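/- **Setting.** Let $n\ge 0$, $r_\infty\ge 1$, $r_1,\dots,r_n\ge 1$ with $g:=r_\infty-3+\sum_s r_s\ge 0$. The times are the positions $X_s$ ($1\le s\le n$), the irregular times $t_{X_s,k}$ ($1\le k\le r_s-1$) and $t_{\infty,k}$ ($1\le k\le r_\infty-1$), with the following values frozen: $t_{\infty,r_\infty-1}=1$, $t_{\infty,r_\infty-2}=0$ if $r_\infty\ge 3$; $t_{\infty,1}=1$, $X_1=0$ if $r_\infty=2$; $X_1=0$, $X_2=1$ if $r_\infty=1,n\ge 2$; $X_1=0$, $t_{X_1,r_1-1}=1$ if $r_\infty=1,n=1$. The $g$ remaining ones are the free times; the constant $t_{\infty,0}$ is the monodromy at infinity. Let $U\subseteq\mathbb C^g$ be an open set of free times on which the $X_s$ are distinct and $t_{X_s,r_s-1}\ne 0$ whenever $r_s\ge 2$. For a direction $\boldsymbol\alpha\in\mathbb C^g$ (components $\alpha_{X_s},\alpha_{X_s,k},\alpha_{\infty,k}$, zero for frozen times) let $\delta^{(\boldsymbol\alpha)}$ be the derivative in the direction $\boldsymbol\alpha$, and $\delta_\tau$ the partial derivative in the free time $\tau$. *Lax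 matrices.* Let $\omega\ne 0$, $q_1,\dots,q_g$ (distinct, and different from the $X_s$) and $p_1,\dots,p_g$ be functions on $U$, put $\sigma=\sum_j q_j-\sum_s r_sX_s$ and $g_0=t_{\infty,r_\infty-2}+t_{\infty,r_\infty-1}\sigma$ if $r_\infty\ge 2$, $g_0=t_{\infty,0}\sigma-\beta_{-1}$ if $r_\infty=1$ ($\beta_{-1}$ a function on $U$), and $$\tilde L_{1,2}(\lambda)=\frac{\omega\prod_j(\lambda-q_j)}{\prod_s(\lambda-X_s)^{r_s}},\qquad \tilde L_{1,1}(\lambda)=\frac{\sum_i p_i\prod_s(q_i-X_s)^{r_s}\prod_{j\ne i}\frac{\lambda-q_j}{q_i-q_j}-(t_{\infty,r_\infty-1}\lambda+g_0)\prod_j(\lambda-q_j)}{\prod_s(\lambda-X_s)^{r_s}} .$$ The coordinates $Q,R$ are the coefficients in $$\tilde L_{1,2}=\sum_{s}\sum_{k=1}^{r_s}\frac{Q_{X_s,k}}{(\lambda-X_s)^k}+\sum_{k=0}^{r_\infty-4}Q_{\infty,k}\lambda^k+\omega\,\delta_{r_\infty\ge3}\lambda^{r_\infty-3},$$ $$\tilde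 L_{1,1}=\sum_{s}\sum_{k=1}^{r_s}\frac{R_{X_s,k}}{(\lambda-X_s)^k}-t_{\infty,r_\infty-1}\delta_{r_\infty\ge2}\lambda^{r_\infty-2}-t_{\infty,r_\infty-2}\delta_{r_\infty\ge3}\lambda^{r_\infty-3}+\sum_{k=0}^{r_\infty-4}R_{\infty,k}\lambda^k .$$ The $R$'s are assumed holomorphic on $U$. Let $M_{X_s}$ and $M_\infty$ be the lower triangular Toeplitz matrices with first columns $(t_{X_s,r_s-1},\dots,t_{X_s,1})$ and $(t_{\infty,r_\infty-1},\dots,t_{\infty,3})$, and set $\nu_{X_s,0}=-\alpha_{X_s}$, $(\nu_{X_s,i})_{1\le i\le r_s-1}=-M_{X_s}^{-1}\big(\tfrac{\alpha_{X_s,r_s-1}}{r_s-1},\dots,\tfrac{\alpha_{X_s,1}}{1}\big)^t$, $(\nu_{\infty,i})_{1\le i\le r_\infty-3}=M_\infty^{-1}\big(\tfrac{\alpha_{\infty,r_\infty-3}}{r_\infty-3},\dots,\tfrac{\alpha_{\infty,1}}{1}\big)^t$. In the oper gauge the first row of the auxiliary matrix is $$A_{1,1}=\tfrac{\mathcal L_{\boldsymbol\alpha}[\omega]}{2\omega}+\tfrac12\nu_{\infty,-1}\delta_{r_\infty=1}-\sum_j\frac{p_j\mu_j}{\lambda-q_j},\qquad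 A_{1,2}=\nu_{\infty,-1}\delta_{r_\infty=1}\lambda+\nu_{\infty,0}\delta_{r_\infty\le2}+\sum_j\frac{\mu_j}{\lambda-q_j},$$ where $\mathcal L_{\boldsymbol\alpha}[\omega]$ does not depend on $\lambda$, and $\mu_j$, $\nu_{\infty,0}$ (if $r_\infty\le2$), $\nu_{\infty,-1}$ (if $r_\infty=1$) are determined by $\sum_j\mu_jq_j^{k}=\nu_{\infty,k+1}$ ($0\le k\le r_\infty-4$) and $\sum_j\mu_j(q_j-X_s)^{-m}=-\nu_{X_s,m-1}+\delta_{m=1}(X_s\nu_{\infty,-1}\delta_{r_\infty=1}+\nu_{\infty,0}\delta_{r_\infty\le2})+\delta_{m=2}\nu_{\infty,-1}\delta_{r_\infty=1}$ ($1\le m\le r_s$). The gauge transformation by $G=\begin{pmatrix}1&0\\ \tilde L_{1,1}&\tilde L_{1,2}\end{pmatrix}$ gives $[\tilde A_{\boldsymbol\alpha}]_{1,1}=A_{1,1}+\tilde L_{1,1}A_{1,2}$. *Systems.* The system at $X_s$ for functions $(W_k)_{1\le k\le r_s}$ on $U$: $W_1$ is annihilated by all $\delta_\tau$; $W_2,\dots,W_{r_s}$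 are annihilated by all $\delta_\tau$ with $\tau$ not one of the $t_{X_s,k}$; and $$M_{X_s}\,\mathrm{diag}\big(\tfrac1{r_s-1},\dots,\tfrac11\big)\,\big(\delta_{t_{X_s,r_s-j}}[W_{r_s+1-i}]\big)_{1\le i,j\le r_s-1}=T(W)\,\mathrm{diag}\big(\tfrac1{r_s-1},\dots,\tfrac11\big),$$ $T(W)$ being lower triangular Toeplitz with first column $(W_{r_s},\dots,W_2)$ (the column of a frozen time is omitted). The system at infinity for $(W_k)_{0\le k\le r_\infty-4}$ (void if $r_\infty\le3$): the $W_k$ are annihilated by all $\delta_\tau$ with $\tau$ not one of the $t_{\infty,k}$; and $$M_\infty\,\mathrm{diag}\big(\tfrac1{r_\infty-3},\dots,\tfrac11\big)\,\big(\delta_{t_{\infty,r_\infty-2-j}}[W_{r_\infty-3-i}]\big)_{1\le i,j\le r_\infty-3}=T_\infty(W)\,\mathrm{diag}\big(\tfrac1{r_\infty-3},\dots,\tfrac11\big),$$ $T_\infty(W)$ being lower triangular Toeplitz with first column $(-1,0,W_{r_\infty-4},\dots,W_2)$. **Theorem.** There are universal functions $f_{i,j}$ ($1\le j\le i\le \rho-1$,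 for each order $\rho\ge2$) and $g_{i,j}$ ($1\le j\le i\le\rho-3$, for each $\rho\ge4$) with the following properties. For $\rho=r_s$, $f_{i,j}$ depends only on $t_{X_s,r_s-1-(i-j)},\dots,t_{X_s,r_s-1}$ and on a choice of $\log t_{X_s,r_s-1}$ (which defines the powers), and $$f_{j,j}=t_{X_s,r_s-1}^{\frac{r_s-j}{r_s-1}},\quad f_{j+1,j}=\tfrac{r_s-j-1}{r_s-2}\,t_{X_s,r_s-1}^{\frac{1-j}{r_s-1}}\,t_{X_s,r_s-2},\quad f_{j,1}=t_{X_s,r_s-j}.$$ For $\rho=r_\infty$, $g_{i,j}$ depends only on $t_{\infty,r_\infty-1-(i-j)},\dots,t_{\infty,r_\infty-3}$, and $g_{j,j}=1$, $g_{j+1,j}=0$, $g_{j+2,j}=\frac{r_\infty-4-j}{r_\infty-3}t_{\infty,r_\infty-3}$, $g_{j+3,j}=\frac{r_\infty-5-j}{r_\infty-4}t_{\infty,r_\infty-4}$. Let $F^{(X_s)}=(f_{i,j})$ and $G^{(\infty)}=(g_{i,j})$ be the corresponding lower triangular matrices. 1. $\delta^{(\boldsymbol\alpha)}\tilde L_{1,1}(\lambda)=\partial_\lambda[\tilde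 A_{\boldsymbol\alpha}(\lambda)]_{1,1}$ holds on $U$ for all $\boldsymbol\alpha$ if and only if $(R_{X_s,k})_{k}$ satisfies the system at $X_s$ for every $s$ and $(R_{\infty,k})_k$ satisfies the system at infinity. 2. Suppose moreover that $U$ is connected and non-empty and fix holomorphic logarithms of the $t_{X_s,r_s-1}$ ($r_s\ge2$) on $U$. For each $s$, holomorphic functions $W_1,\dots,W_{r_s}$ on $U$ satisfy the system at $X_s$ iff $W_1=v_1$ and $(W_{r_s},\dots,W_2)^t=F^{(X_s)}(v_{r_s},\dots,v_2)^t$ for some constants $v_k$. Holomorphic functions $W_0,\dots,W_{r_\infty-4}$ on $U$ satisfy the system at infinity iff $(W_{r_\infty-4},\dots,W_0)^t=-(t_{\infty,r_\infty-3},\dots,t_{\infty,1})^t+G^{(\infty)}(v_{r_\infty-4},\dots,v_0)^t$ for some constants $v_k$. Consequently the condition in 1 holds iff there are constants $v_{X_s,k}$, $v_{\infty,k}$ such that $R_{X_s,1}=v_{X_s,1}$, $(R_{X_s,r_s},\dots,R_{X_s,2})^t=F^{(X_s)}(v_{X_s,r_s},\dots,v_{X_s,2})^t$ for all $s$, and $(R_{\infty,r_\infty-4},\dots,R_{\infty,0})^t=-(t_{\infty,r_\infty-3},\dots,t_{\infty,1})^t+G^{(\infty)}(v_{\infty,r_\infty-4},\dots,v_{\infty,0})^t$.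 3. In the situation of 2, whenever the $R_{X_s,k}$ have this form: if $r_\infty\le2$, then $\sum_sv_{X_s,1}=-t_{\infty,0}$; and if $r_\infty=1$, then on $U$ (with $Q_{X_s,k}=0$ for $k>r_s$) $$\sum_sX_sv_{X_s,1}+\sum_s\sum_{j=1}^{r_s-1}f^{(X_s)}_{r_s-1,j}\,v_{X_s,r_s+1-j}=-g_0-\frac{t_{\infty,0}}{\omega}\sum_s\big(X_s^2Q_{X_s,1}+2X_sQ_{X_s,2}+Q_{X_s,3}\big).$$ -/

import Mathlib

open scoped Matrix

noncomputable section

namespace IsoLax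

/-- Orders of the poles: `n` finite poles of orders `r s ≥ 1`, and a pole at infinity of order
`rInf ≥ 1`.  The total order is at least `3`, so that the genus `g` is a natural number. -/
structure PoleType where
  n : ℕ
  rInf : ℕ
  r : Fin n → ℕ
  one_le_rInf : 1 ≤ rInf
  one_le_r : ∀ s, 1 ≤ r s
  three_le : 3 ≤ rInf + ∑ s, r s

variable (D : PoleType)

/-- `g = r_∞ - 3 + ∑ r_s`, the number of apparent singularities. -/
def PoleType.g : ℕ := D.rInf + ∑ s, D.r s - 3

/-- Labels of `t_{∞,k}` (`1 ≤ k ≤ r_∞ - 3`, label `k - 1`), of `t_{X_s,k}`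
(`1 ≤ k ≤ r_s - 1`, label `k - 1`) and of the positions `X_s`. -/
abbrev AnyTime : Type := Fin (D.rInf - 3) ⊕ (Σ s : Fin D.n, Fin (D.r s - 1)) ⊕ Fin D.n

/-- The labels which are isomonodromic times; the other ones are frozen by the normalization:
`X_1 = 0` if `r_∞ = 2`, `X_1 = 0` and `X_2 = 1` if `r_∞ = 1` and `n ≥ 2`, `X_1 = 0` and
`t_{X_1,r_1-1} = 1` if `r_∞ = 1` and `n = 1`. -/
def IsFree : AnyTime D → Prop
  | Sum.inl _ => True
  | Sum.inr (Sum.inl ⟨s, i⟩) => ¬ (D.rInf = 1 ∧ D.n = 1 ∧ (i : ℕ) + 2 = D.r s)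
  | Sum.inr (Sum.inr s) =>
      3 ≤ D.rInf ∨ (D.rInf = 2 ∧ 1 ≤ (s : ℕ)) ∨ (D.rInf = 1 ∧ 2 ≤ (s : ℕ))

/-- Labels of the isomonodromic times. -/
abbrev IsoTime : Type := {e : AnyTime D // IsFree D e}

instance : Fintype (IsoTime D) := Fintype.ofFinite _

/-- The space `ℂ^g` of isomonodromic times.  Deformation directions `α` live in the same space. -/
abbrev Times : Type := IsoTime D → ℂ

variable {D}

open Classical in
/-- The coordinate of `x` with label `e`, replaced by `d` if that label is frozen. -/
def coordOr (d : ℂ) (x : Times D) (e : AnyTime D) : ℂ :=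
  if h : IsFree D e then x ⟨e, h⟩ else d

open Classical in
/-- Unit vector in the direction with label `e` (zero if that label is frozen). -/
def unitDir (e : AnyTime D) : Times D :=
  if h : IsFree D e then Pi.single ⟨e, h⟩ 1 else 0

/-- `t_{∞,k}`, with `t_{∞,0} = θ` the monodromy at infinity, and with the normalization
`t_{∞,r_∞-1} = 1` if `r_∞ ≥ 2`, `t_{∞,r_∞-2} = 0` if `r_∞ ≥ 3`. -/
def tInf (θ : ℂ) (τ : Times D) (k : ℕ) : ℂ :=
  if k = 0 then θ
  else if k + 1 = D.rInf then 1
  else if k + 2 = D.rInf then 0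
  else if h : k - 1 < D.rInf - 3 then coordOr 0 τ (Sum.inl ⟨k - 1, h⟩) else 0

/-- `t_{X_s,k}` for `1 ≤ k ≤ r_s - 1`. -/
def tPole (τ : Times D) (s : Fin D.n) (k : ℕ) : ℂ :=
  if h : 1 ≤ k ∧ k - 1 < D.r s - 1 then coordOr 1 τ (Sum.inr (Sum.inl ⟨s, ⟨k - 1, h.2⟩⟩)) else 0

/-- The position `X_s`. -/
def pos (τ : Times D) (s : Fin D.n) : ℂ :=
  coordOr (if (s : ℕ) = 0 then 0 else 1) τ (Sum.inr (Sum.inr s))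

/-- The derivation `δ^{(α)}`: the derivative in the direction `α` of a function of the times,
the Darboux coordinates being frozen. -/
def delta (α : Times D) (F : Times D → ℂ) (τ : Times D) : ℂ := fderiv ℂ F τ α

/-- A family of Lax data over the space of times: the monodromy `t_{∞,0}`, the normalization `ω`,
the oper Darboux coordinates `(q, p)`, the subleading coefficient `β_{-1}` at infinity of the
`(1,1)` entry (used only if `r_∞ = 1`), and the value `dω τ α` of the derivative of `ω` along the
isomonodromic flow of direction `α`. -/
structure LaxFamily (D : PoleType) where
  θ : ℂ
  ω : Times D → ℂ
  q : Fin D.g → Times D → ℂ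
  p : Fin D.g → Times D → ℂ
  β : Times D → ℂ
  dω : Times D → Times D → ℂ

/-- Genericity over `U`: `ω ≠ 0`, distinct poles, non-vanishing leading irregular times at the
finite irregular poles, distinct apparent singularities away from the poles. -/
structure LaxFamily.Generic (F : LaxFamily D) (U : Set (Times D)) : Prop where
  omega_ne : ∀ τ ∈ U, F.ω τ ≠ 0
  pos_inj : ∀ τ ∈ U, Function.Injective (pos τ)
  lead_ne : ∀ τ ∈ U, ∀ s, 2 ≤ D.r s → tPole τ s (D.r s - 1) ≠ 0
  q_inj : ∀ τ ∈ U, Function.Injective fun j => F.q j τ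
  q_ne_pos : ∀ τ ∈ U, ∀ j s, F.q j τ ≠ pos τ s

/-- `∏_s (z - X_s)^{r_s}`. -/
def poleProd (τ : Times D) (z : ℂ) : ℂ := ∏ s, (z - pos τ s) ^ D.r s

namespace LaxFamily

variable (F : LaxFamily D)

/-- `∑_j q_j - ∑_s r_s X_s`. -/
def shift (τ : Times D) : ℂ := ∑ j, F.q j τ - ∑ s, (D.r s : ℂ) * pos τ s

/-- The coefficient `g_0`. -/
def g0 (τ : Times D) : ℂ :=
  if 2 ≤ D.rInf then tInf F.θ τ (D.rInf - 2) + tInf F.θ τ (D.rInf - 1) * F.shift τ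
  else F.θ * F.shift τ - F.β τ

/-- The polynomial `Q(z)` of degree less than `g` with
`Q(q_i) = - p_i ∏_s (q_i - X_s)^{r_s}`. -/
def interp (τ : Times D) (z : ℂ) : ℂ :=
  -∑ i, F.p i τ * poleProd τ (F.q i τ) *
    ∏ j ∈ Finset.univ.erase i, (z - F.q j τ) / (F.q i τ - F.q j τ)

/-- Entry `(1,1)` of the geometric Lax matrix, normalized at infinity. -/
def L11 (τ : Times D) (z : ℂ) : ℂ :=
  (-F.interp τ z - (tInf F.θ τ (D.rInf - 1) * z + F.g0 τ) * ∏ j, (z - F.q j τ)) / poleProd τ z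

/-- Entry `(1,2)` of the geometric Lax matrix, normalized at infinity. -/
def L12 (τ : Times D) (z : ℂ) : ℂ := F.ω τ * (∏ j, (z - F.q j τ)) / poleProd τ z

/-- The gauge matrix `G` from the geometric gauge to the oper gauge. -/
def gauge (τ : Times D) (z : ℂ) : Matrix (Fin 2) (Fin 2) ℂ :=
  !![1, 0; F.L11 τ z, F.L12 τ z]

/-- `Q` and `QInf` are the coordinates `Q_{X_s,k}` (`1 ≤ k ≤ r_s`) and `Q_{∞,k}`
(`0 ≤ k ≤ r_∞ - 4`) of the family over `U`: the coefficients of the entry `(1,2)`. -/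
def IsCoordQ (U : Set (Times D)) (Q : Fin D.n → ℕ → Times D → ℂ) (QInf : ℕ → Times D → ℂ) :
    Prop :=
  ∀ τ ∈ U, ∀ z : ℂ, (∀ s, z ≠ pos τ s) →
    F.L12 τ z = ∑ s, ∑ k ∈ Finset.Icc 1 (D.r s), Q s k τ / (z - pos τ s) ^ k
      + ∑ k ∈ Finset.range (D.rInf - 3), QInf k τ * z ^ k
      + (if 3 ≤ D.rInf then F.ω τ * z ^ (D.rInf - 3) else 0)

/-- `R` and `RInf` are the coordinates `R_{X_s,k}` (`1 ≤ k ≤ r_s`) and `R_{∞,k}`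
(`0 ≤ k ≤ r_∞ - 4`) of the family over `U`: the coefficients of the entry `(1,1)`. -/
def IsCoordR (U : Set (Times D)) (R : Fin D.n → ℕ → Times D → ℂ) (RInf : ℕ → Times D → ℂ) :
    Prop :=
  ∀ τ ∈ U, ∀ z : ℂ, (∀ s, z ≠ pos τ s) →
    F.L11 τ z = ∑ s, ∑ k ∈ Finset.Icc 1 (D.r s), R s k τ / (z - pos τ s) ^ k
      - (if 2 ≤ D.rInf then tInf F.θ τ (D.rInf - 1) * z ^ (D.rInf - 2) else 0)
      - (if 3 ≤ D.rInf then tInf F.θ τ (D.rInf - 2) * z ^ (D.rInf - 3) else 0)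
      + ∑ k ∈ Finset.range (D.rInf - 3), RInf k τ * z ^ k

end LaxFamily

/-- The lower triangular Toeplitz matrix `M_{X_s}` with first column
`t_{X_s,r_s-1}, …, t_{X_s,1}`. -/
def MPole (τ : Times D) (s : Fin D.n) : Matrix (Fin (D.r s - 1)) (Fin (D.r s - 1)) ℂ :=
  Matrix.of fun i j => if j ≤ i then tPole τ s (D.r s - 1 - ((i : ℕ) - j)) else 0

/-- The lower triangular Toeplitz matrix `M_∞` with first column
`t_{∞,r_∞-1}, …, t_{∞,3}`. -/
def MInf (θ : ℂ) (τ : Times D) : Matrix (Fin (D.rInf - 3)) (Fin (D.rInf - 3)) ℂ :=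
  Matrix.of fun i j => if j ≤ i then tInf θ τ (D.rInf - 1 - ((i : ℕ) - j)) else 0

/-- `diag (1/m, 1/(m-1), …, 1/1)`. -/
def invDiag (m : ℕ) : Matrix (Fin m) (Fin m) ℂ :=
  Matrix.diagonal fun i => 1 / ((m - (i : ℕ) : ℕ) : ℂ)

/-- `ν_{X_s,i}^{(α)}` for `0 ≤ i ≤ r_s - 1`. -/
def nuPole (τ α : Times D) (s : Fin D.n) (i : ℕ) : ℂ :=
  if i = 0 then -coordOr 0 α (Sum.inr (Sum.inr s))
  else if h : i - 1 < D.r s - 1 then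
    -((MPole τ s)⁻¹ *ᵥ (invDiag (D.r s - 1) *ᵥ
      fun j => coordOr 0 α (Sum.inr (Sum.inl ⟨s, Fin.rev j⟩)))) ⟨i - 1, h⟩
  else 0

/-- `ν_{∞,i}^{(α)}` for `1 ≤ i ≤ r_∞ - 3`. -/
def nuInf (θ : ℂ) (τ α : Times D) (i : ℕ) : ℂ :=
  if h : i - 1 < D.rInf - 3 then
    ((MInf θ τ)⁻¹ *ᵥ (invDiag (D.rInf - 3) *ᵥ
      fun j => coordOr 0 α (Sum.inl (Fin.rev j)))) ⟨i - 1, h⟩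
  else 0

/-- The unknowns in the first row of the auxiliary matrix in the oper gauge: the residues `μ_j` at
the apparent singularities, and `ν_{∞,-1}`, `ν_{∞,0}` (absent if `r_∞ ≥ 2`, resp. `r_∞ ≥ 3`). -/
structure AuxCoeff (D : PoleType) where
  μ : Fin D.g → ℂ
  νm1 : ℂ
  ν0 : ℂ

namespace AuxCoeff

variable (c : AuxCoeff D)

/-- `ν_{∞,-1} δ_{r_∞ = 1}`. -/
def a : ℂ := if D.rInf = 1 then c.νm1 else 0

/-- `ν_{∞,0} δ_{r_∞ ≤ 2}`. -/
def b : ℂ := if D.rInf ≤ 2 then c.ν0 else 0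

/-- The (Vandermonde type) linear system which determines the unknowns. -/
def Solves (F : LaxFamily D) (τ α : Times D) : Prop :=
  (∀ k < D.rInf - 3, ∑ j, c.μ j * F.q j τ ^ k = nuInf F.θ τ α (k + 1)) ∧
  ∀ s, ∀ m ∈ Finset.Icc 1 (D.r s), ∑ j, c.μ j / (F.q j τ - pos τ s) ^ m =
    -(nuPole τ α s (m - 1) - (if m = 1 then pos τ s * c.a + c.b else 0)
      - (if m = 2 then c.a else 0))

/-- First row of the auxiliary matrix `A_α(z)` in the oper gauge. -/
def operRow (F : LaxFamily D) (τ α : Times D) (z : ℂ) : Fin 2 → ℂ :=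
  ![F.dω τ α / (2 * F.ω τ) + c.a / 2 - ∑ j, F.p j τ * c.μ j / (z - F.q j τ),
    c.a * z + c.b + ∑ j, c.μ j / (z - F.q j τ)]

/-- Entry `(1,1)` of the auxiliary matrix `Ã_α(z)` in the geometric gauge.  It is defined by
`G Ã_α = A_α G - 𝓛_α[G]`; since the first row of `G` is `(1, 0)`, the first row of `Ã_α` is the
first row of `A_α G`. -/
def A11 (F : LaxFamily D) (τ α : Times D) (z : ℂ) : ℂ :=
  (c.operRow F τ α z ᵥ* F.gauge τ z) 0

end AuxCoeff

/-- Entry `(1,1)` of the isospectral condition `δ^{(α)} L̃(z) = ∂_z Ã_α(z)` over `U`, for all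
directions `α`. -/
def Isospectral11 (F : LaxFamily D) (U : Set (Times D)) : Prop :=
  ∀ τ ∈ U, ∀ α : Times D, ∃ c : AuxCoeff D, c.Solves F τ α ∧
    ∀ z : ℂ, (∀ s, z ≠ pos τ s) → (∀ j, z ≠ F.q j τ) →
      delta α (fun τ' => F.L11 τ' z) τ = deriv (fun w => c.A11 F τ α w) z

/-- The lower triangular Toeplitz matrix with first column `W_{r_s}, …, W_2`. -/
def toepPole (s : Fin D.n) (W : ℕ → Times D → ℂ) (τ : Times D) :
    Matrix (Fin (D.r s - 1)) (Fin (D.r s - 1)) ℂ :=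
  Matrix.of fun i j => if j ≤ i then W (D.r s - ((i : ℕ) - j)) τ else 0

/-- Row `i`, column `j` (counted from `0`): `δ_{t_{X_s,r_s-1-j}} [W_{r_s-i}]`. -/
def derivPole (s : Fin D.n) (W : ℕ → Times D → ℂ) (τ : Times D) :
    Matrix (Fin (D.r s - 1)) (Fin (D.r s - 1)) ℂ :=
  Matrix.of fun i j =>
    delta (unitDir (Sum.inr (Sum.inl ⟨s, Fin.rev j⟩))) (W (D.r s - (i : ℕ))) τ

/-- The differential system at the finite pole `X_s` for `(W_k)_{1 ≤ k ≤ r_s}`: `W_1` is constant,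
`W_2, …, W_{r_s}` depend on the times `t_{X_s,k}` only, and the matrix equation holds
(columns of frozen times being absent). -/
def PoleSystem (U : Set (Times D)) (s : Fin D.n) (W : ℕ → Times D → ℂ) : Prop :=
  ∀ τ ∈ U,
    (∀ α : Times D, delta α (W 1) τ = 0) ∧
    (∀ e : IsoTime D, (∀ i, e.1 ≠ Sum.inr (Sum.inl ⟨s, i⟩)) →
      ∀ k ∈ Finset.Icc 2 (D.r s), delta (unitDir e.1) (W k) τ = 0) ∧
    ∀ j : Fin (D.r s - 1), IsFree D (Sum.inr (Sum.inl ⟨s, Fin.rev j⟩)) → ∀ i,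
      (MPole τ s * invDiag (D.r s - 1) * derivPole s W τ) i j =
        (toepPole s W τ * invDiag (D.r s - 1)) i j

/-- The lower triangular Toeplitz matrix with first column
`-1, 0, W_{r_∞-4}, …, W_2`. -/
def toepInf (W : ℕ → Times D → ℂ) (τ : Times D) :
    Matrix (Fin (D.rInf - 3)) (Fin (D.rInf - 3)) ℂ :=
  Matrix.of fun i j => if i = j then -1
    else if (j : ℕ) + 2 ≤ i then W (D.rInf - 2 - ((i : ℕ) - j)) τ else 0

/-- Row `i`, column `j` (counted from `0`): `δ_{t_{∞,r_∞-3-j}} [W_{r_∞-4-i}]`. -/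
def derivInf (W : ℕ → Times D → ℂ) (τ : Times D) :
    Matrix (Fin (D.rInf - 3)) (Fin (D.rInf - 3)) ℂ :=
  Matrix.of fun i j => delta (unitDir (Sum.inl (Fin.rev j))) (W (Fin.rev i : ℕ)) τ

/-- The differential system at infinity for `(W_k)_{0 ≤ k ≤ r_∞-4}` (void if `r_∞ ≤ 3`): these
functions depend on the times `t_{∞,k}` only, and the matrix equation holds. -/
def InfSystem (θ : ℂ) (U : Set (Times D)) (W : ℕ → Times D → ℂ) : Prop :=
  ∀ τ ∈ U,
    (∀ e : IsoTime D, (∀ i, e.1 ≠ Sum.inl i) →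
      ∀ k < D.rInf - 3, delta (unitDir e.1) (W k) τ = 0) ∧
    MInf θ τ * invDiag (D.rInf - 3) * derivInf W τ = toepInf W τ * invDiag (D.rInf - 3)

/-- A holomorphic determination of the logarithms of the leading irregular times at the finite
irregular poles. -/
def IsLogBranch (U : Set (Times D)) (ℓ : Fin D.n → Times D → ℂ) : Prop :=
  ∀ s, 2 ≤ D.r s → DifferentiableOn ℂ (ℓ s) U ∧
    ∀ τ ∈ U, Complex.exp (ℓ s τ) = tPole τ s (D.r s - 1)

/-- `W_1 = v_1` and `(W_{r_s}, …, W_2) = F (v_{r_s}, …, v_2)` with `v` constant and `F` lower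
triangular with entries `f_{i,j}`, `1 ≤ j ≤ i ≤ r_s - 1`.  The table `f` takes the order `r_s`, the
indices `i, j`, the logarithm of the leading time, and the times. -/
def PoleForm (f : ℕ → ℕ → ℕ → ℂ → (ℕ → ℂ) → ℂ) (U : Set (Times D)) (s : Fin D.n)
    (l : Times D → ℂ) (W : ℕ → Times D → ℂ) (v : ℕ → ℂ) : Prop :=
  ∀ τ ∈ U, W 1 τ = v 1 ∧
    ∀ i ∈ Finset.Icc 1 (D.r s - 1), W (D.r s + 1 - i) τ =
      ∑ j ∈ Finset.Icc 1 i, f (D.r s) i j (l τ) (tPole τ s) * v (D.r s + 1 - j)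

/-- `(W_{r_∞-4}, …, W_0) = -(t_{∞,r_∞-3}, …, t_{∞,1}) + G (v_{r_∞-4}, …, v_0)` with `v` constant and
`G` lower triangular with entries `g_{i,j}`, `1 ≤ j ≤ i ≤ r_∞ - 3`.  The table `g` takes the order
`r_∞`, the indices `i, j`, and the times. -/
def InfForm (g : ℕ → ℕ → ℕ → (ℕ → ℂ) → ℂ) (θ : ℂ) (U : Set (Times D))
    (W : ℕ → Times D → ℂ) (v : ℕ → ℂ) : Prop :=
  ∀ τ ∈ U, ∀ i ∈ Finset.Icc 1 (D.rInf - 3), W (D.rInf - 3 - i) τ =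
    -tInf θ τ (D.rInf - 2 - i) +
      ∑ j ∈ Finset.Icc 1 i, g D.rInf i j (tInf θ τ) * v (D.rInf - 3 - j)

/-- Dependence and explicit entries of the table `f`, for a pole of order `ρ`:
`f_{i,j}` depends on `t_{ρ-1-(i-j)}, …, t_{ρ-1}` only (and on the chosen logarithm `l` of
`t_{ρ-1}`). -/
def PoleTable (f : ℕ → ℕ → ℕ → ℂ → (ℕ → ℂ) → ℂ) : Prop :=
  ∀ ρ, 2 ≤ ρ →
    (∀ i j, 1 ≤ j → j ≤ i → i ≤ ρ - 1 → ∀ (l : ℂ) (t t' : ℕ → ℂ),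
      (∀ k, ρ - 1 - (i - j) ≤ k → k ≤ ρ - 1 → t k = t' k) → f ρ i j l t = f ρ i j l t') ∧
    ∀ (l : ℂ) (t : ℕ → ℂ), Complex.exp l = t (ρ - 1) →
      (∀ j, 1 ≤ j → j ≤ ρ - 1 →
        f ρ j j l t = Complex.exp (((ρ : ℂ) - j) / ((ρ : ℂ) - 1) * l)) ∧
      (∀ j, 1 ≤ j → j ≤ ρ - 2 →
        f ρ (j + 1) j l t = ((ρ : ℂ) - j - 1) / ((ρ : ℂ) - 2) *
          Complex.exp ((1 - (j : ℂ)) / ((ρ : ℂ) - 1) * l) * t (ρ - 2)) ∧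
      (∀ j, 1 ≤ j → j ≤ ρ - 1 → f ρ j 1 l t = t (ρ - j))

/-- Dependence and explicit entries of the table `g`, for a pole at infinity of order `ρ`: the
matrix is unipotent, `g_{j+1,j} = 0`, and `g_{i,j}` depends on `t_{ρ-1-(i-j)}, …, t_{ρ-3}` only. -/
def InfTable (g : ℕ → ℕ → ℕ → (ℕ → ℂ) → ℂ) : Prop :=
  ∀ ρ, 4 ≤ ρ →
    (∀ i j, 1 ≤ j → j ≤ i → i ≤ ρ - 3 → ∀ t t' : ℕ → ℂ,
      (∀ k, ρ - 1 - (i - j) ≤ k → k ≤ ρ - 3 → t k = t' k) → g ρ i j t = g ρ i j t') ∧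
    ∀ t : ℕ → ℂ,
      (∀ j, 1 ≤ j → j ≤ ρ - 3 → g ρ j j t = 1) ∧
      (∀ j, 1 ≤ j → j + 1 ≤ ρ - 3 → g ρ (j + 1) j t = 0) ∧
      (∀ j, 1 ≤ j → j + 2 ≤ ρ - 3 →
        g ρ (j + 2) j t = ((ρ : ℂ) - 4 - j) / ((ρ : ℂ) - 3) * t (ρ - 3)) ∧
      (∀ j, 1 ≤ j → j + 3 ≤ ρ - 3 →
        g ρ (j + 3) j t = ((ρ : ℂ) - 5 - j) / ((ρ : ℂ) - 4) * t (ρ - 4))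

/-- `∑_s (X_s^2 Q_{X_s,1} + 2 X_s Q_{X_s,2} + Q_{X_s,3})`, with `Q_{X_s,k} = 0` for `k > r_s`. -/
def thirdMoment (Q : Fin D.n → ℕ → Times D → ℂ) (τ : Times D) : ℂ :=
  ∑ s, (pos τ s ^ 2 * Q s 1 τ + (if 2 ≤ D.r s then 2 * pos τ s * Q s 2 τ else 0)
    + (if 3 ≤ D.r s then Q s 3 τ else 0))

end IsoLax

end

/-! Write `θ = x d/dx` for formal power series and `δ` for a derivative in the times.

The isospectral condition. For fixed times, `L11` and the `(1,1)` entry of the auxiliary matrix are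
rational in the spectral variable, so the condition is an equality of partial fractions. The linear
system for the `μ_j` says that the `(1,2)` entry of the oper auxiliary matrix has the Taylor
expansion `∑ ν_{X_s,i} (z - X_s)^i` at `X_s` up to order `r_s - 1`, and that the moments of its
simple fractions are the `ν_{∞,i}`. Since `L11(q_j) = p_j`, the poles at the apparent singularities
cancel, and up to a constant in `z` the entry is a truncated product of `L11` with these expansions
(`AuxCoeff.A11_eq`). After differentiation in `z`, the terms coming from `ν_{X_s,0} = -δX_s` match
those created in `δ L11` by the motion of the poles. What remains is a convolution with `ν`; as `ν`
is the inverse of a Toeplitz matrix applied to the direction, multiplying by that matrix gives the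
differential systems (`principal_eq_zero_iff`, `polynomial_eq_zero_iff`). The unknowns exist because
their square linear system is injective (`affineFraction_eq_zero`).

The general solution. At a finite pole put `L = N = r_s - 1`, `P = ∑ L/(L-n) t_{L-n} x^n` and `Y = ∑
W_{r_s-i} x^i`. Then `L P - θP` is `L` times the generating series of the Toeplitz matrix, and the
system becomes `(L P - θP) ∑ δY_i/(N-i) x^i = Y δP` modulo `x^N`. For each `j < N` it is solved by
`Y = x^j (C - θC/(N-j))` with `C = P^{(N-j)/L}`, because `P θC` and `P δC` are the same multiple of
`C θP` and `C δP`. These solutions form a lower triangular matrix with non-vanishing diagonal, and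
the triangular shape of the system shows that there are no others (`levelSystem_iff`). At infinity
the same holds with `L = r_∞ - 1`, `N = r_∞ - 3`, once `t_{∞,k+1}` is added to `W_k`
(`infEq_iff_levelSystem`); there `P` starts with `1 + 0 x`, so no logarithm is needed.

The additional relations. Adding `(t z + g_0)/ω` times `L12` to `L11`, with `t = t_{∞,r_∞-1}`,
leaves only the interpolation term, which is of lower order at infinity. Expanding this identity at
infinity gives the relations (`residue_sum_of_rInf_eq_two`, `moments_of_rInf_eq_one`). -/

namespace IsoLax

/-! ### Complex powers of formal power series and their derivatives in parameters. -/

open PowerSeries in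
/-- The Euler derivation `x d/dx` of formal power series. -/
noncomputable def eulerDer : Derivation ℂ (PowerSeries ℂ) (PowerSeries ℂ) :=
  (X : PowerSeries ℂ) • derivative ℂ

theorem coeff_eulerDer (f : PowerSeries ℂ) (n : ℕ) :
    (eulerDer f).coeff n = n * f.coeff n := by
  cases n with
  | zero => simp [eulerDer]
  | succ n =>
    simp only [eulerDer, Derivation.smul_apply, smul_eq_mul]
    rw [PowerSeries.coeff_succ_X_mul, PowerSeries.coeff_derivative]
    push_cast
    ring

theorem coeff_mk_mul_mk (a b : ℕ → ℂ) (n : ℕ) :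
    (PowerSeries.mk a * PowerSeries.mk b).coeff n =
      ∑ i ∈ Finset.range (n + 1), a (n - i) * b i := by
  rw [mul_comm, PowerSeries.coeff_mul,
    Finset.Nat.sum_antidiagonal_eq_sum_range_succ_mk]
  simp [mul_comm]

theorem coeff_mul_of_coeff_lt_eq_zero {A B : PowerSeries ℂ} {n : ℕ}
    (h : ∀ j < n, B.coeff j = 0) : (A * B).coeff n = A.coeff 0 * B.coeff n := by
  rw [PowerSeries.coeff_mul, Finset.sum_eq_single (0, n)]
  · rintro ⟨i, j⟩ hij hne
    rw [Finset.HasAntidiagonal.mem_antidiagonal] at hij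
    simp only at hij ⊢
    rw [h j, mul_zero]
    rcases Nat.lt_or_ge j n with h1 | h1
    · exact h1
    · exact absurd (by ext <;> simp <;> omega) hne
  · simp

/-- A series killed by `P θ - s (θ P)`, `θ = x d/dx`, and without constant term vanishes. -/
theorem eq_zero_of_eulerDer {P E : PowerSeries ℂ} {s : ℂ} (hP : P.coeff 0 ≠ 0)
    (h0 : E.coeff 0 = 0) (h : P * eulerDer E = PowerSeries.C s * eulerDer P * E) : E = 0 := by
  ext n
  induction n using Nat.strong_induction_on with
  | _ n ih =>
    rcases Nat.eq_zero_or_pos n with rfl | hn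
    · simpa using h0
    -- At the lowest surviving degree `n` the left side contributes `p_0 n e_n`, while the right
    -- side is multiplied by the constant term of `θP`, which is zero.
    have h1 := congrArg (PowerSeries.coeff n) h
    rw [coeff_mul_of_coeff_lt_eq_zero (n := n) (B := E) (by simpa using ih),
      coeff_mul_of_coeff_lt_eq_zero (n := n) (B := eulerDer E)
        (fun j hj => by rw [coeff_eulerDer, ih j hj]; simp), coeff_eulerDer] at h1
    rw [PowerSeries.coeff_C_mul, coeff_eulerDer] at h1
    have h2 : (n : ℂ) ≠ 0 := by exact_mod_cast hn.ne'
    simp only [CharP.cast_eq_zero, zero_mul, mul_zero] at h1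
    have hP' : PowerSeries.constantCoeff P ≠ 0 := by simpa using hP
    simpa [hP', h2] using h1

/-- Coefficients of `(∑ p_n x^n)^s`, where `p_0 = exp l`. -/
noncomputable def rpowCoeff (s l : ℂ) (p : ℕ → ℂ) : ℕ → ℂ
  | 0 => Complex.exp (s * l)
  | n + 1 => (∑ k : Fin (n + 1), (s * ((k : ℕ) + 1) - ((n - (k : ℕ) : ℕ) : ℂ)) * p ((k : ℕ) + 1) *
      rpowCoeff s l p (n - (k : ℕ))) / ((n + 1) * Complex.exp l)
termination_by n => n
decreasing_by omega

theorem rpowCoeff_zero (s l : ℂ) (p : ℕ → ℂ) : rpowCoeff s l p 0 = Complex.exp (s * l) := by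
  rw [rpowCoeff]

theorem rpowCoeff_succ (s l : ℂ) (p : ℕ → ℂ) (n : ℕ) : rpowCoeff s l p (n + 1) =
    (∑ k ∈ Finset.range (n + 1), (s * (k + 1) - ((n - k : ℕ) : ℂ)) * p (k + 1) *
      rpowCoeff s l p (n - k)) / ((n + 1) * Complex.exp l) := by
  rw [rpowCoeff, Finset.sum_range]

theorem rpowCoeff_congr {s l : ℂ} {p p' : ℕ → ℂ} (n : ℕ)
    (h : ∀ k, 1 ≤ k → k ≤ n → p k = p' k) : rpowCoeff s l p n = rpowCoeff s l p' n := by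
  induction n using Nat.strong_induction_on with
  | _ n ih =>
    cases n with
    | zero => simp only [rpowCoeff_zero]
    | succ n =>
      simp only [rpowCoeff_succ]
      congr 1
      refine Finset.sum_congr rfl fun k hk => ?_
      rw [Finset.mem_range] at hk
      rw [h (k + 1) (by omega) (by omega), ih (n - k) (by omega)
        fun j hj hj' => h j hj (by omega)]

/-- The recursion defining the coefficients is this equation read degree by degree, solved for the
newest coefficient; in degree `0` both sides vanish. It is the equation `P θC = s θP C` of `C =
P^s`. -/
theorem mk_mul_eulerDer_rpowCoeff {s l : ℂ} {p : ℕ → ℂ} (hp : p 0 = Complex.exp l) :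
    PowerSeries.mk p * eulerDer (PowerSeries.mk (rpowCoeff s l p)) =
      PowerSeries.C s * eulerDer (PowerSeries.mk p) * PowerSeries.mk (rpowCoeff s l p) := by
  have hE : ∀ a : ℕ → ℂ, eulerDer (PowerSeries.mk a) = PowerSeries.mk fun n => n * a n := by
    intro a; ext n; simp [coeff_eulerDer]
  ext n
  rw [hE, hE, mul_assoc, PowerSeries.coeff_C_mul, mul_comm (PowerSeries.mk p),
    mul_comm (PowerSeries.mk fun n => (n : ℂ) * p n), coeff_mk_mul_mk, coeff_mk_mul_mk]
  cases n with
  | zero => simp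
  | succ n =>
    rw [Finset.sum_range_succ' _ (n + 1), Finset.sum_range_succ' _ (n + 1)]
    have h1 : ((n : ℂ) + 1) ≠ 0 := by exact_mod_cast Nat.succ_ne_zero n
    have h2 := rpowCoeff_succ s l p n
    rw [eq_div_iff (mul_ne_zero h1 (Complex.exp_ne_zero l))] at h2
    simp only [Nat.sub_zero, hp, CharP.cast_eq_zero, zero_mul, mul_zero, add_zero]
    push_cast
    have h3 : (n + 1 : ℂ) * rpowCoeff s l p (n + 1) * Complex.exp l =
        rpowCoeff s l p (n + 1) * ((n + 1) * Complex.exp l) := by ring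
    rw [h3, h2, Finset.mul_sum, ← Finset.sum_add_distrib]
    refine Finset.sum_congr rfl fun k hk => ?_
    ring

/-- `P` and its first power solve the same Euler equation with the same constant term, so uniqueness
applies to their difference. -/
theorem rpowCoeff_one {l : ℂ} {p : ℕ → ℂ} (hp : p 0 = Complex.exp l) (n : ℕ) :
    rpowCoeff 1 l p n = p n := by
  have h0 : (PowerSeries.mk p).coeff 0 ≠ 0 := by simp [hp, Complex.exp_ne_zero]
  have h := eq_zero_of_eulerDer (s := 1) (P := PowerSeries.mk p)
    (E := PowerSeries.mk (rpowCoeff 1 l p) - PowerSeries.mk p) h0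
    (by simp [rpowCoeff_zero, hp]) (by
      rw [map_sub, mul_sub, mk_mul_eulerDer_rpowCoeff hp, map_one]; ring)
  have h2 := congrArg (PowerSeries.coeff n) h
  simpa [sub_eq_zero] using h2

theorem rpowCoeff_idx_one (s l : ℂ) (p : ℕ → ℂ) :
    rpowCoeff s l p 1 = s * Complex.exp ((s - 1) * l) * p 1 := by
  rw [rpowCoeff_succ]
  simp [rpowCoeff_zero, sub_mul, Complex.exp_sub]
  ring

section Deriv

variable {E : Type*} [NormedAddCommGroup E] [NormedSpace ℂ E]

theorem fderiv_coeff_mul {a b : ℕ → E → ℂ} {x : E} (ha : ∀ n, DifferentiableAt ℂ (a n) x)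
    (hb : ∀ n, DifferentiableAt ℂ (b n) x) (v : E) (n : ℕ) :
    fderiv ℂ (fun y => (PowerSeries.mk (fun n => a n y) * PowerSeries.mk fun n => b n y).coeff n) x v
      = (PowerSeries.mk (fun n => fderiv ℂ (a n) x v) * PowerSeries.mk (fun n => b n x) +
        PowerSeries.mk (fun n => a n x) * PowerSeries.mk fun n => fderiv ℂ (b n) x v).coeff n := by
  simp only [coeff_mk_mul_mk, map_add]
  rw [fderiv_fun_sum (fun i _ => (ha _).fun_mul (hb _)), sum_apply,
    ← Finset.sum_add_distrib]
  refine Finset.sum_congr rfl fun i _ => ?_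
  rw [fderiv_fun_mul (ha _) (hb _)]
  simp
  ring

theorem differentiableAt_rpowCoeff {s : ℂ} {l : E → ℂ} {p : ℕ → E → ℂ} {x : E}
    (hl : DifferentiableAt ℂ l x) (hp : ∀ n, DifferentiableAt ℂ (p n) x) (n : ℕ) :
    DifferentiableAt ℂ (fun y => rpowCoeff s (l y) (fun n => p n y) n) x := by
  induction n using Nat.strong_induction_on with
  | _ n ih =>
    cases n with
    | zero => simp only [rpowCoeff_zero]; fun_prop
    | succ n =>
      simp only [rpowCoeff_succ]
      have hnum : DifferentiableAt ℂ (fun y => ∑ k ∈ Finset.range (n + 1),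
          (s * (k + 1) - ((n - k : ℕ) : ℂ)) * p (k + 1) y *
            rpowCoeff s (l y) (fun n => p n y) (n - k)) x :=
        DifferentiableAt.fun_sum fun k hk => ((hp _).const_mul _).mul (ih _ (by omega))
      have hden : DifferentiableAt ℂ (fun y => ((n : ℂ) + 1) * Complex.exp (l y)) x := by fun_prop
      have hne : ((n : ℂ) + 1) * Complex.exp (l x) ≠ 0 :=
        mul_ne_zero (by exact_mod_cast Nat.succ_ne_zero n) (Complex.exp_ne_zero _)
      simp only [div_eq_mul_inv]
      exact hnum.fun_mul (hden.fun_inv hne)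

/-- `P δ(P^s) = s P^s δP`. -/
theorem mk_mul_fderiv_rpowCoeff {s : ℂ} {l : E → ℂ} {p : ℕ → E → ℂ} {x : E}
    (hl : DifferentiableAt ℂ l x) (hp : ∀ n, DifferentiableAt ℂ (p n) x)
    (h0 : ∀ᶠ y in nhds x, p 0 y = Complex.exp (l y)) (v : E) :
    PowerSeries.mk (fun n => p n x) *
        PowerSeries.mk (fun n => fderiv ℂ (fun y => rpowCoeff s (l y) (fun n => p n y) n) x v) =
      PowerSeries.C s * PowerSeries.mk (fun n => rpowCoeff s (l x) (fun n => p n x) n) *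
        PowerSeries.mk (fun n => fderiv ℂ (p n) x v) := by
  have hE : ∀ a : ℕ → ℂ, eulerDer (PowerSeries.mk a) = PowerSeries.mk fun n => n * a n := by
    intro a; ext n; simp [coeff_eulerDer]
  set c : ℕ → E → ℂ := fun n y => rpowCoeff s (l y) (fun n => p n y) n with hc
  have hcd : ∀ n, DifferentiableAt ℂ (c n) x := fun n => differentiableAt_rpowCoeff hl hp n
  set P := PowerSeries.mk (fun n => p n x) with hP
  set dP := PowerSeries.mk (fun n => fderiv ℂ (p n) x v) with hdP
  set C := PowerSeries.mk (fun n => c n x) with hC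
  set dC := PowerSeries.mk (fun n => fderiv ℂ (c n) x v) with hdC
  have h0x : p 0 x = Complex.exp (l x) := h0.self_of_nhds
  have key : P * eulerDer C = PowerSeries.C s * eulerDer P * C := mk_mul_eulerDer_rpowCoeff h0x
  have hdE : ∀ (a : ℕ → E → ℂ), (∀ n, DifferentiableAt ℂ (a n) x) →
      eulerDer (PowerSeries.mk fun n => fderiv ℂ (a n) x v) =
        PowerSeries.mk fun n => fderiv ℂ (fun y => n * a n y) x v := by
    intro a ha
    ext n
    rw [hE, PowerSeries.coeff_mk, PowerSeries.coeff_mk, fderiv_const_mul (ha n)]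
    simp
  -- Derivative of `P θC = s θP C` in the direction `v`, which commutes with `θ`.
  have hder : dP * eulerDer C + P * eulerDer dC =
      PowerSeries.C s * (eulerDer dP * C + eulerDer P * dC) := by
    ext n
    have h1 := fderiv_coeff_mul hp (b := fun n y => n * c n y)
      (fun n => (hcd n).const_mul _) v n
    have h2 := fderiv_coeff_mul (a := fun n y => n * p n y) (b := c)
      (fun n => (hp n).const_mul _) hcd v n
    rw [hC, hdC, hE fun n => c n x, hdE c hcd, hP, hdP, hE fun n => p n x, hdE p hp, PowerSeries.coeff_C_mul, ← h1, ← h2]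
    have h3 : (fun y => (PowerSeries.mk (fun n => p n y) *
        PowerSeries.mk fun n => (n : ℂ) * c n y).coeff n) =ᶠ[nhds x]
        fun y => s * (PowerSeries.mk (fun n => (n : ℂ) * p n y) *
          PowerSeries.mk fun n => c n y).coeff n := by
      filter_upwards [h0] with y hy
      have := mk_mul_eulerDer_rpowCoeff (s := s) (p := fun n => p n y) hy
      rw [hE, hE, mul_assoc] at this
      rw [← PowerSeries.coeff_C_mul, ← this]
    rw [h3.fderiv_eq, fderiv_const_mul]
    · simp
    · simp only [coeff_mk_mul_mk]
      exact DifferentiableAt.fun_sum fun i _ => ((hp _).const_mul _).mul (hcd _)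
  have hP0 : P.coeff 0 ≠ 0 := by simp [hP, h0x, Complex.exp_ne_zero]
  have hPne : P ≠ 0 := fun h => hP0 (by simp [h])
  rw [← sub_eq_zero]
  -- The defect `P δC - s C δP` has the weight of `P^{s+1}`, hence satisfies the Euler equation with
  -- exponent `1 + s`. Its constant term vanishes because `p_0` and `c_0` are `exp l` and `exp (s
  -- l)` near the point. The Euler equation is checked after multiplication by `P`, so that `key`
  -- can eliminate `θC` without division.
  refine eq_zero_of_eulerDer (s := 1 + s) hP0 ?_ ?_
  · have h4 : (fun y => c 0 y) =ᶠ[nhds x] fun y => Complex.exp (s * l y) :=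
      Filter.Eventually.of_forall fun y => rpowCoeff_zero _ _ _
    have h5 : p 0 =ᶠ[nhds x] fun y => Complex.exp (l y) := h0
    have h6 : fderiv ℂ (c 0) x v = Complex.exp (s * l x) * (s * fderiv ℂ l x v) := by
      rw [h4.fderiv_eq, (hl.hasFDerivAt.const_mul s).cexp.fderiv]; simp
    have h7 : fderiv ℂ (p 0) x v = Complex.exp (l x) * fderiv ℂ l x v := by
      rw [h5.fderiv_eq, hl.hasFDerivAt.cexp.fderiv]; simp
    have h8 : c 0 x = Complex.exp (s * l x) := rpowCoeff_zero _ _ _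
    simp only [map_sub, PowerSeries.coeff_zero_eq_constantCoeff, map_mul, hP, hdC, hC, hdP,
      PowerSeries.constantCoeff_mk, PowerSeries.constantCoeff_C, h6, h7, h8, h0x]
    ring
  · apply mul_left_cancel₀ hPne
    have hCs : eulerDer (PowerSeries.C s) = 0 := by
      ext n
      rw [coeff_eulerDer, PowerSeries.coeff_C]
      by_cases h : n = 0 <;> simp [h]
    simp only [map_sub, Derivation.leibniz, smul_eq_mul, hCs, map_add, map_one]
    linear_combination (P * P) * hder + (-(PowerSeries.C s) * P * dP - P * dP) * key

end Deriv

end IsoLax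

/-! ### The model linear system and its fundamental matrix. -/

namespace IsoLax

section Level

variable {E : Type*} [NormedAddCommGroup E] [NormedSpace ℂ E]

/-- The linear system `(L P - x P') ∑ δY_i / (N - i) x^i = (∑ Y_i x^i) δP` modulo `x^N`, where
`P = ∑ p_n x^n`. -/
def LevelSystem (L N : ℕ) (p Y : ℕ → E → ℂ) (x v : E) : Prop :=
  ∀ k < N, ∑ i ∈ Finset.range (k + 1), ((L : ℂ) - ((k - i : ℕ) : ℂ)) * p (k - i) x *
      (fderiv ℂ (Y i) x v / ((N : ℂ) - i)) =
    ∑ i ∈ Finset.range (k + 1), fderiv ℂ (p (k - i)) x v * Y i x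

/-- Entry `(i, j)`, counted from `0`, of the fundamental matrix of the system of level `L` and
size `N`. -/
noncomputable def levelEntry (L N i j : ℕ) (l : ℂ) (p : ℕ → ℂ) : ℂ :=
  ((N : ℂ) - i) / ((N : ℂ) - j) * rpowCoeff (((N : ℂ) - j) / L) l p (i - j)

/-- Column `j` of the fundamental matrix. -/
noncomputable def levelCol (L N j : ℕ) (l : E → ℂ) (p : ℕ → E → ℂ) (i : ℕ) (x : E) : ℂ :=
  if j ≤ i then levelEntry L N i j (l x) (fun n => p n x) else 0

theorem natCast_sub_ne_zero {N j : ℕ} (h : j < N) : (N : ℂ) - j ≠ 0 := by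
  rw [sub_ne_zero]; exact_mod_cast h.ne'

theorem differentiableAt_levelCol {L N j : ℕ} {l : E → ℂ} {p : ℕ → E → ℂ} {x : E}
    (hl : DifferentiableAt ℂ l x) (hp : ∀ n, DifferentiableAt ℂ (p n) x) (i : ℕ) :
    DifferentiableAt ℂ (levelCol L N j l p i) x := by
  unfold levelCol levelEntry
  by_cases h : j ≤ i
  · simp only [h, if_true]
    exact (differentiableAt_rpowCoeff hl hp _).const_mul _
  · simp only [h, if_false]
    fun_prop

/-- With `a = N - j` and `C = P^{a/L}`, column `j` has generating series `x^j (C - θC/a)`. The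
weights `1/(N-i)` turn its derivative into `x^j δC/a`, and `P δC = (a/L) C δP` together with `P θC =
(a/L) C θP` gives the system. -/
theorem levelSystem_levelCol {L N j : ℕ} (hL : 0 < L) (hj : j < N) {l : E → ℂ} {p : ℕ → E → ℂ}
    {x : E} (hl : DifferentiableAt ℂ l x) (hp : ∀ n, DifferentiableAt ℂ (p n) x)
    (h0 : ∀ᶠ y in nhds x, p 0 y = Complex.exp (l y)) (v : E) :
    LevelSystem L N p (levelCol L N j l p) x v := by
  intro k hk
  set s : ℂ := ((N : ℂ) - j) / L with hs
  set a : ℂ := (N : ℂ) - j with ha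
  have ha0 : a ≠ 0 := natCast_sub_ne_zero hj
  have hL0 : (L : ℂ) ≠ 0 := by exact_mod_cast hL.ne'
  set c : ℕ → E → ℂ := fun n y => rpowCoeff s (l y) (fun n => p n y) n with hc
  have hcd : ∀ n, DifferentiableAt ℂ (c n) x := fun n => differentiableAt_rpowCoeff hl hp n
  set P := PowerSeries.mk (fun n => p n x) with hP
  set dP := PowerSeries.mk (fun n => fderiv ℂ (p n) x v) with hdP
  set C := PowerSeries.mk (fun n => c n x) with hC
  set dC := PowerSeries.mk (fun n => fderiv ℂ (c n) x v) with hdC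
  have h0x : p 0 x = Complex.exp (l x) := h0.self_of_nhds
  have key : P * eulerDer C = PowerSeries.C s * eulerDer P * C := mk_mul_eulerDer_rpowCoeff h0x
  have key2 : P * dC = PowerSeries.C s * C * dP := mk_mul_fderiv_rpowCoeff hl hp h0 v
  have hP0 : P ≠ 0 := by
    intro h
    have h1 := congrArg (PowerSeries.coeff 0) h
    simp [hP, h0x, Complex.exp_ne_zero] at h1
  have hCa : PowerSeries.C a = PowerSeries.C s * PowerSeries.C (L : ℂ) := by
    rw [← map_mul, hs, div_mul_cancel₀ _ hL0]
  have hmain : (PowerSeries.C (L : ℂ) * P - eulerDer P) *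
      (PowerSeries.X ^ j * (PowerSeries.C (1 / a) * dC)) =
      dP * (PowerSeries.X ^ j * (PowerSeries.C (1 / a) * (PowerSeries.C a * C - eulerDer C))) := by
    -- Both power identities carry a factor `P`; multiplying by it avoids inverting the series.
    apply mul_left_cancel₀ hP0
    linear_combination ((PowerSeries.C (L : ℂ) * P - eulerDer P) * PowerSeries.X ^ j *
      PowerSeries.C (1 / a)) * key2 + dP * PowerSeries.X ^ j * PowerSeries.C (1 / a) * key -
      P * dP * PowerSeries.X ^ j * PowerSeries.C (1 / a) * C * hCa
  have hl1 : PowerSeries.C (L : ℂ) * P - eulerDer P =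
      PowerSeries.mk fun n => ((L : ℂ) - n) * p n x := by
    ext n
    rw [map_sub, PowerSeries.coeff_C_mul, coeff_eulerDer, hP, PowerSeries.coeff_mk,
      PowerSeries.coeff_mk, sub_mul]
  have hmk : ∀ f : PowerSeries ℂ, f = PowerSeries.mk fun n => f.coeff n := fun f => by ext; simp
  have h1 := congrArg (PowerSeries.coeff k) hmain
  rw [hl1, hmk (PowerSeries.X ^ j * (PowerSeries.C (1 / a) * dC)), hdP,
    hmk (PowerSeries.X ^ j * (PowerSeries.C (1 / a) * (PowerSeries.C a * C - eulerDer C))),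
    coeff_mk_mul_mk, coeff_mk_mul_mk] at h1
  refine Eq.trans (Finset.sum_congr rfl fun i hi => ?_) (h1.trans
    (Finset.sum_congr rfl fun i hi => ?_))
  · rw [Finset.mem_range] at hi
    congr 1
    rw [PowerSeries.coeff_X_pow_mul']
    have hNi : (N : ℂ) - i ≠ 0 := natCast_sub_ne_zero (by omega)
    by_cases hji : j ≤ i
    · have h2 : levelCol L N j l p i = fun y => ((N : ℂ) - i) / a * c (i - j) y := by
        ext y; simp [levelCol, hji, levelEntry, hc, ha, hs]
      rw [h2, fderiv_const_mul (hcd _)]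
      simp [hji, hdC]
      field_simp
    · have h2 : levelCol L N j l p i = fun y => 0 := by
        ext y; simp [levelCol, hji]
      rw [h2]
      simp [hji]
  · congr 1
    rw [PowerSeries.coeff_X_pow_mul']
    by_cases hji : j ≤ i
    · simp only [hji, if_true, PowerSeries.coeff_C_mul, map_sub, coeff_eulerDer, levelCol,
        levelEntry, hC, PowerSeries.coeff_mk, hc, ← ha, ← hs]
      rw [Nat.cast_sub hji]
      field_simp
      rw [ha]; ring
    · simp [hji, levelCol]

theorem LevelSystem.congr_add {L N : ℕ} {p Y Z : ℕ → E → ℂ} {x v : E} (c : ℂ)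
    (hY : LevelSystem L N p Y x v) (hZ : LevelSystem L N p Z x v)
    (dY : ∀ i < N, DifferentiableAt ℂ (Y i) x) (dZ : ∀ i < N, DifferentiableAt ℂ (Z i) x) :
    LevelSystem L N p (fun i y => Y i y + Z i y * c) x v := by
  intro k hk
  have e1 : ∀ i ∈ Finset.range (k + 1), ((L : ℂ) - ((k - i : ℕ) : ℂ)) * p (k - i) x *
      (fderiv ℂ (fun y => Y i y + Z i y * c) x v / ((N : ℂ) - i)) =
      ((L : ℂ) - ((k - i : ℕ) : ℂ)) * p (k - i) x * (fderiv ℂ (Y i) x v / ((N : ℂ) - i)) +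
      c * (((L : ℂ) - ((k - i : ℕ) : ℂ)) * p (k - i) x *
        (fderiv ℂ (Z i) x v / ((N : ℂ) - i))) := by
    intro i hi
    rw [Finset.mem_range] at hi
    rw [fderiv_fun_add (dY i (by omega)) ((dZ i (by omega)).mul_const c),
      fderiv_mul_const (dZ i (by omega))]
    simp
    ring
  rw [Finset.sum_congr rfl e1, Finset.sum_add_distrib, hY k hk, ← Finset.mul_sum, hZ k hk,
    Finset.mul_sum, ← Finset.sum_add_distrib]
  exact Finset.sum_congr rfl fun i _ => by ring

theorem LevelSystem.add_sum {L N : ℕ} {p Y : ℕ → E → ℂ} {Z : ℕ → ℕ → E → ℂ} {x v : E}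
    (c : ℕ → ℂ) (m : ℕ)
    (hY : LevelSystem L N p Y x v) (hZ : ∀ j < m, LevelSystem L N p (Z j) x v)
    (dY : ∀ i < N, DifferentiableAt ℂ (Y i) x)
    (dZ : ∀ j < m, ∀ i < N, DifferentiableAt ℂ (Z j i) x) :
    LevelSystem L N p (fun i y => Y i y + ∑ j ∈ Finset.range m, Z j i y * c j) x v := by
  induction m with
  | zero => simpa using hY
  | succ m ih =>
    have := (ih (fun j hj => hZ j (by omega)) (fun j hj => dZ j (by omega))).congr_add (c m)
      (hZ m (by omega))
      (fun i hi => (dY i hi).fun_add (DifferentiableAt.fun_sum fun j hj =>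
        (dZ j (by rw [Finset.mem_range] at hj; omega) i hi).mul_const _))
      (dZ m (by omega))
    simpa only [Finset.sum_range_succ, add_assoc] using this

theorem LevelSystem.congr_of_eventuallyEq {L N : ℕ} {p Y Z : ℕ → E → ℂ} {x v : E}
    (hY : LevelSystem L N p Y x v) (h : ∀ i < N, Z i =ᶠ[nhds x] Y i) :
    LevelSystem L N p Z x v := by
  intro k hk
  refine Eq.trans (Finset.sum_congr rfl fun i hi => ?_) ((hY k hk).trans
    (Finset.sum_congr rfl fun i hi => ?_))
  all_goals rw [Finset.mem_range] at hi
  · rw [(h i (by omega)).fderiv_eq]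
  · rw [(h i (by omega)).eq_of_nhds]

theorem levelSystem_zero (L N : ℕ) (p : ℕ → E → ℂ) (x v : E) :
    LevelSystem L N p (fun _ _ => 0) x v := by
  intro k _
  simp

theorem sum_levelCol {T : Type*} {L N m i : ℕ} (hi : i < m) (l : T → ℂ) (p : ℕ → T → ℂ)
    (c : ℕ → ℂ) (x : T) :
    ∑ j ∈ Finset.range m, levelCol L N j l p i x * c j =
      ∑ j ∈ Finset.range (i + 1), levelEntry L N i j (l x) (fun n => p n x) * c j := by
  symm
  refine Finset.sum_subset_zero_on_sdiff (fun j hj => ?_) (fun j hj => ?_) fun j hj => ?_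
  · rw [Finset.mem_range] at *; omega
  · simp only [Finset.mem_sdiff, Finset.mem_range] at hj
    have : ¬ j ≤ i := by omega
    simp [levelCol, this]
  · rw [Finset.mem_range] at hj
    have : j ≤ i := by omega
    simp [levelCol, this]

/-- Variation of constants for a triangular system: the constants are found one at a time, each from
a scalar equation integrated on the connected set. -/
theorem levelSystem_iff {L N : ℕ} (hNL : N ≤ L) {U : Set E} (hU : IsOpen U)
    (hU' : IsPreconnected U) {l : E → ℂ} (hl : DifferentiableOn ℂ l U) {p : ℕ → E → ℂ}
    (hp : ∀ n, DifferentiableOn ℂ (p n) U) (h0 : ∀ x ∈ U, p 0 x = Complex.exp (l x))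
    {Y : ℕ → E → ℂ} (hY : ∀ i < N, DifferentiableOn ℂ (Y i) U) :
    (∀ x ∈ U, ∀ v, LevelSystem L N p Y x v) ↔
      ∃ c : ℕ → ℂ, ∀ x ∈ U, ∀ i < N, Y i x =
        ∑ j ∈ Finset.range (i + 1), levelEntry L N i j (l x) (fun n => p n x) * c j := by
  have hnhds : ∀ x ∈ U, U ∈ nhds x := fun x hx => hU.mem_nhds hx
  have hlx : ∀ x ∈ U, DifferentiableAt ℂ l x := fun x hx => hl.differentiableAt (hnhds x hx)
  have hpx : ∀ x ∈ U, ∀ n, DifferentiableAt ℂ (p n) x :=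
    fun x hx n => (hp n).differentiableAt (hnhds x hx)
  have hYx : ∀ x ∈ U, ∀ i < N, DifferentiableAt ℂ (Y i) x :=
    fun x hx i hi => (hY i hi).differentiableAt (hnhds x hx)
  have h0x : ∀ x ∈ U, ∀ᶠ y in nhds x, p 0 y = Complex.exp (l y) := fun x hx => by
    filter_upwards [hnhds x hx] with y hy using h0 y hy
  have hcol : ∀ x ∈ U, ∀ v, ∀ j < N, LevelSystem L N p (levelCol L N j l p) x v :=
    fun x hx v j hj => levelSystem_levelCol (by omega) hj (hlx x hx) (hpx x hx) (h0x x hx) v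
  constructor
  · intro hsys
    have claim : ∀ m ≤ N, ∃ c : ℕ → ℂ, ∀ x ∈ U, ∀ i < m,
        Y i x = ∑ j ∈ Finset.range m, levelCol L N j l p i x * c j := by
      intro m
      induction m with
      | zero => intro _; exact ⟨0, by simp⟩
      | succ m ih =>
        intro hm
        obtain ⟨c, hc⟩ := ih (by omega)
        -- Subtracting the columns already found kills the components below `m` and stays within the
        -- solutions, so equation `m` involves `Z m` alone.
        set Z : ℕ → E → ℂ := fun i y => Y i y +
          ∑ j ∈ Finset.range m, levelCol L N j l p i y * (-c j) with hZ
        have hZsys : ∀ x ∈ U, ∀ v, LevelSystem L N p Z x v := fun x hx v =>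
          (hsys x hx v).add_sum (fun j => -c j) m (fun j hj => hcol x hx v j (by omega)) (hYx x hx)
            (fun j hj i hi => differentiableAt_levelCol (hlx x hx) (hpx x hx) i)
        have hZ0 : ∀ x ∈ U, ∀ i < m, Z i x = 0 := fun x hx i hi => by
          simp [hZ, hc x hx i hi]
        have hZd : ∀ x ∈ U, DifferentiableAt ℂ (Z m) x := fun x hx =>
          (hYx x hx m (by omega)).fun_add (DifferentiableAt.fun_sum fun j hj =>
            (differentiableAt_levelCol (hlx x hx) (hpx x hx) m).mul_const _)
        have hNm : (N : ℂ) - m ≠ 0 := natCast_sub_ne_zero (by omega)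
        have hL0 : (L : ℂ) ≠ 0 := by
          have : L ≠ 0 := by omega
          exact_mod_cast this
        set s : ℂ := ((N : ℂ) - m) / L with hs
        have hexp : ∀ x ∈ U, HasFDerivAt (fun y => Complex.exp (-s * l y))
            (Complex.exp (-s * l x) • (-s) • fderiv ℂ l x) x := fun x hx =>
          ((hlx x hx).hasFDerivAt.const_mul (-s)).cexp
        -- Equation `m` reads `L p_0 δZ_m/(N-m) = δp_0 Z_m`, that is `δZ_m = s Z_m δl` since `p_0 =
        -- exp l`. Hence `Z_m exp (-s l)` is constant, and this constant is the next coefficient.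
        have hconst := IsOpen.exists_is_const_of_fderiv_eq_zero (𝕜 := ℂ) hU hU'
          (f := fun y => Z m y * Complex.exp (-s * l y))
          (fun x hx => ((hZd x hx).mul (hexp x hx).differentiableAt).differentiableWithinAt) (by
            intro x hx
            ext v
            rw [((hZd x hx).hasFDerivAt.fun_mul (hexp x hx)).fderiv]
            have h1 := hZsys x hx v m (by omega)
            rw [Finset.sum_range_succ, Finset.sum_range_succ, Finset.sum_eq_zero,
              Finset.sum_eq_zero] at h1
            · have h2 : p 0 =ᶠ[nhds x] fun y => Complex.exp (l y) := h0x x hx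
              have h3 : fderiv ℂ (p 0) x v = Complex.exp (l x) * fderiv ℂ l x v := by
                rw [h2.fderiv_eq, (hlx x hx).hasFDerivAt.cexp.fderiv]; simp
              simp only [Nat.sub_self, h3, h0 x hx, CharP.cast_eq_zero, sub_zero, zero_add] at h1
              have h4 : fderiv ℂ (Z m) x v = s * (fderiv ℂ l x v * Z m x) := by
                apply mul_left_cancel₀ (Complex.exp_ne_zero (l x))
                rw [hs]
                field_simp at h1 ⊢
                linear_combination h1
              simp only [add_apply, smul_apply, smul_eq_mul, h4, Pi.zero_apply,
                zero_apply]
              ring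
            · intro i hi
              rw [hZ0 x hx i (by simpa using hi), mul_zero]
            · intro i hi
              rw [Finset.mem_range] at hi
              have h2 : Z i =ᶠ[nhds x] fun _ => 0 := by
                filter_upwards [hnhds x hx] with y hy using hZ0 y hy i hi
              rw [h2.fderiv_eq]
              simp)
        obtain ⟨a, ha⟩ := hconst
        refine ⟨Function.update c m a, fun x hx i hi => ?_⟩
        rw [Finset.sum_range_succ, Function.update_self]
        have h5 : ∑ j ∈ Finset.range m, levelCol L N j l p i x * Function.update c m a j =
            ∑ j ∈ Finset.range m, levelCol L N j l p i x * c j :=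
          Finset.sum_congr rfl fun j hj => by
            rw [Function.update_of_ne (by rw [Finset.mem_range] at hj; omega)]
        rw [h5]
        rcases Nat.lt_succ_iff_lt_or_eq.mp hi with h6 | rfl
        · rw [hc x hx i h6]
          simp [levelCol, show ¬ m ≤ i by omega]
        · have h7 : levelCol L N i l p i x = Complex.exp (s * l x) := by
            simp [levelCol, levelEntry, rpowCoeff_zero, hNm, hs]
          have h8 := ha x hx
          rw [h7, ← h8, mul_comm, mul_assoc, ← Complex.exp_add]
          simp [hZ]
    obtain ⟨c, hc⟩ := claim N le_rfl
    exact ⟨c, fun x hx i hi => by rw [hc x hx i hi, sum_levelCol hi]⟩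
  · rintro ⟨c, hc⟩ x hx v
    have h1 := (levelSystem_zero L N p x v).add_sum c N (fun j hj => hcol x hx v j hj)
      (fun i _ => by fun_prop)
      (fun j hj i hi => differentiableAt_levelCol (hlx x hx) (hpx x hx) i)
    refine h1.congr_of_eventuallyEq fun i hi => ?_
    filter_upwards [hnhds x hx] with y hy
    rw [hc y hy i hi, zero_add, sum_levelCol hi]

end Level

end IsoLax

/-! ### The differential systems contracted with an arbitrary direction. -/

namespace IsoLax

variable {D : PoleType}

open Classical in
/-- The linear form `α ↦ α_e`, zero if the label `e` is frozen. -/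
noncomputable def coordCLM (e : AnyTime D) : Times D →L[ℂ] ℂ :=
  if h : IsFree D e then ContinuousLinearMap.proj ⟨e, h⟩ else 0

theorem coordCLM_apply (e : AnyTime D) (α : Times D) : coordCLM e α = coordOr 0 α e := by
  unfold coordCLM coordOr
  split_ifs <;> simp

theorem hasFDerivAt_coordOr (d : ℂ) (e : AnyTime D) (τ : Times D) :
    HasFDerivAt (fun τ => coordOr d τ e) (coordCLM e) τ := by
  unfold coordCLM coordOr
  split_ifs with h
  · exact (ContinuousLinearMap.proj (R := ℂ) (φ := fun _ : IsoTime D => ℂ) ⟨e, h⟩).hasFDerivAt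
  · exact hasFDerivAt_const _ _

theorem unitDir_coe (e : IsoTime D) [DecidableEq (IsoTime D)] :
    unitDir e.1 = Pi.single (M := fun _ => ℂ) e 1 := by
  unfold unitDir
  rw [dif_pos e.2]
  ext i
  simp [Pi.single_apply]

theorem coordCLM_unitDir_ne {e e' : AnyTime D} (h : e ≠ e') : coordCLM e (unitDir e') = 0 := by
  unfold coordCLM unitDir
  split_ifs with h1 h2 <;> simp [h]

theorem coordCLM_unitDir_self {e : AnyTime D} (h : IsFree D e) : coordCLM e (unitDir e) = 1 := by
  simp [coordCLM, unitDir, h]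

theorem clm_eq_zero_of_unitDir {φ : Times D →L[ℂ] ℂ} (h : ∀ e : IsoTime D, φ (unitDir e.1) = 0) :
    φ = 0 := by
  classical
  ext α
  rw [pi_eq_sum_univ' α, map_sum]
  refine Finset.sum_eq_zero fun e _ => ?_
  have h1 := h e
  rw [unitDir_coe] at h1
  rw [map_smul]
  rw [h1, smul_zero]

/-- The differential of `X_s`. -/
noncomputable def dPos (s : Fin D.n) : Times D →L[ℂ] ℂ := coordCLM (Sum.inr (Sum.inr s))

/-- The differential of `t_{X_s,k}`. -/
noncomputable def dPole (s : Fin D.n) (k : ℕ) : Times D →L[ℂ] ℂ :=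
  if h : 1 ≤ k ∧ k - 1 < D.r s - 1 then coordCLM (Sum.inr (Sum.inl ⟨s, ⟨k - 1, h.2⟩⟩)) else 0

/-- The differential of `t_{∞,k}`. -/
noncomputable def dInf (D : PoleType) (k : ℕ) : Times D →L[ℂ] ℂ :=
  if h : 1 ≤ k ∧ k - 1 < D.rInf - 3 then coordCLM (Sum.inl ⟨k - 1, h.2⟩) else 0

theorem hasFDerivAt_pos (s : Fin D.n) (τ : Times D) :
    HasFDerivAt (fun τ => pos τ s) (dPos s) τ := hasFDerivAt_coordOr _ _ _

theorem hasFDerivAt_tPole (s : Fin D.n) (k : ℕ) (τ : Times D) :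
    HasFDerivAt (fun τ => tPole τ s k) (dPole s k) τ := by
  unfold tPole dPole
  split_ifs with h
  · exact hasFDerivAt_coordOr _ _ _
  · exact hasFDerivAt_const _ _

theorem hasFDerivAt_tInf (θ : ℂ) (k : ℕ) (τ : Times D) :
    HasFDerivAt (fun τ => tInf θ τ k) (dInf D k) τ := by
  unfold tInf dInf
  by_cases h0 : k = 0
  · simp only [h0, if_true]
    rw [dif_neg (by omega)]
    exact hasFDerivAt_const _ _
  by_cases h1 : k + 1 = D.rInf
  · simp only [h0, h1, if_true, if_false]
    rw [dif_neg (by omega)]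
    exact hasFDerivAt_const _ _
  by_cases h2 : k + 2 = D.rInf
  · simp only [h0, h1, h2, if_true, if_false]
    rw [dif_neg (by omega)]
    exact hasFDerivAt_const _ _
  by_cases h3 : k - 1 < D.rInf - 3
  · simp only [h0, h1, h2, h3, if_false, dite_true]
    rw [dif_pos ⟨by omega, trivial⟩]
    exact hasFDerivAt_coordOr _ _ _
  · simp only [h0, h1, h2, h3, if_false, dite_false]
    rw [dif_neg (by simp)]
    exact hasFDerivAt_const _ _

theorem sum_fin_ite_le {N : ℕ} (i : Fin N) (a : ℕ → ℂ) :
    ∑ l : Fin N, (if l ≤ i then a l else 0) = ∑ l ∈ Finset.range ((i : ℕ) + 1), a l := by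
  have h := Fin.sum_univ_eq_sum_range (fun l => if l ≤ (i : ℕ) then a l else 0) N
  have h2 : ∑ l : Fin N, (if l ≤ i then a l else 0) =
      ∑ l : Fin N, (if (l : ℕ) ≤ (i : ℕ) then a l else 0) :=
    Finset.sum_congr rfl fun l _ => by simp only [Fin.le_def]
  rw [h2, h, ← Finset.sum_filter]
  congr 1
  ext l
  simp only [Finset.mem_filter, Finset.mem_range]
  omega

theorem natCast_sub_eq {N i : ℕ} (h : i ≤ N) : ((N - i : ℕ) : ℂ) = (N : ℂ) - i := by
  push_cast [h]; ring

/-- The matrix equation at `X_s` contracted with the direction `α`. -/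
def PoleEq (s : Fin D.n) (W : ℕ → Times D → ℂ) (τ α : Times D) : Prop :=
  ∀ k < D.r s - 1, ∑ i ∈ Finset.range (k + 1), tPole τ s (D.r s - 1 - (k - i)) *
      (delta α (W (D.r s - i)) τ / ((D.r s - 1 - i : ℕ) : ℂ)) =
    ∑ j ∈ Finset.range (k + 1), W (D.r s - (k - j)) τ *
      (dPole s (D.r s - 1 - j) α / ((D.r s - 1 - j : ℕ) : ℂ))

theorem dPole_unitDir_of_ne {s : Fin D.n} {e : AnyTime D}
    (he : ∀ i, e ≠ Sum.inr (Sum.inl ⟨s, i⟩)) (k : ℕ) : dPole s k (unitDir e) = 0 := by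
  unfold dPole
  split_ifs with h
  · exact coordCLM_unitDir_ne fun h1 => he _ h1.symm
  · simp

theorem dPole_unitDir_rev {s : Fin D.n} {j : Fin (D.r s - 1)}
    (hj : IsFree D (Sum.inr (Sum.inl ⟨s, Fin.rev j⟩))) {k : ℕ} (hk : k < D.r s - 1) :
    dPole s (D.r s - 1 - k) (unitDir (Sum.inr (Sum.inl ⟨s, Fin.rev j⟩))) =
      if k = (j : ℕ) then 1 else 0 := by
  have hj2 := j.2
  unfold dPole
  rw [dif_pos ⟨by omega, by omega⟩]
  split_ifs with h
  · have : (⟨D.r s - 1 - k - 1, by omega⟩ : Fin (D.r s - 1)) = Fin.rev j := by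
      ext; simp [Fin.val_rev]; omega
    rw [this]
    exact coordCLM_unitDir_self hj
  · refine coordCLM_unitDir_ne fun h1 => h ?_
    simp only [Sum.inr.injEq, Sum.inl.injEq, Sigma.mk.injEq, heq_eq_eq, true_and] at h1
    have := congrArg Fin.val h1
    simp only [Fin.val_rev] at this
    omega

/-- A coordinate direction selects one column of the matrix equation, and triangularity shortens the
matrix products to convolutions. The reversal reflects that columns are listed from the highest time
downwards. -/
theorem poleEq_unitDir_rev_iff {s : Fin D.n} (W : ℕ → Times D → ℂ) (τ : Times D)
    (j : Fin (D.r s - 1)) (hj : IsFree D (Sum.inr (Sum.inl ⟨s, Fin.rev j⟩))) :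
    PoleEq s W τ (unitDir (Sum.inr (Sum.inl ⟨s, Fin.rev j⟩))) ↔
      ∀ i, (MPole τ s * invDiag (D.r s - 1) * derivPole s W τ) i j =
        (toepPole s W τ * invDiag (D.r s - 1)) i j := by
  have hrow : ∀ i : Fin (D.r s - 1), (MPole τ s * invDiag (D.r s - 1) * derivPole s W τ) i j =
      ∑ l ∈ Finset.range ((i : ℕ) + 1), tPole τ s (D.r s - 1 - (i - l)) *
        (delta (unitDir (Sum.inr (Sum.inl ⟨s, Fin.rev j⟩))) (W (D.r s - l)) τ /
          ((D.r s - 1 - l : ℕ) : ℂ)) := by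
    intro i
    rw [← sum_fin_ite_le, Matrix.mul_apply]
    refine Finset.sum_congr rfl fun l _ => ?_
    simp only [MPole, invDiag, derivPole, Matrix.mul_diagonal, Matrix.of_apply]
    split_ifs <;> ring
  have hrhs : ∀ i : Fin (D.r s - 1), (toepPole s W τ * invDiag (D.r s - 1)) i j =
      ∑ l ∈ Finset.range ((i : ℕ) + 1), W (D.r s - (i - l)) τ *
      (dPole s (D.r s - 1 - l) (unitDir (Sum.inr (Sum.inl ⟨s, Fin.rev j⟩))) /
        ((D.r s - 1 - l : ℕ) : ℂ)) := by
    intro i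
    have hi := i.2
    rw [Finset.sum_congr rfl fun l hl => by
      rw [dPole_unitDir_rev hj (by rw [Finset.mem_range] at hl; omega)]]
    simp only [toepPole, invDiag, Matrix.mul_diagonal, Matrix.of_apply, Fin.le_def]
    by_cases h : (j : ℕ) ≤ i
    · rw [Finset.sum_eq_single (j : ℕ)]
      · simp [h]
      · intro b _ hb; simp [hb]
      · intro hb; rw [Finset.mem_range] at hb; omega
    · rw [Finset.sum_eq_zero]
      · simp [h]
      · intro b hb
        rw [Finset.mem_range] at hb
        rw [if_neg (by omega)]; simp
  constructor
  · intro h i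
    rw [hrow, hrhs]
    exact h i i.2
  · intro h k hk
    have := h ⟨k, hk⟩
    rw [hrow, hrhs] at this
    exact this

theorem poleEq_of_forall_unitDir {s : Fin D.n} {W : ℕ → Times D → ℂ} {τ : Times D}
    (h : ∀ e : IsoTime D, PoleEq s W τ (unitDir e.1)) (α : Times D) : PoleEq s W τ α := by
  intro k hk
  have h1 := clm_eq_zero_of_unitDir (φ := ∑ i ∈ Finset.range (k + 1),
      (tPole τ s (D.r s - 1 - (k - i)) / ((D.r s - 1 - i : ℕ) : ℂ)) •
        fderiv ℂ (W (D.r s - i)) τ -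
      ∑ j ∈ Finset.range (k + 1), (W (D.r s - (k - j)) τ / ((D.r s - 1 - j : ℕ) : ℂ)) •
        dPole s (D.r s - 1 - j)) (fun e => by
    have h2 := h e k hk
    rw [← sub_eq_zero] at h2
    rw [← h2]
    simp only [sub_apply, sum_apply, smul_apply, smul_eq_mul, delta]
    congr 1 <;> exact Finset.sum_congr rfl fun i _ => by ring)
  have h3 := congrArg (fun φ => φ α) h1
  simp only [sub_apply, sum_apply, smul_apply, smul_eq_mul, zero_apply, sub_eq_zero] at h3
  simp only [delta]
  refine Eq.trans (Finset.sum_congr rfl fun i _ => by ring) (h3.trans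
    (Finset.sum_congr rfl fun i _ => by ring))

/-- A convolution equation with vanishing right hand side has only the trivial solution. -/
theorem eq_zero_of_conv {N : ℕ} {a b : ℕ → ℂ} (ha : a 0 ≠ 0)
    (h : ∀ k < N, ∑ i ∈ Finset.range (k + 1), a (k - i) * b i = 0) : ∀ k < N, b k = 0 := by
  intro k
  induction k using Nat.strong_induction_on with
  | _ k ih =>
    intro hk
    have h1 := h k hk
    rw [Finset.sum_range_succ, Finset.sum_eq_zero fun i hi => by
      rw [Finset.mem_range] at hi; rw [ih i hi (by omega), mul_zero]] at h1
    simpa [ha] using h1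

/-- The contracted equation is linear in the direction, so the free coordinate directions suffice.
It also contains the independence clause: in a direction that does not touch the `t_{X_s,k}` the
right side is zero, and a convolution with non-vanishing leading coefficient forces all derivatives
of `W_2, …, W_{r_s}` to vanish. -/
theorem poleSystem_iff {U : Set (Times D)} {s : Fin D.n} {W : ℕ → Times D → ℂ}
    (hlead : ∀ τ ∈ U, 2 ≤ D.r s → tPole τ s (D.r s - 1) ≠ 0) :
    PoleSystem U s W ↔
      ∀ τ ∈ U, (∀ α : Times D, delta α (W 1) τ = 0) ∧ ∀ α, PoleEq s W τ α := by
  refine forall₂_congr fun τ hτ => and_congr_right fun _ => ?_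
  constructor
  · rintro ⟨h1, h2⟩
    refine poleEq_of_forall_unitDir fun e => ?_
    by_cases he : ∀ i, e.1 ≠ Sum.inr (Sum.inl ⟨s, i⟩)
    · intro k hk
      rw [Finset.sum_eq_zero, Finset.sum_eq_zero]
      · intro j _; rw [dPole_unitDir_of_ne he]; simp
      · intro i hi
        rw [Finset.mem_range] at hi
        rw [h1 e he _ (by rw [Finset.mem_Icc]; omega)]; simp
    · push Not at he
      obtain ⟨i, hi⟩ := he
      have hfree : IsFree D (Sum.inr (Sum.inl ⟨s, Fin.rev (Fin.rev i)⟩)) := by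
        rw [Fin.rev_rev, ← hi]; exact e.2
      have := (poleEq_unitDir_rev_iff W τ (Fin.rev i) hfree).2 (h2 _ hfree)
      rwa [Fin.rev_rev, ← hi] at this
  · intro h
    refine ⟨fun e he k hk => ?_, fun j hj => (poleEq_unitDir_rev_iff W τ j hj).1 (h _)⟩
    rw [Finset.mem_Icc] at hk
    have h1 := eq_zero_of_conv (N := D.r s - 1) (a := fun n => tPole τ s (D.r s - 1 - n))
      (b := fun i => delta (unitDir e.1) (W (D.r s - i)) τ / ((D.r s - 1 - i : ℕ) : ℂ))
      (hlead τ hτ (by omega)) (fun k hk => by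
        rw [h (unitDir e.1) k hk]
        exact Finset.sum_eq_zero fun j _ => by rw [dPole_unitDir_of_ne he]; simp)
    have h2 := h1 (D.r s - k) (by omega)
    have h3 : ((D.r s - 1 - (D.r s - k) : ℕ) : ℂ) ≠ 0 := by
      have : D.r s - 1 - (D.r s - k) ≠ 0 := by omega
      exact_mod_cast this
    rw [div_eq_zero_iff, or_iff_left h3, Nat.sub_sub_self hk.2] at h2
    exact h2

/-- Coefficient of `z^k` in the polynomial part of the entry `(1,1)`. -/
def infCoeff (W : ℕ → Times D → ℂ) (τ : Times D) (k : ℕ) : ℂ :=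
  if k + 2 = D.rInf then -1 else if k + 3 = D.rInf then 0 else W k τ

/-- The matrix equation at infinity contracted with the direction `α`. -/
def InfEq (θ : ℂ) (W : ℕ → Times D → ℂ) (τ α : Times D) : Prop :=
  ∀ k < D.rInf - 3, ∑ i ∈ Finset.range (k + 1), tInf θ τ (D.rInf - 1 - (k - i)) *
      (delta α (W (D.rInf - 3 - 1 - i)) τ / ((D.rInf - 3 - i : ℕ) : ℂ)) =
    ∑ j ∈ Finset.range (k + 1), infCoeff W τ (D.rInf - 2 - (k - j)) *
      (dInf D (D.rInf - 3 - j) α / ((D.rInf - 3 - j : ℕ) : ℂ))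

theorem dInf_unitDir_of_ne {e : AnyTime D} (he : ∀ i, e ≠ Sum.inl i) (k : ℕ) :
    dInf D k (unitDir e) = 0 := by
  unfold dInf
  split_ifs with h
  · exact coordCLM_unitDir_ne fun h1 => he _ h1.symm
  · simp

theorem dInf_unitDir_rev (j : Fin (D.rInf - 3)) {k : ℕ} (hk : k < D.rInf - 3) :
    dInf D (D.rInf - 3 - k) (unitDir (Sum.inl (Fin.rev j))) = if k = (j : ℕ) then 1 else 0 := by
  have hj2 := j.2
  unfold dInf
  rw [dif_pos ⟨by omega, by omega⟩]
  split_ifs with h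
  · have : (⟨D.rInf - 3 - k - 1, by omega⟩ : Fin (D.rInf - 3)) = Fin.rev j := by
      ext; simp [Fin.val_rev]; omega
    rw [this]
    exact coordCLM_unitDir_self trivial
  · refine coordCLM_unitDir_ne fun h1 => h ?_
    rw [Sum.inl.injEq] at h1
    have := congrArg Fin.val h1
    simp only [Fin.val_rev] at this
    omega

theorem infEq_unitDir_rev_iff (θ : ℂ) (W : ℕ → Times D → ℂ) (τ : Times D)
    (j : Fin (D.rInf - 3)) :
    InfEq θ W τ (unitDir (Sum.inl (Fin.rev j))) ↔
      ∀ i, (MInf θ τ * invDiag (D.rInf - 3) * derivInf W τ) i j =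
        (toepInf W τ * invDiag (D.rInf - 3)) i j := by
  have hrow : ∀ i : Fin (D.rInf - 3), (MInf θ τ * invDiag (D.rInf - 3) * derivInf W τ) i j =
      ∑ l ∈ Finset.range ((i : ℕ) + 1), tInf θ τ (D.rInf - 1 - (i - l)) *
        (delta (unitDir (Sum.inl (Fin.rev j))) (W (D.rInf - 3 - 1 - l)) τ /
          ((D.rInf - 3 - l : ℕ) : ℂ)) := by
    intro i
    rw [← sum_fin_ite_le, Matrix.mul_apply]
    refine Finset.sum_congr rfl fun l _ => ?_
    have hl : ((Fin.rev l : Fin (D.rInf - 3)) : ℕ) = D.rInf - 3 - 1 - l := by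
      rw [Fin.val_rev]; omega
    simp only [MInf, invDiag, derivInf, Matrix.mul_diagonal, Matrix.of_apply, hl]
    split_ifs <;> ring
  have hrhs : ∀ i : Fin (D.rInf - 3), (toepInf W τ * invDiag (D.rInf - 3)) i j =
      ∑ l ∈ Finset.range ((i : ℕ) + 1), infCoeff W τ (D.rInf - 2 - (i - l)) *
      (dInf D (D.rInf - 3 - l) (unitDir (Sum.inl (Fin.rev j))) /
        ((D.rInf - 3 - l : ℕ) : ℂ)) := by
    intro i
    have hi := i.2
    rw [Finset.sum_congr rfl fun l hl => by
      rw [dInf_unitDir_rev j (by rw [Finset.mem_range] at hl; omega)]]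
    simp only [toepInf, invDiag, Matrix.mul_diagonal, Matrix.of_apply, Fin.ext_iff]
    by_cases h : (j : ℕ) ≤ i
    · rw [Finset.sum_eq_single (j : ℕ)]
      · simp only [if_true]
        congr 1
        unfold infCoeff
        split_ifs <;> first | rfl | (exfalso; omega)
      · intro b _ hb; simp [hb]
      · intro hb; rw [Finset.mem_range] at hb; omega
    · rw [Finset.sum_eq_zero]
      · rw [if_neg (by omega), if_neg (by omega)]; simp
      · intro b hb
        rw [Finset.mem_range] at hb
        rw [if_neg (by omega)]; simp
  constructor
  · intro h i
    rw [hrow, hrhs]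
    exact h i i.2
  · intro h k hk
    have := h ⟨k, hk⟩
    rw [hrow, hrhs] at this
    exact this

theorem infEq_of_forall_unitDir {θ : ℂ} {W : ℕ → Times D → ℂ} {τ : Times D}
    (h : ∀ e : IsoTime D, InfEq θ W τ (unitDir e.1)) (α : Times D) : InfEq θ W τ α := by
  intro k hk
  have h1 := clm_eq_zero_of_unitDir (φ := ∑ i ∈ Finset.range (k + 1),
      (tInf θ τ (D.rInf - 1 - (k - i)) / ((D.rInf - 3 - i : ℕ) : ℂ)) •
        fderiv ℂ (W (D.rInf - 3 - 1 - i)) τ -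
      ∑ j ∈ Finset.range (k + 1),
        (infCoeff W τ (D.rInf - 2 - (k - j)) / ((D.rInf - 3 - j : ℕ) : ℂ)) •
        dInf D (D.rInf - 3 - j)) (fun e => by
    have h2 := h e k hk
    rw [← sub_eq_zero] at h2
    rw [← h2]
    simp only [sub_apply, sum_apply, smul_apply, smul_eq_mul, delta]
    congr 1 <;> exact Finset.sum_congr rfl fun i _ => by ring)
  have h3 := congrArg (fun φ => φ α) h1
  simp only [sub_apply, sum_apply, smul_apply, smul_eq_mul, zero_apply, sub_eq_zero] at h3
  simp only [delta]
  refine Eq.trans (Finset.sum_congr rfl fun i _ => by ring) (h3.trans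
    (Finset.sum_congr rfl fun i _ => by ring))

theorem tInf_lead (θ : ℂ) (τ : Times D) (h : 2 ≤ D.rInf) : tInf θ τ (D.rInf - 1) = 1 := by
  unfold tInf
  rw [if_neg (by omega), if_pos (by omega)]

theorem tInf_sublead (θ : ℂ) (τ : Times D) (h : 3 ≤ D.rInf) : tInf θ τ (D.rInf - 2) = 0 := by
  unfold tInf
  rw [if_neg (by omega), if_neg (by omega), if_pos (by omega)]

/-- The argument of the finite poles; here the leading coefficient `t_{∞,r_∞-1} = 1` makes the
convolution invertible without a genericity assumption. -/
theorem infSystem_iff {θ : ℂ} {U : Set (Times D)} {W : ℕ → Times D → ℂ} :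
    InfSystem θ U W ↔ ∀ τ ∈ U, ∀ α, InfEq θ W τ α := by
  refine forall₂_congr fun τ hτ => ?_
  constructor
  · rintro ⟨h1, h2⟩
    refine infEq_of_forall_unitDir fun e => ?_
    by_cases he : ∀ i, e.1 ≠ Sum.inl i
    · intro k hk
      rw [Finset.sum_eq_zero, Finset.sum_eq_zero]
      · intro j _; rw [dInf_unitDir_of_ne he]; simp
      · intro i hi
        rw [Finset.mem_range] at hi
        rw [h1 e he _ (by omega)]; simp
    · push Not at he
      obtain ⟨i, hi⟩ := he
      have := (infEq_unitDir_rev_iff θ W τ (Fin.rev i)).2 (fun i' => by rw [h2])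
      rwa [Fin.rev_rev, ← hi] at this
  · intro h
    refine ⟨fun e he k hk => ?_, ?_⟩
    · have h1 := eq_zero_of_conv (N := D.rInf - 3) (a := fun n => tInf θ τ (D.rInf - 1 - n))
        (b := fun i => delta (unitDir e.1) (W (D.rInf - 3 - 1 - i)) τ /
          ((D.rInf - 3 - i : ℕ) : ℂ))
        (by rw [Nat.sub_zero, tInf_lead θ τ (by omega)]; exact one_ne_zero) (fun k hk => by
          rw [h (unitDir e.1) k hk]
          exact Finset.sum_eq_zero fun j _ => by rw [dInf_unitDir_of_ne he]; simp)
      have h2 := h1 (D.rInf - 3 - 1 - k) (by omega)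
      have h3 : ((D.rInf - 3 - (D.rInf - 3 - 1 - k) : ℕ) : ℂ) ≠ 0 := by
        have : D.rInf - 3 - (D.rInf - 3 - 1 - k) ≠ 0 := by omega
        exact_mod_cast this
      rw [div_eq_zero_iff, or_iff_left h3,
        show D.rInf - 3 - 1 - (D.rInf - 3 - 1 - k) = k by omega] at h2
      exact h2
    · ext i j
      exact (infEq_unitDir_rev_iff θ W τ j).1 (h _) i

end IsoLax

/-! ### The explicit tables, and reduction of both systems to the model system. -/

namespace IsoLax

/-- Coefficients of `P = ∑ L / (L - n) t_{L-n} x^n`. -/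
noncomputable def levelP (L : ℕ) (t : ℕ → ℂ) (n : ℕ) : ℂ := (L : ℂ) / ((L : ℂ) - n) * t (L - n)

/-- The table `f` of the general solution at a finite pole of order `ρ`. -/
noncomputable def poleTable (ρ i j : ℕ) (l : ℂ) (t : ℕ → ℂ) : ℂ :=
  levelEntry (ρ - 1) (ρ - 1) (i - 1) (j - 1) l (levelP (ρ - 1) t)

/-- The table `g` of the general solution at a pole of order `ρ` at infinity. -/
noncomputable def infTable (ρ i j : ℕ) (t : ℕ → ℂ) : ℂ :=
  levelEntry (ρ - 1) (ρ - 3) (i - 1) (j - 1) 0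
    (levelP (ρ - 1) fun k => if k + 1 = ρ then 1 else if k + 2 = ρ then 0 else t k)

theorem levelP_zero {L : ℕ} (hL : 0 < L) (t : ℕ → ℂ) : levelP L t 0 = t L := by
  have : (L : ℂ) ≠ 0 := by exact_mod_cast hL.ne'
  simp [levelP, this]

theorem sum_Icc_one (n : ℕ) (f : ℕ → ℂ) :
    ∑ j ∈ Finset.Icc 1 n, f j = ∑ j ∈ Finset.range n, f (j + 1) := by
  have : Finset.Icc 1 n = Finset.Ico 1 (n + 1) := by ext x; rw [Finset.mem_Icc, Finset.mem_Ico]; omega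
  rw [this, Finset.sum_Ico_eq_sum_range]
  exact Finset.sum_congr (by simp) fun j _ => by rw [add_comm]

/-- Entry `(i, j)` is a rescaled coefficient of `x^{i-j}` in `P^{(ρ-j)/(ρ-1)}`, which involves only
the first coefficients of `P`. The diagonal and subdiagonal are its degrees `0` and `1`; in the
first column the exponent is `1`, so the power is `P` itself. -/
theorem poleTable_spec : PoleTable poleTable := by
  intro ρ hρ
  have hL : 0 < ρ - 1 := by omega
  have hc : (((ρ - 1 : ℕ)) : ℂ) = (ρ : ℂ) - 1 := by push_cast [show 1 ≤ ρ by omega]; ring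
  have hρ1 : (ρ : ℂ) - 1 ≠ 0 := by
    rw [← hc]; exact_mod_cast hL.ne'
  have hsub : ∀ j, 1 ≤ j → ((j - 1 : ℕ) : ℂ) = (j : ℂ) - 1 := fun j hj => by
    push_cast [hj]; ring
  have hne : ∀ j, j ≤ ρ - 1 → (ρ : ℂ) - j ≠ 0 := fun j hj => natCast_sub_ne_zero (by omega)
  refine ⟨fun i j hj hji hi l t t' h => ?_, fun l t hl => ⟨fun j hj hj' => ?_, fun j hj hj' => ?_,
    fun j hj hj' => ?_⟩⟩
  · unfold poleTable levelEntry
    congr 1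
    refine rpowCoeff_congr _ fun k hk hk' => ?_
    unfold levelP
    rw [h (ρ - 1 - k) (by omega) (by omega)]
  · unfold poleTable levelEntry
    rw [Nat.sub_self, rpowCoeff_zero, hc, hsub j hj]
    have := hne j hj'
    rw [show (ρ : ℂ) - 1 - (j - 1) = ρ - j by ring, div_self this, one_mul]
  · unfold poleTable levelEntry
    rw [show j + 1 - 1 - (j - 1) = 1 by omega, rpowCoeff_idx_one, hc, hsub j hj,
      hsub (j + 1) (by omega)]
    have h1 := hne j (by omega)
    have h2 := hne 2 (by omega)
    push_cast at h2 ⊢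
    have h3 : ((ρ : ℂ) - 1 - (j - 1)) = ρ - j := by ring
    have h4 : ((ρ : ℂ) - j) / ((ρ : ℂ) - 1) - 1 = (1 - j) / ((ρ : ℂ) - 1) := by
      field_simp; ring
    have h5 : levelP (ρ - 1) t 1 = ((ρ : ℂ) - 1) / ((ρ : ℂ) - 2) * t (ρ - 2) := by
      unfold levelP
      rw [hc, Nat.sub_sub]
      push_cast
      rw [show (ρ : ℂ) - 1 - 1 = ρ - 2 by ring]
    rw [h3, h4, h5]
    field_simp
    ring
  · unfold poleTable levelEntry
    have hs : (((ρ - 1 : ℕ) : ℂ) - ((1 - 1 : ℕ) : ℂ)) / ((ρ - 1 : ℕ) : ℂ) = 1 := by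
      rw [hc]; simp [hρ1]
    rw [hs, rpowCoeff_one (by rw [levelP_zero hL, hl])]
    unfold levelP
    rw [hc, Nat.sub_self, Nat.sub_zero, hsub j hj, show ρ - 1 - (j - 1) = ρ - j by omega]
    have h1 := hne j (by omega)
    rw [show (ρ : ℂ) - 1 - (j - 1) = ρ - j by ring]
    simp only [CharP.cast_eq_zero, sub_zero]
    field_simp

/-- With `p_0 = 1` and `p_1 = 0`, every non-linear monomial of weight `2` contains `p_1`; the same
happens in weight `3`. -/
theorem rpowCoeff_idx_two {s : ℂ} {p : ℕ → ℂ} (h1 : p 1 = 0) :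
    rpowCoeff s 0 p 2 = s * p 2 := by
  rw [rpowCoeff_succ]
  simp [Finset.sum_range_succ, rpowCoeff_zero, h1]
  ring

theorem rpowCoeff_idx_three {s : ℂ} {p : ℕ → ℂ} (h1 : p 1 = 0) :
    rpowCoeff s 0 p 3 = s * p 3 := by
  rw [rpowCoeff_succ]
  simp [Finset.sum_range_succ, rpowCoeff_zero, rpowCoeff_idx_one, h1]
  field_simp

theorem infTable_spec : InfTable infTable := by
  intro ρ hρ
  have hL : 0 < ρ - 1 := by omega
  have hc : (((ρ - 1 : ℕ)) : ℂ) = (ρ : ℂ) - 1 := by push_cast [show 1 ≤ ρ by omega]; ring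
  have hc3 : (((ρ - 3 : ℕ)) : ℂ) = (ρ : ℂ) - 3 := by push_cast [show 3 ≤ ρ by omega]; ring
  have hρ1 : (ρ : ℂ) - 1 ≠ 0 := by
    rw [← hc]; exact_mod_cast hL.ne'
  have hsub : ∀ j, 1 ≤ j → ((j - 1 : ℕ) : ℂ) = (j : ℂ) - 1 := fun j hj => by
    push_cast [hj]; ring
  have hne : ∀ j, j ≤ ρ - 1 → (ρ : ℂ) - j ≠ 0 := fun j hj => natCast_sub_ne_zero (by omega)
  have hp1 : ∀ t : ℕ → ℂ, levelP (ρ - 1)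
      (fun k => if k + 1 = ρ then 1 else if k + 2 = ρ then 0 else t k) 1 = 0 := by
    intro t
    unfold levelP
    beta_reduce
    rw [if_neg (by omega), if_pos (by omega), mul_zero]
  have hpn : ∀ (t : ℕ → ℂ) (n : ℕ), 2 ≤ n → n < ρ - 1 → levelP (ρ - 1)
      (fun k => if k + 1 = ρ then 1 else if k + 2 = ρ then 0 else t k) n =
        ((ρ : ℂ) - 1) / ((ρ : ℂ) - 1 - n) * t (ρ - 1 - n) := by
    intro t n hn hn'
    unfold levelP
    beta_reduce
    rw [if_neg (by omega), if_neg (by omega), hc]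
  refine ⟨fun i j hj hji hi t t' h => ?_, fun t => ⟨fun j hj hj' => ?_, fun j hj hj' => ?_,
    fun j hj hj' => ?_, fun j hj hj' => ?_⟩⟩
  · unfold infTable levelEntry
    congr 1
    refine rpowCoeff_congr _ fun k hk hk' => ?_
    unfold levelP
    congr 1
    beta_reduce
    -- The coefficient `p_1` involves `t_{ρ-2}`, which the table replaces by its frozen value `0`;
    -- this is why the dependence stops at `t_{ρ-3}`.
    by_cases h1 : k = 1
    · subst h1
      simp only [if_neg (show ¬ ρ - 1 - 1 + 1 = ρ by omega), if_pos (show ρ - 1 - 1 + 2 = ρ by omega)]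
    · rw [h (ρ - 1 - k) (by omega) (by omega)]
  · unfold infTable levelEntry
    rw [Nat.sub_self, rpowCoeff_zero, mul_zero, Complex.exp_zero, mul_one,
      div_self (natCast_sub_ne_zero (by omega))]
  · unfold infTable levelEntry
    rw [show j + 1 - 1 - (j - 1) = 1 by omega, rpowCoeff_idx_one, hp1]
    simp
  · unfold infTable levelEntry
    rw [show j + 2 - 1 - (j - 1) = 2 by omega, rpowCoeff_idx_two (hp1 t), hc, hc3,
      hpn t 2 le_rfl (by omega), hsub j hj, hsub (j + 2) (by omega)]
    have h1 := hne (j + 2) (by omega)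
    have h2 := hne 3 (by omega)
    push_cast at h1 h2 ⊢
    rw [show (ρ : ℂ) - 3 - (j + 2 - 1) = ρ - 4 - j by ring,
      show (ρ : ℂ) - 3 - (j - 1) = ρ - (j + 2) by ring, show (ρ : ℂ) - 1 - 2 = ρ - 3 by ring,
      Nat.sub_sub]
    field_simp
  · unfold infTable levelEntry
    rw [show j + 3 - 1 - (j - 1) = 3 by omega, rpowCoeff_idx_three (hp1 t), hc, hc3,
      hpn t 3 (by omega) (by omega), hsub j hj, hsub (j + 3) (by omega)]
    have h1 := hne (j + 2) (by omega)
    have h2 := hne 4 (by omega)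
    push_cast at h1 h2 ⊢
    rw [show (ρ : ℂ) - 3 - (j + 3 - 1) = ρ - 5 - j by ring,
      show (ρ : ℂ) - 3 - (j - 1) = ρ - (j + 2) by ring, show (ρ : ℂ) - 1 - 3 = ρ - 4 by ring,
      Nat.sub_sub]
    field_simp

variable {D : PoleType}

/-- The factor `L/(L-n)` in `P` cancels the `L - n` produced by `L P - θP`, and in `δP` it supplies
the weights of `invDiag`. The two equations then differ by the factor `L`. -/
theorem poleEq_iff_levelSystem (s : Fin D.n) (W : ℕ → Times D → ℂ) (τ α : Times D) :
    PoleEq s W τ α ↔ LevelSystem (D.r s - 1) (D.r s - 1)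
      (fun n τ => levelP (D.r s - 1) (tPole τ s) n) (fun i => W (D.r s - i)) τ α := by
  refine forall₂_congr fun k hk => ?_
  set L := D.r s - 1 with hL
  have hL0 : (L : ℂ) ≠ 0 := by
    have : L ≠ 0 := by omega
    exact_mod_cast this
  have e1 : ∑ i ∈ Finset.range (k + 1), ((L : ℂ) - ((k - i : ℕ) : ℂ)) *
      levelP L (tPole τ s) (k - i) * (fderiv ℂ (W (D.r s - i)) τ α / ((L : ℂ) - i)) =
      L * ∑ i ∈ Finset.range (k + 1), tPole τ s (L - (k - i)) *
      (delta α (W (D.r s - i)) τ / ((L - i : ℕ) : ℂ)) := by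
    rw [Finset.mul_sum]
    refine Finset.sum_congr rfl fun i hi => ?_
    rw [Finset.mem_range] at hi
    have h1 : (L : ℂ) - ((k - i : ℕ) : ℂ) ≠ 0 := natCast_sub_ne_zero (by omega)
    rw [natCast_sub_eq (show i ≤ L by omega), levelP, delta]
    field_simp
  have e2 : ∑ i ∈ Finset.range (k + 1),
      fderiv ℂ (fun τ => levelP L (tPole τ s) (k - i)) τ α * W (D.r s - i) τ =
      L * ∑ j ∈ Finset.range (k + 1), W (D.r s - (k - j)) τ *
      (dPole s (L - j) α / ((L - j : ℕ) : ℂ)) := by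
    rw [Finset.mul_sum, ← Finset.sum_flip]
    refine Finset.sum_congr rfl fun j hj => ?_
    rw [Finset.mem_range] at hj
    rw [Nat.sub_sub_self (by omega)]
    unfold levelP
    rw [((hasFDerivAt_tPole s (L - j) τ).const_mul _).fderiv, natCast_sub_eq (show j ≤ L by omega),
      smul_apply, smul_eq_mul]
    ring
  rw [e1, e2, mul_right_inj' hL0]

theorem differentiable_levelP_tPole (s : Fin D.n) (L n : ℕ) :
    Differentiable ℂ fun τ => levelP L (tPole τ s) n := fun τ =>
  ((hasFDerivAt_tPole s (L - n) τ).const_mul _).differentiableAt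

theorem poleSystem_iff_exists_poleForm {U : Set (Times D)} (hU : IsOpen U) (hU' : IsConnected U)
    {s : Fin D.n} {l : Times D → ℂ}
    (hl : 2 ≤ D.r s → DifferentiableOn ℂ l U ∧
      ∀ τ ∈ U, Complex.exp (l τ) = tPole τ s (D.r s - 1))
    {W : ℕ → Times D → ℂ} (hW : ∀ k ∈ Finset.Icc 1 (D.r s), DifferentiableOn ℂ (W k) U) :
    PoleSystem U s W ↔ ∃ v : ℕ → ℂ, PoleForm poleTable U s l W v := by
  have h1r := D.one_le_r s
  have hconst : (∀ τ ∈ U, ∀ α : Times D, delta α (W 1) τ = 0) ↔ ∃ a, ∀ τ ∈ U, W 1 τ = a := by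
    constructor
    · intro h
      exact IsOpen.exists_is_const_of_fderiv_eq_zero hU hU'.isPreconnected
        (hW 1 (by rw [Finset.mem_Icc]; omega)) fun τ hτ => by ext α; exact h τ hτ α
    · rintro ⟨a, ha⟩ τ hτ α
      have : W 1 =ᶠ[nhds τ] fun _ => a := by
        filter_upwards [hU.mem_nhds hτ] with y hy using ha y hy
      rw [delta, this.fderiv_eq]; simp
  rw [poleSystem_iff fun τ hτ h => by rw [← (hl h).2 τ hτ]; exact Complex.exp_ne_zero _]
  have hlev : (∀ τ ∈ U, ∀ α, PoleEq s W τ α) ↔ ∃ c : ℕ → ℂ, ∀ τ ∈ U, ∀ i < D.r s - 1,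
      W (D.r s - i) τ = ∑ j ∈ Finset.range (i + 1), levelEntry (D.r s - 1) (D.r s - 1) i j (l τ)
        (levelP (D.r s - 1) (tPole τ s)) * c j := by
    rcases Nat.lt_or_ge (D.r s) 2 with h | h
    · have h0 : D.r s - 1 = 0 := by omega
      exact ⟨fun _ => ⟨0, fun τ _ i hi => by omega⟩, fun _ τ _ α k hk => by omega⟩
    · simp only [poleEq_iff_levelSystem]
      exact levelSystem_iff le_rfl hU hU'.isPreconnected (hl h).1
        (fun n => (differentiable_levelP_tPole s _ n).differentiableOn)
        (fun τ hτ => by rw [levelP_zero (by omega), (hl h).2 τ hτ])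
        (fun i hi => hW _ (by rw [Finset.mem_Icc]; omega))
  have hsplit : (∀ τ ∈ U, (∀ α : Times D, delta α (W 1) τ = 0) ∧ ∀ α, PoleEq s W τ α) ↔
      (∀ τ ∈ U, ∀ α : Times D, delta α (W 1) τ = 0) ∧ ∀ τ ∈ U, ∀ α, PoleEq s W τ α :=
    ⟨fun h => ⟨fun τ hτ => (h τ hτ).1, fun τ hτ => (h τ hτ).2⟩, fun h τ hτ => ⟨h.1 τ hτ, h.2 τ hτ⟩⟩
  rw [hsplit, hconst, hlev]
  constructor
  · rintro ⟨⟨a, ha⟩, c, hc⟩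
    -- The constant for `W_1` occupies index `1`, which the reversed constants of the triangular
    -- part never use: their indices are at least `2`.
    refine ⟨fun k => if k = 1 then a else c (D.r s - k), fun τ hτ => ⟨by simpa using ha τ hτ, ?_⟩⟩
    intro i hi
    rw [Finset.mem_Icc] at hi
    rw [sum_Icc_one, show D.r s + 1 - i = D.r s - (i - 1) by omega, hc τ hτ (i - 1) (by omega),
      show i - 1 + 1 = i by omega]
    refine Finset.sum_congr rfl fun j hj => ?_
    rw [Finset.mem_range] at hj
    beta_reduce
    rw [if_neg (by omega), show D.r s - (D.r s + 1 - (j + 1)) = j by omega]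
    rfl
  · rintro ⟨v, hv⟩
    refine ⟨⟨v 1, fun τ hτ => (hv τ hτ).1⟩, fun j => v (D.r s - j), fun τ hτ i hi => ?_⟩
    have := (hv τ hτ).2 (i + 1) (by rw [Finset.mem_Icc]; omega)
    rw [sum_Icc_one, show D.r s + 1 - (i + 1) = D.r s - i by omega] at this
    rw [this]
    refine Finset.sum_congr rfl fun j hj => ?_
    rw [show D.r s + 1 - (j + 1) = D.r s - j by omega]
    rfl

theorem dInf_of_lt {k : ℕ} (h : D.rInf - 3 < k) : dInf D k = 0 := by
  unfold dInf
  rw [dif_neg (by omega)]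

/-- In generating series, the factor `x^2` is moved from `y` to `a`. -/
theorem sum_shift_two (k : ℕ) (y a : ℕ → ℂ) :
    ∑ j ∈ Finset.range (k + 1), (if 2 ≤ k - j then y (k - j - 2) else 0) * a j =
      ∑ i ∈ Finset.range (k + 1), (if 2 ≤ k - i then a (k - i - 2) else 0) * y i := by
  rcases Nat.lt_or_ge k 2 with h | h
  · rw [Finset.sum_eq_zero, Finset.sum_eq_zero] <;>
    · intro i hi
      rw [Finset.mem_range] at hi
      rw [if_neg (by omega), zero_mul]
  · obtain ⟨m, rfl⟩ : ∃ m, k = m + 2 := ⟨k - 2, by omega⟩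
    have key : ∀ f g : ℕ → ℂ, ∑ j ∈ Finset.range (m + 2 + 1),
        (if 2 ≤ m + 2 - j then f (m + 2 - j - 2) else 0) * g j =
        ∑ j ∈ Finset.range (m + 1), f (m - j) * g j := by
      intro f g
      rw [Finset.sum_range_succ, Finset.sum_range_succ]
      rw [if_neg (show ¬ 2 ≤ m + 2 - (m + 2) by omega), if_neg (show ¬ 2 ≤ m + 2 - (m + 1) by omega),
        zero_mul, zero_mul, add_zero, add_zero]
      refine Finset.sum_congr rfl fun j hj => ?_
      rw [Finset.mem_range] at hj
      rw [if_pos (by omega), show m + 2 - j - 2 = m - j by omega]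
    rw [key, key, ← Finset.sum_flip]
    refine Finset.sum_congr rfl fun j hj => ?_
    rw [Finset.mem_range] at hj
    rw [Nat.sub_sub_self (by omega), mul_comm]

/-- Let `T` be the series of the Toeplitz matrix and `Y` that of the shifted unknowns `W_k +
t_{∞,k+1}`. The coefficients `-1, 0, W, …` on the right side form `x^2 Y - T`. Moving `-T` to the
left replaces `δW` by `δY`, and `x^2` times the weighted differentials of the times is `δP/L`, since
`L = N + 2`. -/
theorem infEq_iff_levelSystem (θ : ℂ) {W : ℕ → Times D → ℂ} {τ : Times D} (α : Times D)
    (hW : ∀ k < D.rInf - 3, DifferentiableAt ℂ (W k) τ) :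
    InfEq θ W τ α ↔ LevelSystem (D.rInf - 1) (D.rInf - 3)
      (fun n τ => levelP (D.rInf - 1) (tInf θ τ) n)
      (fun i τ => W (D.rInf - 3 - 1 - i) τ + tInf θ τ (D.rInf - 3 - i)) τ α := by
  refine forall₂_congr fun k hk => ?_
  set L := D.rInf - 1 with hL
  set N := D.rInf - 3 with hN
  have hL0 : (L : ℂ) ≠ 0 := by
    have : L ≠ 0 := by omega
    exact_mod_cast this
  set a : ℕ → ℂ := fun j => dInf D (N - j) α / ((N - j : ℕ) : ℂ) with ha
  have e1 : ∑ i ∈ Finset.range (k + 1), ((L : ℂ) - ((k - i : ℕ) : ℂ)) *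
      levelP L (tInf θ τ) (k - i) *
      (fderiv ℂ (fun τ => W (N - 1 - i) τ + tInf θ τ (N - i)) τ α / ((N : ℂ) - i)) =
      L * (∑ i ∈ Finset.range (k + 1), tInf θ τ (L - (k - i)) *
        (delta α (W (N - 1 - i)) τ / ((N - i : ℕ) : ℂ)) +
        ∑ i ∈ Finset.range (k + 1), tInf θ τ (L - (k - i)) * a i) := by
    rw [← Finset.sum_add_distrib, Finset.mul_sum]
    refine Finset.sum_congr rfl fun i hi => ?_
    rw [Finset.mem_range] at hi
    have h1 : (L : ℂ) - ((k - i : ℕ) : ℂ) ≠ 0 := natCast_sub_ne_zero (by omega)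
    rw [fderiv_fun_add (hW _ (by omega)) (hasFDerivAt_tInf θ _ τ).differentiableAt,
      (hasFDerivAt_tInf θ (N - i) τ).fderiv, add_apply]
    simp only [ha]
    rw [natCast_sub_eq (show i ≤ N by omega), levelP, delta]
    field_simp
  have e2 : ∑ i ∈ Finset.range (k + 1),
      fderiv ℂ (fun τ => levelP L (tInf θ τ) (k - i)) τ α *
        (W (N - 1 - i) τ + tInf θ τ (N - i)) =
      L * ∑ i ∈ Finset.range (k + 1), (if 2 ≤ k - i then a (k - i - 2) else 0) *
        (W (N - 1 - i) τ + tInf θ τ (N - i)) := by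
    rw [Finset.mul_sum]
    refine Finset.sum_congr rfl fun i hi => ?_
    rw [Finset.mem_range] at hi
    unfold levelP
    rw [((hasFDerivAt_tInf θ (L - (k - i)) τ).const_mul _).fderiv, smul_apply, smul_eq_mul]
    by_cases h : 2 ≤ k - i
    · rw [if_pos h]
      simp only [ha]
      rw [show N - (k - i - 2) = L - (k - i) by omega, natCast_sub_eq (show k - i ≤ L by omega)]
      ring
    · rw [if_neg h, dInf_of_lt (by omega)]
      simp
  have e3 : ∑ j ∈ Finset.range (k + 1), (if 2 ≤ k - j then
        W (N - 1 - (k - j - 2)) τ + tInf θ τ (N - (k - j - 2)) else 0) * a j =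
      ∑ j ∈ Finset.range (k + 1), infCoeff W τ (D.rInf - 2 - (k - j)) * a j +
      ∑ i ∈ Finset.range (k + 1), tInf θ τ (L - (k - i)) * a i := by
    rw [← Finset.sum_add_distrib]
    refine Finset.sum_congr rfl fun j hj => ?_
    rw [Finset.mem_range] at hj
    rw [← add_mul]
    congr 1
    unfold infCoeff
    by_cases h0 : k - j = 0
    · rw [if_neg (by omega), if_pos (by omega), h0, Nat.sub_zero, hL, tInf_lead θ τ (by omega)]
      ring
    by_cases h1 : k - j = 1
    · rw [if_neg (by omega), if_neg (by omega), if_pos (by omega), h1,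
        show L - 1 = D.rInf - 2 by omega, tInf_sublead θ τ (by omega)]
      ring
    · rw [if_pos (by omega), if_neg (by omega), if_neg (by omega),
        show N - 1 - (k - j - 2) = D.rInf - 2 - (k - j) by omega,
        show N - (k - j - 2) = L - (k - j) by omega]
  have e4 := sum_shift_two k (fun i => W (N - 1 - i) τ + tInf θ τ (N - i)) a
  rw [e1, e2, ← e4, e3, mul_right_inj' hL0, add_left_inj]

theorem infSystem_iff_exists_infForm {θ : ℂ} {U : Set (Times D)} (hU : IsOpen U)
    (hU' : IsConnected U) {W : ℕ → Times D → ℂ}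
    (hW : ∀ k < D.rInf - 3, DifferentiableOn ℂ (W k) U) :
    InfSystem θ U W ↔ ∃ v : ℕ → ℂ, InfForm infTable θ U W v := by
  rw [infSystem_iff]
  have hlev : (∀ τ ∈ U, ∀ α, InfEq θ W τ α) ↔ ∃ c : ℕ → ℂ, ∀ τ ∈ U, ∀ i < D.rInf - 3,
      W (D.rInf - 3 - 1 - i) τ + tInf θ τ (D.rInf - 3 - i) = ∑ j ∈ Finset.range (i + 1),
        levelEntry (D.rInf - 1) (D.rInf - 3) i j 0 (levelP (D.rInf - 1) (tInf θ τ)) * c j := by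
    rcases Nat.lt_or_ge (D.rInf) 4 with h | h
    · exact ⟨fun _ => ⟨0, fun τ _ i hi => by omega⟩, fun _ τ _ α k hk => by omega⟩
    · have hd : ∀ τ ∈ U, ∀ k < D.rInf - 3, DifferentiableAt ℂ (W k) τ :=
        fun τ hτ k hk => (hW k hk).differentiableAt (hU.mem_nhds hτ)
      -- The leading coefficient of `P` is `1`, so its logarithm is taken to be `0`.
      rw [← levelSystem_iff (l := fun _ => 0) (p := fun n τ => levelP (D.rInf - 1) (tInf θ τ) n)
        (Y := fun i τ => W (D.rInf - 3 - 1 - i) τ + tInf θ τ (D.rInf - 3 - i))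
        (by omega) hU hU'.isPreconnected (by fun_prop)
        (fun n τ _ => ((hasFDerivAt_tInf θ _ τ).const_mul _).differentiableAt.differentiableWithinAt)
        (fun τ _ => by rw [levelP_zero (by omega), tInf_lead θ τ (by omega), Complex.exp_zero])
        (fun i hi => (hW _ (by omega)).fun_add fun τ _ =>
          (hasFDerivAt_tInf θ _ τ).differentiableAt.differentiableWithinAt)]
      exact forall₂_congr fun τ hτ => forall_congr' fun α =>
        infEq_iff_levelSystem θ α (hd τ hτ)
  have htab : ∀ i j, 1 ≤ i → i ≤ D.rInf - 3 → ∀ τ : Times D,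
      infTable D.rInf i j (tInf θ τ) = levelEntry (D.rInf - 1) (D.rInf - 3) (i - 1) (j - 1) 0
        (levelP (D.rInf - 1) (tInf θ τ)) := by
    intro i j h1 hi τ
    unfold infTable
    congr 2
    ext k
    split_ifs with h2 h3
    · rw [show k = D.rInf - 1 by omega, tInf_lead θ τ (by omega)]
    · rw [show k = D.rInf - 2 by omega, tInf_sublead θ τ (by omega)]
    · rfl
  rw [hlev]
  constructor
  · rintro ⟨c, hc⟩
    refine ⟨fun k => c (D.rInf - 3 - 1 - k), fun τ hτ i hi => ?_⟩
    rw [Finset.mem_Icc] at hi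
    have h1 := hc τ hτ (i - 1) (by omega)
    rw [show D.rInf - 3 - 1 - (i - 1) = D.rInf - 3 - i by omega,
      show D.rInf - 3 - (i - 1) = D.rInf - 2 - i by omega, show i - 1 + 1 = i by omega] at h1
    rw [eq_neg_add_iff_add_eq, add_comm, h1, sum_Icc_one]
    refine Finset.sum_congr rfl fun j hj => ?_
    rw [Finset.mem_range] at hj
    beta_reduce
    rw [htab i _ hi.1 hi.2, show D.rInf - 3 - 1 - (D.rInf - 3 - (j + 1)) = j by omega,
      Nat.add_sub_cancel]
  · rintro ⟨v, hv⟩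
    refine ⟨fun j => v (D.rInf - 3 - 1 - j), fun τ hτ i hi => ?_⟩
    have h1 := hv τ hτ (i + 1) (by rw [Finset.mem_Icc]; omega)
    rw [show D.rInf - 3 - (i + 1) = D.rInf - 3 - 1 - i by omega,
      show D.rInf - 2 - (i + 1) = D.rInf - 3 - i by omega, sum_Icc_one] at h1
    rw [h1, neg_add_cancel_comm]
    refine Finset.sum_congr rfl fun j hj => ?_
    rw [Finset.mem_range] at hj
    rw [htab (i + 1) _ (by omega) (by omega), show D.rInf - 3 - (j + 1) = D.rInf - 3 - 1 - j by omega,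
      Nat.add_sub_cancel, Nat.add_sub_cancel]

end IsoLax

/-! ### Toeplitz inversion and uniqueness of partial fractions. -/

namespace IsoLax

open Filter Topology

/-- In truncated power series: if `t ν = a` with `t` invertible, then `b = y ν` is equivalent to `t
b = y a`. This trades the vector `ν`, defined through an inverse matrix, for the matrix in the
differential system. -/
theorem conv_eq_iff {N : ℕ} {t ν a b y : ℕ → ℂ} (ht : t 0 ≠ 0)
    (hν : ∀ k < N, ∑ i ∈ Finset.range (k + 1), t (k - i) * ν i = a k) :
    (∀ k < N, b k = ∑ i ∈ Finset.range (k + 1), y (k - i) * ν i) ↔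
      ∀ k < N, ∑ i ∈ Finset.range (k + 1), t (k - i) * b i =
        ∑ j ∈ Finset.range (k + 1), y (k - j) * a j := by
  set c : ℕ → ℂ := fun k => ∑ i ∈ Finset.range (k + 1), y (k - i) * ν i with hc
  have hcm : PowerSeries.mk c = PowerSeries.mk y * PowerSeries.mk ν := by
    ext k; rw [coeff_mk_mul_mk, PowerSeries.coeff_mk]
  have h1 : ∀ k < N, ∑ i ∈ Finset.range (k + 1), t (k - i) * c i =
      ∑ j ∈ Finset.range (k + 1), y (k - j) * a j := by
    intro k hk
    have hta : PowerSeries.mk t * PowerSeries.mk ν = PowerSeries.mk fun k =>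
        ∑ i ∈ Finset.range (k + 1), t (k - i) * ν i := by
      ext k; rw [coeff_mk_mul_mk, PowerSeries.coeff_mk]
    rw [← coeff_mk_mul_mk, hcm, mul_left_comm, hta, coeff_mk_mul_mk]
    refine Finset.sum_congr rfl fun i hi => ?_
    rw [Finset.mem_range] at hi
    rw [hν i (by omega)]
  constructor
  · intro h k hk
    rw [← h1 k hk]
    refine Finset.sum_congr rfl fun i hi => ?_
    rw [Finset.mem_range] at hi
    rw [h i (by omega)]
  · intro h k hk
    have h2 := eq_zero_of_conv (N := N) (a := t) (b := fun i => b i - c i) ht (fun k hk => by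
      simp only [mul_sub, Finset.sum_sub_distrib, h k hk, h1 k hk, sub_self]) k hk
    exact sub_eq_zero.mp h2

theorem principalPart_eq_zero {X : ℂ} (K : ℕ) {e : ℕ → ℂ} {h : ℂ → ℂ} (hh : ContinuousAt h X)
    (H : ∀ᶠ z in 𝓝[≠] X, ∑ m ∈ Finset.range K, e m / (z - X) ^ (m + 1) + h z = 0) :
    ∀ m < K, e m = 0 := by
  induction K with
  | zero => intro m hm; omega
  | succ K ih =>
    have key : e K = 0 := by
      -- Multiplication by `(z - X)^(K+1)` clears the denominators. The result is continuous at `X`,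
      -- vanishes on a punctured neighbourhood and takes there the value `e K`; the poles are thus
      -- peeled off from the highest order.
      set f : ℂ → ℂ := fun z => ∑ m ∈ Finset.range K, e m * (z - X) ^ (K - m) + e K +
        (z - X) ^ (K + 1) * h z with hf
      have hfc : ContinuousAt f X := by
        refine ContinuousAt.add (by fun_prop) (ContinuousAt.mul (by fun_prop) hh)
      have hf0 : ∀ᶠ z in 𝓝[≠] X, f z = 0 := by
        filter_upwards [H, self_mem_nhdsWithin] with z hz hzX
        have hne : z - X ≠ 0 := sub_ne_zero.mpr hzX
        have h1 := congrArg (fun w => (z - X) ^ (K + 1) * w) hz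
        simp only [mul_zero, mul_add, Finset.mul_sum, Finset.sum_range_succ] at h1
        rw [← h1]
        simp only [hf]
        congr 2
        · refine Finset.sum_congr rfl fun m hm => ?_
          rw [Finset.mem_range] at hm
          rw [show K + 1 = (K - m) + (m + 1) by omega, pow_add]
          field_simp
        · field_simp
      have hlim : Tendsto f (𝓝[≠] X) (𝓝 (f X)) := hfc.tendsto.mono_left nhdsWithin_le_nhds
      have hlim0 : Tendsto f (𝓝[≠] X) (𝓝 0) := tendsto_nhds_of_eventually_eq hf0
      have h2 := tendsto_nhds_unique hlim hlim0
      simp only [hf, sub_self] at h2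
      rw [Finset.sum_eq_zero fun m hm => by
        rw [Finset.mem_range] at hm
        rw [zero_pow (by omega), mul_zero]] at h2
      simpa using h2
    intro m hm
    rcases Nat.lt_succ_iff_lt_or_eq.mp hm with h1 | rfl
    · refine ih ?_ m h1
      filter_upwards [H] with z hz
      simpa [Finset.sum_range_succ, key] using hz
    · exact key

/-- Uniqueness of the partial fraction expansion. -/
theorem partialFraction_eq_zero {ι : Type*} [Fintype ι] {X : ι → ℂ} (hX : Function.Injective X)
    {K : ι → ℕ} {M : ℕ} {e : ι → ℕ → ℂ} {d : ℕ → ℂ}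
    (H : ∀ᶠ z in cofinite, ∑ s, ∑ m ∈ Finset.range (K s), e s m / (z - X s) ^ (m + 1) +
      ∑ k ∈ Finset.range M, d k * z ^ k = 0) :
    (∀ s, ∀ m < K s, e s m = 0) ∧ ∀ k < M, d k = 0 := by
  classical
  have he : ∀ s, ∀ m < K s, e s m = 0 := by
    intro s
    refine principalPart_eq_zero (X := X s) (K s) (h := fun z =>
      ∑ s' ∈ Finset.univ.erase s, ∑ m ∈ Finset.range (K s'), e s' m / (z - X s') ^ (m + 1) +
      ∑ k ∈ Finset.range M, d k * z ^ k) ?_ ?_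
    · refine ContinuousAt.add ?_ (by fun_prop)
      refine tendsto_finsetSum _ fun s' hs' => tendsto_finsetSum _ fun m _ => ?_
      have hne : X s - X s' ≠ 0 := sub_ne_zero.mpr fun h =>
        (Finset.ne_of_mem_erase hs') (hX h).symm
      have : ContinuousAt (fun z => e s' m / (z - X s') ^ (m + 1)) (X s) :=
        ContinuousAt.div (by fun_prop) (by fun_prop) (pow_ne_zero _ hne)
      exact this
    · filter_upwards [nhdsNE_le_cofinite (X s) H] with z hz
      rw [← Finset.add_sum_erase _ _ (Finset.mem_univ s), add_assoc] at hz
      exact hz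
  refine ⟨he, ?_⟩
  have hd : ∀ᶠ z in cofinite, ∑ k ∈ Finset.range M, d k * z ^ k = 0 := by
    filter_upwards [H] with z hz
    rw [Finset.sum_eq_zero, zero_add] at hz
    · exact hz
    · intro s _
      refine Finset.sum_eq_zero fun m hm => ?_
      rw [he s m (by simpa using hm), zero_div]
  -- Once the principal parts are gone, a polynomial with cofinitely many roots is left.
  set p : Polynomial ℂ := ∑ k ∈ Finset.range M, Polynomial.C (d k) * Polynomial.X ^ k with hp
  have hp0 : p = 0 := by
    refine Polynomial.eq_zero_of_infinite_isRoot p ?_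
    have h1 : {z : ℂ | p.IsRoot z} = {z | ∑ k ∈ Finset.range M, d k * z ^ k = 0} := by
      ext z; simp [hp, Polynomial.IsRoot, Polynomial.eval_finsetSum]
    rw [h1]
    exact Set.infinite_of_finite_compl hd
  intro k hk
  have h2 := congrArg (fun p => Polynomial.coeff p k) hp0
  simpa [hp, Polynomial.finsetSum_coeff, Polynomial.coeff_C_mul, Polynomial.coeff_X_pow, hk]
    using h2

theorem isUnit_det_toeplitz {N : ℕ} {t : ℕ → ℂ} (ht : 0 < N → t 0 ≠ 0) :
    IsUnit (Matrix.of fun i j : Fin N => if j ≤ i then t ((i : ℕ) - j) else 0).det := by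
  rw [Matrix.det_of_isLowerTriangular]
  · rw [isUnit_iff_ne_zero, Finset.prod_ne_zero_iff]
    intro i _
    simpa using ht (by have := i.2; omega)
  · intro i j hij
    have : ¬ j ≤ i := not_le.mpr hij
    simp [this]

theorem toeplitz_inv_mulVec {N : ℕ} {t : ℕ → ℂ} (ht : 0 < N → t 0 ≠ 0) (w : Fin N → ℂ)
    {ν : ℕ → ℂ} (hν : ∀ i (hi : i < N), ν i =
      ((Matrix.of fun i j : Fin N => if j ≤ i then t ((i : ℕ) - j) else 0)⁻¹ *ᵥ w) ⟨i, hi⟩)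
    (k : ℕ) (hk : k < N) : ∑ i ∈ Finset.range (k + 1), t (k - i) * ν i = w ⟨k, hk⟩ := by
  set M : Matrix (Fin N) (Fin N) ℂ :=
    Matrix.of fun i j : Fin N => if j ≤ i then t ((i : ℕ) - j) else 0 with hM
  have h1 : M *ᵥ (M⁻¹ *ᵥ w) = w := by
    rw [Matrix.mulVec_mulVec, Matrix.mul_nonsing_inv _ (isUnit_det_toeplitz ht),
      Matrix.one_mulVec]
  have h2 := congrFun h1 ⟨k, hk⟩
  rw [← h2, ← sum_fin_ite_le ⟨k, hk⟩ (fun i => t (k - i) * ν i), Matrix.mulVec, dotProduct]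
  refine Finset.sum_congr rfl fun l _ => ?_
  rw [hν l l.2]
  simp only [hM, Matrix.of_apply, ite_mul, zero_mul]

variable {D : PoleType}

theorem sum_nuPole {τ α : Times D} {s : Fin D.n}
    (hlead : 2 ≤ D.r s → tPole τ s (D.r s - 1) ≠ 0) (k : ℕ) (hk : k < D.r s - 1) :
    ∑ i ∈ Finset.range (k + 1), tPole τ s (D.r s - 1 - (k - i)) * -nuPole τ α s (i + 1) =
      dPole s (D.r s - 1 - k) α / ((D.r s - 1 - k : ℕ) : ℂ) := by
  rw [toeplitz_inv_mulVec (t := fun n => tPole τ s (D.r s - 1 - n))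
    (w := invDiag (D.r s - 1) *ᵥ fun j => coordOr 0 α (Sum.inr (Sum.inl ⟨s, Fin.rev j⟩)))
    (fun h => hlead (by omega)) (ν := fun i => -nuPole τ α s (i + 1)) ?_ k hk]
  · rw [invDiag, Matrix.mulVec_diagonal, dPole, dif_pos ⟨by omega, by omega⟩, coordCLM_apply,
      one_div, inv_mul_eq_div]
    have : (⟨D.r s - 1 - k - 1, by omega⟩ : Fin (D.r s - 1)) = Fin.rev ⟨k, hk⟩ := by
      ext; simp [Fin.val_rev]; omega
    rw [this]
  · intro i hi
    simp only [nuPole]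
    rw [if_neg (by omega), dif_pos (show i + 1 - 1 < D.r s - 1 by omega), neg_neg]
    rfl

theorem sum_nuInf {θ : ℂ} {τ α : Times D} (k : ℕ) (hk : k < D.rInf - 3) :
    ∑ i ∈ Finset.range (k + 1), tInf θ τ (D.rInf - 1 - (k - i)) * nuInf θ τ α (i + 1) =
      dInf D (D.rInf - 3 - k) α / ((D.rInf - 3 - k : ℕ) : ℂ) := by
  rw [toeplitz_inv_mulVec (t := fun n => tInf θ τ (D.rInf - 1 - n))
    (w := invDiag (D.rInf - 3) *ᵥ fun j => coordOr 0 α (Sum.inl (Fin.rev j)))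
    (fun h => by rw [Nat.sub_zero, tInf_lead θ τ (by omega)]; exact one_ne_zero)
    (ν := fun i => nuInf θ τ α (i + 1)) ?_ k hk]
  · rw [invDiag, Matrix.mulVec_diagonal, dInf, dif_pos ⟨by omega, by omega⟩, coordCLM_apply,
      one_div, inv_mul_eq_div]
    have : (⟨D.rInf - 3 - k - 1, by omega⟩ : Fin (D.rInf - 3)) = Fin.rev ⟨k, hk⟩ := by
      ext; simp [Fin.val_rev]; omega
    rw [this]
  · intro i hi
    simp only [nuInf]
    rw [dif_pos (show i + 1 - 1 < D.rInf - 3 by omega)]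
    rfl

end IsoLax

/-! ### Partial fractions of a product. -/

namespace IsoLax

section Generic

variable {ι κ : Type*} [Fintype ι] [Fintype κ]

/-- The rational function with the given partial fraction expansion. -/
noncomputable def partialFraction (X : ι → ℂ) (r : ι → ℕ) (R : ι → ℕ → ℂ) (M : ℕ) (ρ : ℕ → ℂ)
    (z : ℂ) : ℂ :=
  ∑ s, ∑ k ∈ Finset.range (r s), R s k / (z - X s) ^ (k + 1) + ∑ k ∈ Finset.range M, ρ k * z ^ k

/-- Geometric sum for `u^{k+1} - w^{k+1}` with `u = 1/(z - X)` and `w = 1/(q_j - X)`: the difference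
`u - w` contains the factor `z - q_j`. -/
theorem simpleFraction_mul_inv_pow {q μ : κ → ℂ} {X z : ℂ} (hz : z ≠ X) (hzq : ∀ j, z ≠ q j)
    (hq : ∀ j, q j ≠ X) (k : ℕ) :
    (∑ j, μ j / (z - q j)) * (1 / (z - X) ^ (k + 1)) =
      ∑ j, μ j / (z - q j) * (1 / (q j - X) ^ (k + 1)) -
      ∑ m ∈ Finset.range (k + 1), (∑ j, μ j / (q j - X) ^ (k + 1 - m)) / (z - X) ^ (m + 1) := by
  simp only [Finset.sum_div]
  rw [Finset.sum_comm, Finset.sum_mul, ← Finset.sum_sub_distrib]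
  refine Finset.sum_congr rfl fun j _ => ?_
  have h1 : z - X ≠ 0 := sub_ne_zero.mpr hz
  have h2 : q j - X ≠ 0 := sub_ne_zero.mpr (hq j)
  have h3 : z - q j ≠ 0 := sub_ne_zero.mpr (hzq j)
  have h4 := geom_sum₂_mul (z - X)⁻¹ (q j - X)⁻¹ (k + 1)
  have h5 : (z - X)⁻¹ - (q j - X)⁻¹ = -((z - q j) * ((z - X)⁻¹ * (q j - X)⁻¹)) := by
    field_simp; ring
  have h6 : ∑ m ∈ Finset.range (k + 1), μ j / (q j - X) ^ (k + 1 - m) / (z - X) ^ (m + 1) =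
      μ j * ((∑ i ∈ Finset.range (k + 1), (z - X)⁻¹ ^ i * (q j - X)⁻¹ ^ (k + 1 - 1 - i)) *
        ((z - X)⁻¹ * (q j - X)⁻¹)) := by
    rw [Finset.sum_mul, Finset.mul_sum]
    refine Finset.sum_congr rfl fun m hm => ?_
    rw [Finset.mem_range] at hm
    rw [show k + 1 - m = (k + 1 - 1 - m) + 1 by omega, pow_succ, pow_succ]
    simp only [div_eq_mul_inv, mul_inv, inv_pow]
    ring
  rw [h5] at h4
  rw [h6, one_div, one_div, ← inv_pow, ← inv_pow]
  field_simp at h4 ⊢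
  linear_combination -(μ j) * h4

theorem simpleFraction_mul_pow {q μ : κ → ℂ} {z : ℂ} (hzq : ∀ j, z ≠ q j) (k : ℕ) :
    (∑ j, μ j / (z - q j)) * z ^ k = ∑ j, μ j / (z - q j) * q j ^ k +
      ∑ i ∈ Finset.range k, (∑ j, μ j * q j ^ (k - 1 - i)) * z ^ i := by
  simp only [Finset.sum_mul]
  rw [Finset.sum_comm (s := Finset.range k), ← Finset.sum_add_distrib]
  refine Finset.sum_congr rfl fun j _ => ?_
  have h3 : z - q j ≠ 0 := sub_ne_zero.mpr (hzq j)
  have h4 := geom_sum₂_mul z (q j) k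
  have h6 : ∑ i ∈ Finset.range k, μ j * q j ^ (k - 1 - i) * z ^ i =
      μ j * ∑ i ∈ Finset.range k, z ^ i * q j ^ (k - 1 - i) := by
    rw [Finset.mul_sum]
    exact Finset.sum_congr rfl fun i _ => by ring
  rw [h6]
  field_simp
  linear_combination -(μ j) * h4

/-- The hypothesis says that `A z + B + ∑ μ_j/(z - q_j)` has Taylor coefficients `ν_0, …, ν_{r-1}`
at `X`, the corrections in `A` and `B` being those of the affine part. The last term is the
polynomial part of `(A z + B)/(z - X)^{k+1}`. -/
theorem affineFraction_mul_inv_pow {q μ : κ → ℂ} {X z A B : ℂ} {r : ℕ} {ν : ℕ → ℂ}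
    (hz : z ≠ X) (hzq : ∀ j, z ≠ q j) (hq : ∀ j, q j ≠ X)
    (hν : ∀ i < r, ∑ j, μ j / (q j - X) ^ (i + 1) =
      -(ν i - (if i = 0 then X * A + B else 0) - if i = 1 then A else 0)) {k : ℕ} (hk : k < r) :
    (A * z + B + ∑ j, μ j / (z - q j)) * (1 / (z - X) ^ (k + 1)) =
      ∑ j, μ j / (z - q j) * (1 / (q j - X) ^ (k + 1)) +
      ∑ m ∈ Finset.range (k + 1), ν (k - m) / (z - X) ^ (m + 1) + if k = 0 then A else 0 := by
  have h1 : z - X ≠ 0 := sub_ne_zero.mpr hz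
  have h2 : ∑ m ∈ Finset.range (k + 1), (∑ j, μ j / (q j - X) ^ (k + 1 - m)) / (z - X) ^ (m + 1) =
      -∑ m ∈ Finset.range (k + 1), ν (k - m) / (z - X) ^ (m + 1) +
      ∑ m ∈ Finset.range (k + 1), (if k - m = 0 then X * A + B else 0) / (z - X) ^ (m + 1) +
      ∑ m ∈ Finset.range (k + 1), (if k - m = 1 then A else 0) / (z - X) ^ (m + 1) := by
    rw [← Finset.sum_neg_distrib, ← Finset.sum_add_distrib, ← Finset.sum_add_distrib]
    refine Finset.sum_congr rfl fun m hm => ?_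
    rw [Finset.mem_range] at hm
    rw [show k + 1 - m = (k - m) + 1 by omega, hν _ (by omega)]
    ring
  have h3 : ∑ m ∈ Finset.range (k + 1), (if k - m = 0 then X * A + B else 0) / (z - X) ^ (m + 1) =
      (X * A + B) / (z - X) ^ (k + 1) := by
    rw [Finset.sum_eq_single k]
    · simp
    · intro m hm hmk
      rw [Finset.mem_range] at hm
      rw [if_neg (by omega), zero_div]
    · simp
  have h4 : ∑ m ∈ Finset.range (k + 1), (if k - m = 1 then A else 0) / (z - X) ^ (m + 1) =
      A / (z - X) ^ k - if k = 0 then A else 0 := by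
    cases k with
    | zero => simp
    | succ k =>
      rw [Finset.sum_eq_single k]
      · simp
      · intro m hm hmk
        rw [Finset.mem_range] at hm
        rw [if_neg (by omega), zero_div]
      · simp
  have h5 := simpleFraction_mul_inv_pow (μ := μ) hz hzq hq k
  rw [h2, h3, h4] at h5
  rw [add_mul, h5]
  have h6 : (A * z + B) * (1 / (z - X) ^ (k + 1)) =
      (X * A + B) / (z - X) ^ (k + 1) + A / (z - X) ^ k := by
    field_simp; ring
  rw [h6]
  ring

theorem sum_range_triangle {M : ℕ} (c : ℕ → ℂ) (F : ℕ → ℕ → ℂ) (u : ℕ → ℂ) (j : ℕ) :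
    ∑ k ∈ Finset.range M, c k * ∑ m ∈ Finset.range (k + j), F k m * u m =
      ∑ m ∈ Finset.range (M + j), (∑ k ∈ Finset.range M, if m < k + j then F k m * c k else 0) * u m
      := by
  simp only [Finset.sum_mul]
  rw [Finset.sum_comm]
  refine Finset.sum_congr rfl fun k hk => ?_
  rw [Finset.mem_range] at hk
  rw [Finset.mul_sum]
  refine Finset.sum_subset_zero_on_sdiff (fun m hm => ?_) (fun m hm => ?_) fun m hm => ?_
  · rw [Finset.mem_range] at *; omega
  · simp only [Finset.mem_sdiff, Finset.mem_range] at hm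
    rw [if_neg hm.2, zero_mul]
  · rw [Finset.mem_range] at hm
    rw [if_pos hm]; ring

/-- Coefficients of the principal part of the product of `∑ R_k (z-X)^{-k-1}` by
`∑ ν_i (z-X)^i`. -/
noncomputable def principalProd (r : ℕ) (R ν : ℕ → ℂ) (m : ℕ) : ℂ :=
  ∑ k ∈ Finset.range r, if m < k + 1 then ν (k - m) * R k else 0

/-- Coefficients of the polynomial part of the product of `∑ ρ_k z^k` by `∑ S_i z^{-i-1}`. -/
noncomputable def polyProd (M : ℕ) (ρ S : ℕ → ℂ) (m : ℕ) : ℂ :=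
  ∑ k ∈ Finset.range M, if m < k then S (k - 1 - m) * ρ k else 0

/-- The product is decomposed pole by pole: the residue at `q_j` is `μ_j` times the value of the
other factor, the principal part at `X s` uses only the Taylor coefficients `ν`, and the expansion
of `∑ μ_j/(z - q_j)` at infinity enters through the moments of `μ`. -/
theorem affineFraction_mul_partialFraction {X : ι → ℂ} {r : ι → ℕ} {R : ι → ℕ → ℂ} {M : ℕ}
    {ρ : ℕ → ℂ} {q μ : κ → ℂ} {A B : ℂ} {ν : ι → ℕ → ℂ}
    (hq : ∀ j s, q j ≠ X s)
    (hν : ∀ s, ∀ i < r s, ∑ j, μ j / (q j - X s) ^ (i + 1) =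
      -(ν s i - (if i = 0 then X s * A + B else 0) - if i = 1 then A else 0))
    {z : ℂ} (hz : ∀ s, z ≠ X s) (hzq : ∀ j, z ≠ q j) :
    (A * z + B + ∑ j, μ j / (z - q j)) * partialFraction X r R M ρ z =
      ∑ j, partialFraction X r R M ρ (q j) * μ j / (z - q j) +
      (A * z + B) * ∑ k ∈ Finset.range M, ρ k * z ^ k +
      ∑ s, ∑ k ∈ Finset.range (r s), R s k * (if k = 0 then A else 0) +
      partialFraction X r (fun s => principalProd (r s) (R s) (ν s)) M
        (polyProd M ρ fun i => ∑ j, μ j * q j ^ i) z := by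
  have e1 : (A * z + B + ∑ j, μ j / (z - q j)) *
      ∑ s, ∑ k ∈ Finset.range (r s), R s k / (z - X s) ^ (k + 1) =
      ∑ j, (∑ s, ∑ k ∈ Finset.range (r s), R s k / (q j - X s) ^ (k + 1)) * μ j / (z - q j) +
      ∑ s, ∑ m ∈ Finset.range (r s), principalProd (r s) (R s) (ν s) m / (z - X s) ^ (m + 1) +
      ∑ s, ∑ k ∈ Finset.range (r s), R s k * (if k = 0 then A else 0) := by
    simp only [Finset.sum_mul, Finset.sum_div]
    rw [Finset.sum_comm, Finset.mul_sum, ← Finset.sum_add_distrib, ← Finset.sum_add_distrib]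
    refine Finset.sum_congr rfl fun s _ => ?_
    rw [Finset.sum_comm, Finset.mul_sum]
    have e2 : ∑ m ∈ Finset.range (r s), principalProd (r s) (R s) (ν s) m / (z - X s) ^ (m + 1) =
        ∑ k ∈ Finset.range (r s), R s k *
          ∑ m ∈ Finset.range (k + 1), ν s (k - m) * (1 / (z - X s) ^ (m + 1)) := by
      rw [sum_range_triangle _ (fun k m => ν s (k - m)) (fun m => 1 / (z - X s) ^ (m + 1)) 1,
        Finset.sum_range_succ]
      have h0 : principalProd (r s) (R s) (ν s) (r s) = 0 :=
        Finset.sum_eq_zero fun k hk => by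
          rw [Finset.mem_range] at hk
          rw [if_neg (by omega)]
      unfold principalProd at h0 ⊢
      rw [h0, zero_mul, add_zero]
      exact Finset.sum_congr rfl fun m _ => by ring
    rw [e2, ← Finset.sum_add_distrib, ← Finset.sum_add_distrib]
    refine Finset.sum_congr rfl fun k hk => ?_
    rw [Finset.mem_range] at hk
    have h1 := affineFraction_mul_inv_pow (hz s) hzq (fun j => hq j s) (hν s) hk
    have h2 : ∑ j, R s k / (q j - X s) ^ (k + 1) * μ j / (z - q j) =
        R s k * ∑ j, μ j / (z - q j) * (1 / (q j - X s) ^ (k + 1)) := by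
      rw [Finset.mul_sum]
      exact Finset.sum_congr rfl fun j _ => by ring
    rw [h2, show (A * z + B + ∑ j, μ j / (z - q j)) * (R s k / (z - X s) ^ (k + 1)) =
      R s k * ((A * z + B + ∑ j, μ j / (z - q j)) * (1 / (z - X s) ^ (k + 1))) by ring, h1]
    simp only [mul_one_div]
    ring
  have e3 : (∑ j, μ j / (z - q j)) * ∑ k ∈ Finset.range M, ρ k * z ^ k =
      ∑ j, (∑ k ∈ Finset.range M, ρ k * q j ^ k) * μ j / (z - q j) +
      ∑ i ∈ Finset.range M, polyProd M ρ (fun i => ∑ j, μ j * q j ^ i) i * z ^ i := by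
    have e4 := sum_range_triangle (M := M) ρ (fun k m => ∑ j, μ j * q j ^ (k - 1 - m))
      (fun m => z ^ m) 0
    simp only [add_zero] at e4
    unfold polyProd
    rw [← e4]
    simp only [Finset.sum_mul (s := Finset.range M), Finset.sum_div]
    rw [Finset.sum_comm (s := Finset.univ) (t := Finset.range M), Finset.mul_sum,
      ← Finset.sum_add_distrib]
    refine Finset.sum_congr rfl fun k _ => ?_
    have h2 : ∑ j, ρ k * q j ^ k * μ j / (z - q j) = ρ k * ∑ j, μ j / (z - q j) * q j ^ k := by
      rw [Finset.mul_sum]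
      exact Finset.sum_congr rfl fun j _ => by ring
    rw [h2, mul_left_comm, simpleFraction_mul_pow hzq, mul_add]
  unfold partialFraction
  simp only [add_mul (∑ s, ∑ k ∈ Finset.range (r s), _), add_div, Finset.sum_add_distrib]
  rw [mul_add, e1, add_mul _ (∑ j, μ j / (z - q j)), e3]
  ring

end Generic

end IsoLax

/-! ### The isospectral condition in a fixed direction, coefficient by coefficient. -/

namespace IsoLax

open Filter Topology

section Generic

variable {ι : Type*} [Fintype ι]

theorem principalProd_add (a b : ℕ) (R ν : ℕ → ℂ) :
    principalProd (a + b) R ν a = ∑ i ∈ Finset.range b, R (a + i) * ν i := by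
  unfold principalProd
  rw [Finset.sum_range_add, Finset.sum_eq_zero, zero_add]
  · refine Finset.sum_congr rfl fun i _ => ?_
    rw [if_pos (by omega), Nat.add_sub_cancel_left, mul_comm]
  · intro i hi
    rw [Finset.mem_range] at hi
    rw [if_neg (by omega)]

theorem polyProd_add (a b : ℕ) (ρ S : ℕ → ℂ) :
    polyProd (a + 1 + b) ρ S a = ∑ i ∈ Finset.range b, ρ (a + 1 + i) * S i := by
  unfold polyProd
  rw [Finset.sum_range_add, Finset.sum_eq_zero, zero_add]
  · refine Finset.sum_congr rfl fun i _ => ?_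
    rw [if_pos (by omega), show a + 1 + i - 1 - a = i by omega, mul_comm]
  · intro i hi
    rw [Finset.mem_range] at hi
    rw [if_neg (by omega)]

theorem polyProd_of_le {M m : ℕ} (h : M ≤ m + 1) (ρ S : ℕ → ℂ) : polyProd M ρ S m = 0 := by
  unfold polyProd
  refine Finset.sum_eq_zero fun k hk => ?_
  rw [Finset.mem_range] at hk
  rw [if_neg (by omega)]

/-- The condition `ρ M = 0` allows the range `M` to be kept although the differentiated coefficients
are shifted by one. At `m = 0` the truncated index `m - 1` is harmless because of the factor `m`. -/
theorem hasDerivAt_partialFraction {X : ι → ℂ} {r : ι → ℕ} {R : ι → ℕ → ℂ} {M : ℕ} {ρ : ℕ → ℂ}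
    (hρ : ρ M = 0) {z : ℂ} (hz : ∀ s, z ≠ X s) :
    HasDerivAt (partialFraction X r R M ρ)
      (partialFraction X (fun s => r s + 1) (fun s m => -(m * R s (m - 1))) M
        (fun k => (k + 1) * ρ (k + 1)) z) z := by
  have h1 : HasDerivAt (partialFraction X r R M ρ)
      (∑ s, ∑ k ∈ Finset.range (r s), R s k * (-((k + 1 : ℕ) : ℂ) / (z - X s) ^ (k + 2)) +
        ∑ k ∈ Finset.range M, ρ k * (k * z ^ (k - 1))) z := by
    refine HasDerivAt.add (HasDerivAt.fun_sum fun s _ => HasDerivAt.fun_sum fun k _ => ?_)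
      (HasDerivAt.fun_sum fun k _ => (hasDerivAt_pow k z).const_mul _)
    have hne : z - X s ≠ 0 := sub_ne_zero.mpr (hz s)
    have h2 := ((((hasDerivAt_id z).sub_const (X s)).pow (k + 1)).inv
      (pow_ne_zero (k + 1) hne)).const_mul (R s k)
    refine (h2.congr_deriv ?_).congr_of_eventuallyEq (Eventually.of_forall fun w => ?_)
    · simp only [id, Nat.add_sub_cancel, mul_one, Pi.pow_apply]
      congr 1
      rw [← pow_mul, div_eq_div_iff (pow_ne_zero _ hne) (pow_ne_zero _ hne)]
      ring
    · simp [div_eq_mul_inv]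
  refine h1.congr_deriv ?_
  unfold partialFraction
  congr 1
  · refine Finset.sum_congr rfl fun s _ => ?_
    rw [Finset.sum_range_succ' _ (r s)]
    simp only [CharP.cast_eq_zero, zero_mul, neg_zero, zero_div, add_zero, Nat.add_sub_cancel]
    exact Finset.sum_congr rfl fun k _ => by ring
  · cases M with
    | zero => simp
    | succ M =>
      rw [Finset.sum_range_succ' _ M, Finset.sum_range_succ _ M]
      beta_reduce
      rw [hρ]
      simp only [CharP.cast_eq_zero, zero_mul, mul_zero, add_zero, Nat.add_sub_cancel]
      refine Finset.sum_congr rfl fun k _ => ?_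
      push_cast; ring

theorem partialFraction_sub (X : ι → ℂ) (r : ι → ℕ) (R R' : ι → ℕ → ℂ) (M : ℕ) (ρ ρ' : ℕ → ℂ)
    (z : ℂ) : partialFraction X r (fun s m => R s m - R' s m) M (fun k => ρ k - ρ' k) z =
      partialFraction X r R M ρ z - partialFraction X r R' M ρ' z := by
  unfold partialFraction
  simp only [sub_div, sub_mul, Finset.sum_sub_distrib]
  ring

end Generic

variable {D : PoleType}

theorem sum_infCoeff (W : ℕ → Times D → ℂ) (θ : ℂ) (τ : Times D) (z : ℂ) :
    ∑ k ∈ Finset.range (D.rInf - 1), infCoeff W τ k * z ^ k =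
      - (if 2 ≤ D.rInf then tInf θ τ (D.rInf - 1) * z ^ (D.rInf - 2) else 0)
      - (if 3 ≤ D.rInf then tInf θ τ (D.rInf - 2) * z ^ (D.rInf - 3) else 0)
      + ∑ k ∈ Finset.range (D.rInf - 3), W k τ * z ^ k := by
  have h1 := D.one_le_rInf
  by_cases h2 : 2 ≤ D.rInf
  · rw [if_pos h2, tInf_lead θ τ h2, show D.rInf - 1 = D.rInf - 2 + 1 by omega,
      Finset.sum_range_succ]
    have e1 : infCoeff W τ (D.rInf - 2) = -1 := by
      unfold infCoeff; rw [if_pos (by omega)]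
    rw [e1]
    by_cases h3 : 3 ≤ D.rInf
    · rw [if_pos h3, tInf_sublead θ τ h3, show D.rInf - 2 = D.rInf - 3 + 1 by omega,
        Finset.sum_range_succ]
      have e2 : infCoeff W τ (D.rInf - 3) = 0 := by
        unfold infCoeff; rw [if_neg (by omega), if_pos (by omega)]
      have e3 : ∑ k ∈ Finset.range (D.rInf - 3), infCoeff W τ k * z ^ k =
          ∑ k ∈ Finset.range (D.rInf - 3), W k τ * z ^ k := by
        refine Finset.sum_congr rfl fun k hk => ?_
        rw [Finset.mem_range] at hk
        unfold infCoeff; rw [if_neg (by omega), if_neg (by omega)]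
      rw [e2, e3]
      ring
    · rw [if_neg h3, show D.rInf - 2 = 0 by omega, show D.rInf - 3 = 0 by omega]
      simp
  · rw [if_neg h2, if_neg (by omega), show D.rInf - 1 = 0 by omega, show D.rInf - 3 = 0 by omega]
    simp

theorem LaxFamily.IsCoordR.L11_eq {F : LaxFamily D} {U : Set (Times D)}
    {R : Fin D.n → ℕ → Times D → ℂ} {RInf : ℕ → Times D → ℂ} (hR : F.IsCoordR U R RInf)
    {τ : Times D} (hτ : τ ∈ U) {z : ℂ} (hz : ∀ s, z ≠ pos τ s) :
    F.L11 τ z = partialFraction (pos τ) D.r (fun s k => R s (k + 1) τ) (D.rInf - 1)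
      (infCoeff RInf τ) z := by
  rw [hR τ hτ z hz, partialFraction, sum_infCoeff RInf F.θ]
  simp only [sum_Icc_one]
  ring

theorem poleProd_ne_zero {τ : Times D} {z : ℂ} (hz : ∀ s, z ≠ pos τ s) : poleProd τ z ≠ 0 :=
  Finset.prod_ne_zero_iff.mpr fun s _ => pow_ne_zero _ (sub_ne_zero.mpr (hz s))

/-- Lagrange interpolation: at `q_i` the product over all `q_j` vanishes and a single interpolation
term survives. -/
theorem LaxFamily.Generic.L11_q {F : LaxFamily D} {U : Set (Times D)} (hF : F.Generic U)
    {τ : Times D} (hτ : τ ∈ U) (i : Fin D.g) : F.L11 τ (F.q i τ) = F.p i τ := by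
  have h0 : ∏ j, (F.q i τ - F.q j τ) = 0 :=
    Finset.prod_eq_zero (Finset.mem_univ i) (sub_self _)
  have h1 : F.interp τ (F.q i τ) = -(F.p i τ * poleProd τ (F.q i τ)) := by
    unfold LaxFamily.interp
    rw [Finset.sum_eq_single i]
    · rw [Finset.prod_eq_one, mul_one]
      intro j hj
      exact div_self (sub_ne_zero.mpr fun h =>
        (Finset.ne_of_mem_erase hj) (hF.q_inj τ hτ h.symm))
    · intro k _ hk
      rw [Finset.prod_eq_zero (Finset.mem_erase.mpr ⟨hk.symm, Finset.mem_univ i⟩), mul_zero]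
      simp
    · simp
  rw [LaxFamily.L11, h0, h1, mul_zero, sub_zero, neg_neg,
    mul_div_cancel_right₀ _ (poleProd_ne_zero (hF.q_ne_pos τ hτ i))]

/-- The residue of `L11` times the `(1,2)` entry at `q_j` is `p_j μ_j`, which cancels the explicit
pole of the `(1,1)` entry. Everything independent of `z` goes into `K`, as only the `z`-derivative
is used. -/
theorem AuxCoeff.A11_eq {F : LaxFamily D} {U : Set (Times D)} (hF : F.Generic U)
    {R : Fin D.n → ℕ → Times D → ℂ} {RInf : ℕ → Times D → ℂ} (hR : F.IsCoordR U R RInf)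
    {τ : Times D} (hτ : τ ∈ U) {α : Times D} {c : AuxCoeff D} (hc : c.Solves F τ α) :
    ∃ K : ℂ, ∀ z : ℂ, (∀ s, z ≠ pos τ s) → (∀ j, z ≠ F.q j τ) → c.A11 F τ α z = K +
      partialFraction (pos τ) D.r
        (fun s => principalProd (D.r s) (fun k => R s (k + 1) τ) (nuPole τ α s)) (D.rInf - 1)
        (polyProd (D.rInf - 1) (infCoeff RInf τ) fun i => ∑ j, c.μ j * F.q j τ ^ i) z := by
  -- The affine factor times the polynomial part of `L11` is constant in every case: for `r_∞ = 1`
  -- the polynomial part is empty, for `r_∞ = 2` both factors are constant, and for `r_∞ ≥ 3` the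
  -- affine factor is zero.
  have haff : ∃ K' : ℂ, ∀ z, (c.a * z + c.b) *
      ∑ k ∈ Finset.range (D.rInf - 1), infCoeff RInf τ k * z ^ k = K' := by
    rcases Nat.lt_or_ge D.rInf 3 with h | h
    · have h1 := D.one_le_rInf
      rcases (by omega : D.rInf = 1 ∨ D.rInf = 2) with h2 | h2
      · refine ⟨0, fun z => ?_⟩
        rw [show D.rInf - 1 = 0 by omega]
        simp
      · refine ⟨c.b * infCoeff RInf τ 0, fun z => ?_⟩
        rw [show D.rInf - 1 = 1 by omega]
        simp [AuxCoeff.a, h2]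
    · refine ⟨0, fun z => ?_⟩
      have ha : c.a = 0 := if_neg (by omega)
      have hb : c.b = 0 := if_neg (by omega)
      rw [ha, hb]; ring
  obtain ⟨K', hK'⟩ := haff
  refine ⟨F.dω τ α / (2 * F.ω τ) + c.a / 2 + K' + ∑ s, ∑ k ∈ Finset.range (D.r s),
    R s (k + 1) τ * (if k = 0 then c.a else 0), fun z hz hzq => ?_⟩
  have h1 := affineFraction_mul_partialFraction (X := pos τ) (r := D.r)
    (R := fun s k => R s (k + 1) τ) (M := D.rInf - 1) (ρ := infCoeff RInf τ)
    (q := fun j => F.q j τ) (μ := c.μ) (A := c.a) (B := c.b) (ν := nuPole τ α)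
    (hF.q_ne_pos τ hτ) (fun s i hi => by
      have h2 := hc.2 s (i + 1) (by rw [Finset.mem_Icc]; omega)
      rw [h2]
      simp) hz hzq
  rw [hK', ← hR.L11_eq hτ hz] at h1
  simp only [← hR.L11_eq hτ (hF.q_ne_pos τ hτ _), hF.L11_q hτ] at h1
  simp only [AuxCoeff.A11, AuxCoeff.operRow, LaxFamily.gauge, Matrix.vecMul, dotProduct,
    Fin.sum_univ_two]
  simp only [Matrix.cons_val_zero, Matrix.cons_val_one, Matrix.of_apply, Matrix.cons_val', mul_one]
  rw [h1]
  ring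

/-- The poles move with the times, so differentiating `(z - X_s)^{-k}` raises the pole order by one;
hence the order `r_s + 1`. -/
theorem delta_L11 {F : LaxFamily D} {U : Set (Times D)} (hU : IsOpen U)
    {R : Fin D.n → ℕ → Times D → ℂ} {RInf : ℕ → Times D → ℂ} (hR : F.IsCoordR U R RInf)
    (hRd : ∀ s, ∀ k ∈ Finset.Icc 1 (D.r s), DifferentiableOn ℂ (R s k) U)
    (hRInfd : ∀ k < D.rInf - 3, DifferentiableOn ℂ (RInf k) U)
    {τ : Times D} (hτ : τ ∈ U) (α : Times D) {z : ℂ} (hz : ∀ s, z ≠ pos τ s) :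
    delta α (fun τ' => F.L11 τ' z) τ = partialFraction (pos τ) (fun s => D.r s + 1)
      (fun s m => (if m < D.r s then delta α (R s (m + 1)) τ else 0) + m * (R s m τ * dPos s α))
      (D.rInf - 1) (fun k => if k < D.rInf - 3 then delta α (RInf k) τ else 0) z := by
  have hev : (fun τ' => F.L11 τ' z) =ᶠ[𝓝 τ] fun τ' =>
      ∑ s, ∑ k ∈ Finset.range (D.r s), R s (k + 1) τ' / (z - pos τ' s) ^ (k + 1) +
      ∑ k ∈ Finset.range (D.rInf - 1), infCoeff RInf τ' k * z ^ k := by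
    have h1 : ∀ᶠ τ' in 𝓝 τ, ∀ s, z ≠ pos τ' s := by
      rw [eventually_all]
      intro s
      have : ContinuousAt (fun τ' => pos τ' s) τ := (hasFDerivAt_pos s τ).continuousAt
      exact (this.eventually_ne (hz s).symm).mono fun τ' h => h.symm
    filter_upwards [hU.mem_nhds hτ, h1] with τ' hτ' hz'
    rw [hR.L11_eq hτ' hz', partialFraction]
  have hpole : ∀ s, ∀ k < D.r s, HasFDerivAt (fun τ' => R s (k + 1) τ' / (z - pos τ' s) ^ (k + 1))
      ((1 / (z - pos τ s) ^ (k + 1)) • fderiv ℂ (R s (k + 1)) τ +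
        (((k : ℂ) + 1) * R s (k + 1) τ / (z - pos τ s) ^ (k + 2)) • dPos s) τ := by
    intro s k hk
    have hne : z - pos τ s ≠ 0 := sub_ne_zero.mpr (hz s)
    have h1 := ((hRd s (k + 1) (by rw [Finset.mem_Icc]; omega)).differentiableAt
      (hU.mem_nhds hτ)).hasFDerivAt
    have h2 : HasDerivAt (fun w : ℂ => (w ^ (k + 1))⁻¹)
        (-(((k + 1 : ℕ) : ℂ) * (z - pos τ s) ^ k) / ((z - pos τ s) ^ (k + 1)) ^ 2)
        (z - pos τ s) := by
      simpa using (hasDerivAt_pow (k + 1) (z - pos τ s)).fun_inv (pow_ne_zero _ hne)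
    have h3 := h1.fun_mul (h2.comp_hasFDerivAt τ ((hasFDerivAt_pos s τ).const_sub z))
    simp only [div_eq_mul_inv]
    refine h3.congr_fderiv ?_
    ext β
    simp only [add_apply, smul_apply, neg_apply, smul_eq_mul, Function.comp_apply]
    push_cast
    field_simp
    ring
  have hinf : ∀ k, k < D.rInf - 1 → HasFDerivAt (fun τ' => infCoeff RInf τ' k * z ^ k)
      (if k < D.rInf - 3 then z ^ k • fderiv ℂ (RInf k) τ else 0) τ := by
    intro k hk
    unfold infCoeff
    by_cases h3 : k < D.rInf - 3
    · rw [if_pos h3]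
      simp only [if_neg (show ¬ k + 2 = D.rInf by omega), if_neg (show ¬ k + 3 = D.rInf by omega)]
      exact (((hRInfd k h3).differentiableAt (hU.mem_nhds hτ)).hasFDerivAt).mul_const _
    · rw [if_neg h3]
      by_cases h4 : k + 2 = D.rInf
      · simp only [if_pos h4]; exact hasFDerivAt_const _ _
      · simp only [if_neg h4, if_pos (show k + 3 = D.rInf by omega)]; exact hasFDerivAt_const _ _
  have htot := (HasFDerivAt.fun_sum (u := Finset.univ) fun s _ =>
    HasFDerivAt.fun_sum (u := Finset.range (D.r s)) fun k hk =>
      hpole s k (Finset.mem_range.mp hk)).fun_add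
    (HasFDerivAt.fun_sum (u := Finset.range (D.rInf - 1)) fun k hk =>
      hinf k (Finset.mem_range.mp hk))
  rw [delta, hev.fderiv_eq, htot.fderiv]
  simp only [add_apply, sum_apply, smul_apply, smul_eq_mul]
  unfold partialFraction
  congr 1
  · refine Finset.sum_congr rfl fun s _ => ?_
    simp only [add_div, Finset.sum_add_distrib]
    rw [Finset.sum_range_succ, Finset.sum_range_succ' (fun m => (m : ℂ) * _ / _)]
    simp only [lt_irrefl, if_false, zero_div, add_zero, CharP.cast_eq_zero, zero_mul]
    congr 1
    · refine Finset.sum_congr rfl fun k hk => ?_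
      rw [if_pos (Finset.mem_range.mp hk), delta]; ring
    · refine Finset.sum_congr rfl fun k hk => ?_
      push_cast; ring
  · refine Finset.sum_congr rfl fun k _ => ?_
    by_cases h : k < D.rInf - 3
    · simp only [if_pos h, smul_apply, smul_eq_mul, delta, mul_comm]
    · simp only [if_neg h, zero_apply, zero_mul]

/-- The index `m` is the coefficient of `(z - X_s)^{-m-1}`. The value `m = 0` gives `δR_1 = 0`, the
top value `m = r_s` is automatic, and the intermediate ones are the convolution form of the system,
with `m = r_s - 1 - k`. -/
theorem principal_eq_zero_iff {s : Fin D.n} {R : ℕ → Times D → ℂ} {τ α : Times D}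
    (hlead : 2 ≤ D.r s → tPole τ s (D.r s - 1) ≠ 0) :
    (∀ m < D.r s + 1, (if m < D.r s then delta α (R (m + 1)) τ else 0) +
      m * (R m τ * dPos s α) - -(m * principalProd (D.r s) (fun k => R (k + 1) τ)
        (nuPole τ α s) (m - 1)) = 0) ↔ delta α (R 1) τ = 0 ∧ PoleEq s R τ α := by
  have h1r := D.one_le_r s
  have hν0 : nuPole τ α s 0 = -dPos s α := by
    simp [nuPole, dPos, coordCLM_apply]
  -- As `ν_0 = -δX_s`, the term of the moving pole cancels the lowest term of the convolution.
  have hshift : ∀ a b : ℕ, a + (b + 1) = D.r s →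
      R (a + 1) τ * dPos s α + principalProd (D.r s) (fun k => R (k + 1) τ) (nuPole τ α s) a =
      ∑ i ∈ Finset.range b, R (a + i + 2) τ * nuPole τ α s (i + 1) := by
    intro a b hab
    rw [← hab, principalProd_add, Finset.sum_range_succ', hν0]
    simp only [add_zero, mul_neg]
    rw [add_comm, add_assoc, neg_add_cancel, add_zero]
    rfl
  have hpole : PoleEq s R τ α ↔ ∀ k < D.r s - 1,
      delta α (R (D.r s - k)) τ / ((D.r s - 1 - k : ℕ) : ℂ) =
        ∑ i ∈ Finset.range (k + 1), R (D.r s - (k - i)) τ * -nuPole τ α s (i + 1) := by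
    rcases Nat.lt_or_ge (D.r s) 2 with h | h
    · exact ⟨fun _ k hk => by omega, fun _ k hk => by omega⟩
    · exact (conv_eq_iff (y := fun n => R (D.r s - n) τ)
        (t := fun n => tPole τ s (D.r s - 1 - n)) (hlead h) (sum_nuPole hlead)).symm
  have hterm : ∀ k < D.r s - 1,
      (delta α (R (D.r s - k)) τ / ((D.r s - 1 - k : ℕ) : ℂ) =
        ∑ i ∈ Finset.range (k + 1), R (D.r s - (k - i)) τ * -nuPole τ α s (i + 1)) ↔
      (if D.r s - 1 - k < D.r s then delta α (R (D.r s - 1 - k + 1)) τ else 0) +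
      ((D.r s - 1 - k : ℕ) : ℂ) * (R (D.r s - 1 - k) τ * dPos s α) -
      -(((D.r s - 1 - k : ℕ) : ℂ) * principalProd (D.r s) (fun k => R (k + 1) τ)
        (nuPole τ α s) (D.r s - 1 - k - 1)) = 0 := by
    intro k hk
    have hne : ((D.r s - 1 - k : ℕ) : ℂ) ≠ 0 := by
      have : D.r s - 1 - k ≠ 0 := by omega
      exact_mod_cast this
    have h2 := hshift (D.r s - 1 - k - 1) (k + 1) (by omega)
    rw [show D.r s - 1 - k - 1 + 1 = D.r s - 1 - k by omega] at h2
    have h3 : ∑ i ∈ Finset.range (k + 1), R (D.r s - (k - i)) τ * -nuPole τ α s (i + 1) =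
        -∑ i ∈ Finset.range (k + 1), R (D.r s - 1 - k - 1 + i + 2) τ * nuPole τ α s (i + 1) := by
      rw [← Finset.sum_neg_distrib]
      refine Finset.sum_congr rfl fun i hi => ?_
      rw [Finset.mem_range] at hi
      rw [show D.r s - (k - i) = D.r s - 1 - k - 1 + i + 2 by omega]; ring
    rw [if_pos (by omega), h3, ← h2, show D.r s - 1 - k + 1 = D.r s - k by omega,
      div_eq_iff hne]
    constructor
    · intro h; linear_combination h
    · intro h; linear_combination h
  rw [hpole]
  constructor
  · intro h
    refine ⟨?_, fun k hk => (hterm k hk).2 (h _ (by omega))⟩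
    have := h 0 (by omega)
    simpa [show 0 < D.r s by omega] using this
  · rintro ⟨h0, h⟩ m hm
    rcases Nat.eq_zero_or_pos m with rfl | hm0
    · simp [h0]
    rcases Nat.lt_succ_iff_lt_or_eq.mp hm with h1 | h1
    · have := (hterm (D.r s - 1 - m) (by omega)).1 (h _ (by omega))
      rwa [show D.r s - 1 - (D.r s - 1 - m) = m by omega] at this
    · have h2 := hshift (m - 1) 0 (by omega)
      rw [show m - 1 + 1 = m by omega, Finset.range_zero, Finset.sum_empty] at h2
      rw [if_neg (by omega)]
      linear_combination (m : ℂ) * h2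

/-- Multiplication by a series in `1/z` lowers the degree and differentiation lowers it again, so
the two top coefficients, which are frozen in `L11`, give no condition. The others are the
convolution form of the system at infinity. -/
theorem polynomial_eq_zero_iff {θ : ℂ} {W : ℕ → Times D → ℂ} {τ α : Times D} {S : ℕ → ℂ}
    (hS : ∀ k < D.rInf - 3, S k = nuInf θ τ α (k + 1)) :
    (∀ k < D.rInf - 1, (if k < D.rInf - 3 then delta α (W k) τ else 0) -
      ((k : ℂ) + 1) * polyProd (D.rInf - 1) (infCoeff W τ) S (k + 1) = 0) ↔ InfEq θ W τ α := by
  have hinf : InfEq θ W τ α ↔ ∀ k < D.rInf - 3,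
      delta α (W (D.rInf - 3 - 1 - k)) τ / ((D.rInf - 3 - k : ℕ) : ℂ) =
        ∑ i ∈ Finset.range (k + 1), infCoeff W τ (D.rInf - 2 - (k - i)) * S i := by
    rcases Nat.lt_or_ge D.rInf 4 with h | h
    · exact ⟨fun _ k hk => by omega, fun _ k hk => by omega⟩
    · refine (conv_eq_iff (y := fun n => infCoeff W τ (D.rInf - 2 - n))
        (t := fun n => tInf θ τ (D.rInf - 1 - n)) ?_ fun k hk => ?_).symm
      · rw [Nat.sub_zero, tInf_lead θ τ (by omega)]; exact one_ne_zero
      · rw [← sum_nuInf k hk]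
        refine Finset.sum_congr rfl fun i hi => ?_
        rw [Finset.mem_range] at hi
        rw [hS i (by omega)]
  have hterm : ∀ k < D.rInf - 3,
      (delta α (W (D.rInf - 3 - 1 - k)) τ / ((D.rInf - 3 - k : ℕ) : ℂ) =
        ∑ i ∈ Finset.range (k + 1), infCoeff W τ (D.rInf - 2 - (k - i)) * S i) ↔
      (if D.rInf - 3 - 1 - k < D.rInf - 3 then delta α (W (D.rInf - 3 - 1 - k)) τ else 0) -
      (((D.rInf - 3 - 1 - k : ℕ) : ℂ) + 1) *
        polyProd (D.rInf - 1) (infCoeff W τ) S (D.rInf - 3 - 1 - k + 1) = 0 := by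
    intro k hk
    have hne : ((D.rInf - 3 - k : ℕ) : ℂ) ≠ 0 := by
      have : D.rInf - 3 - k ≠ 0 := by omega
      exact_mod_cast this
    have h2 : polyProd (D.rInf - 1) (infCoeff W τ) S (D.rInf - 3 - 1 - k + 1) =
        ∑ i ∈ Finset.range (k + 1), infCoeff W τ (D.rInf - 2 - (k - i)) * S i := by
      conv_lhs => rw [show D.rInf - 1 = (D.rInf - 3 - 1 - k + 1) + 1 + (k + 1) by omega]
      rw [polyProd_add]
      refine Finset.sum_congr rfl fun i hi => ?_
      rw [Finset.mem_range] at hi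
      rw [show D.rInf - 3 - 1 - k + 1 + 1 + i = D.rInf - 2 - (k - i) by omega]
    have h3 : ((D.rInf - 3 - 1 - k : ℕ) : ℂ) + 1 = ((D.rInf - 3 - k : ℕ) : ℂ) := by
      rw [show D.rInf - 3 - k = D.rInf - 3 - 1 - k + 1 by omega]; push_cast; ring
    rw [if_pos (by omega), h2, h3, div_eq_iff hne, sub_eq_zero, mul_comm (_ : ℂ)]
  rw [hinf]
  constructor
  · intro h k hk
    exact (hterm k hk).2 (h _ (by omega))
  · intro h k hk
    by_cases h1 : k < D.rInf - 3
    · have := (hterm (D.rInf - 3 - 1 - k) (by omega)).1 (h _ (by omega))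
      rwa [show D.rInf - 3 - 1 - (D.rInf - 3 - 1 - k) = k by omega] at this
    · rw [if_neg h1, polyProd_of_le (by omega)]; ring

theorem isospectral_direction_iff {F : LaxFamily D} {U : Set (Times D)} (hU : IsOpen U)
    (hF : F.Generic U) {R : Fin D.n → ℕ → Times D → ℂ} {RInf : ℕ → Times D → ℂ}
    (hR : F.IsCoordR U R RInf)
    (hRd : ∀ s, ∀ k ∈ Finset.Icc 1 (D.r s), DifferentiableOn ℂ (R s k) U)
    (hRInfd : ∀ k < D.rInf - 3, DifferentiableOn ℂ (RInf k) U)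
    {τ : Times D} (hτ : τ ∈ U) {α : Times D} {c : AuxCoeff D} (hc : c.Solves F τ α) :
    (∀ z : ℂ, (∀ s, z ≠ pos τ s) → (∀ j, z ≠ F.q j τ) →
      delta α (fun τ' => F.L11 τ' z) τ = deriv (fun w => c.A11 F τ α w) z) ↔
    (∀ s, delta α (R s 1) τ = 0 ∧ PoleEq s (R s) τ α) ∧ InfEq F.θ RInf τ α := by
  obtain ⟨K, hK⟩ := AuxCoeff.A11_eq hF hR hτ hc
  set S : ℕ → ℂ := fun i => ∑ j, c.μ j * F.q j τ ^ i with hS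
  have hfin : ∀ᶠ z in cofinite, (∀ s, z ≠ pos τ s) ∧ ∀ j, z ≠ F.q j τ := by
    filter_upwards [(Set.finite_range (pos τ)).compl_mem_cofinite,
      (Set.finite_range fun j => F.q j τ).compl_mem_cofinite] with z h1 h2
    exact ⟨fun s h => h1 ⟨s, h.symm⟩, fun j h => h2 ⟨j, h.symm⟩⟩
  have hderiv : ∀ z : ℂ, (∀ s, z ≠ pos τ s) → (∀ j, z ≠ F.q j τ) →
      deriv (fun w => c.A11 F τ α w) z = partialFraction (pos τ) (fun s => D.r s + 1)
        (fun s m => -(m * principalProd (D.r s) (fun k => R s (k + 1) τ) (nuPole τ α s) (m - 1)))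
        (D.rInf - 1)
        (fun k => ((k : ℂ) + 1) * polyProd (D.rInf - 1) (infCoeff RInf τ) S (k + 1)) z := by
    intro z hz hzq
    have hev : (fun w => c.A11 F τ α w) =ᶠ[𝓝 z] fun w => K + partialFraction (pos τ) D.r
        (fun s => principalProd (D.r s) (fun k => R s (k + 1) τ) (nuPole τ α s)) (D.rInf - 1)
        (polyProd (D.rInf - 1) (infCoeff RInf τ) S) w := by
      have h1 : ∀ᶠ w in 𝓝 z, ∀ s, w ≠ pos τ s :=
        eventually_all.mpr fun s => eventually_ne_nhds (hz s)
      have h2 : ∀ᶠ w in 𝓝 z, ∀ j, w ≠ F.q j τ :=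
        eventually_all.mpr fun j => eventually_ne_nhds (hzq j)
      filter_upwards [h1, h2] with w hw1 hw2 using hK w hw1 hw2
    rw [hev.deriv_eq]
    exact ((hasDerivAt_partialFraction (polyProd_of_le (by omega) _ _) hz).const_add K).deriv
  have hiff : (∀ z : ℂ, (∀ s, z ≠ pos τ s) → (∀ j, z ≠ F.q j τ) →
      delta α (fun τ' => F.L11 τ' z) τ = deriv (fun w => c.A11 F τ α w) z) ↔
      ∀ z : ℂ, (∀ s, z ≠ pos τ s) → (∀ j, z ≠ F.q j τ) →
        partialFraction (pos τ) (fun s => D.r s + 1)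
          (fun s m => (if m < D.r s then delta α (R s (m + 1)) τ else 0) +
            m * (R s m τ * dPos s α) -
            -(m * principalProd (D.r s) (fun k => R s (k + 1) τ) (nuPole τ α s) (m - 1)))
          (D.rInf - 1) (fun k => (if k < D.rInf - 3 then delta α (RInf k) τ else 0) -
            ((k : ℂ) + 1) * polyProd (D.rInf - 1) (infCoeff RInf τ) S (k + 1)) z = 0 := by
    refine forall_congr' fun z => forall₂_congr fun hz hzq => ?_
    rw [delta_L11 hU hR hRd hRInfd hτ α hz, hderiv z hz hzq, partialFraction_sub, sub_eq_zero]
  rw [hiff, ← polynomial_eq_zero_iff (S := S) hc.1]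
  simp only [← principal_eq_zero_iff (hF.lead_ne τ hτ _)]
  constructor
  · intro h
    exact partialFraction_eq_zero (hF.pos_inj τ hτ) (hfin.mono fun z hz => h z hz.1 hz.2)
  · rintro ⟨h1, h2⟩ z _ _
    unfold partialFraction
    rw [Finset.sum_eq_zero, Finset.sum_eq_zero, add_zero]
    · intro k hk
      beta_reduce
      rw [h2 k (Finset.mem_range.mp hk), zero_mul]
    · intro s _
      exact Finset.sum_eq_zero fun m hm => by
        beta_reduce
        rw [h1 s m (Finset.mem_range.mp hm), zero_div]

end IsoLax

/-! ### Solvability of the system for the unknowns of the auxiliary matrix. -/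

namespace IsoLax

section Generic

variable {ι κ : Type*} [Fintype ι] [Fintype κ]

-- The polynomial is the numerator of `A z + B + ∑ μ_j/(z - q_j)`, and the hypothesis is the
-- vanishing of its first `r` Taylor coefficients at `X₀`. A finite geometric sum replaces the
-- Taylor expansion.
open Polynomial in
theorem pow_dvd_affine_numerator [DecidableEq κ] {q μ : κ → ℂ} {X₀ A B : ℂ} {r : ℕ} (hr : 1 ≤ r)
    (hq : ∀ j, q j ≠ X₀)
    (hν : ∀ i < r, ∑ j, μ j / (q j - X₀) ^ (i + 1) =
      (if i = 0 then X₀ * A + B else 0) + if i = 1 then A else 0) :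
    (X - C X₀) ^ r ∣ (C A * X + C B) * ∏ j, (X - C (q j)) +
      ∑ j, C (μ j) * ∏ i ∈ Finset.univ.erase j, (X - C (q i)) := by
  have h1 : ∀ j, C (μ j) * ∏ i ∈ Finset.univ.erase j, (X - C (q i)) =
      (X - C X₀) ^ r * (C (μ j * (q j - X₀)⁻¹ ^ r) * ∏ i ∈ Finset.univ.erase j, (X - C (q i))) -
      (∏ i, (X - C (q i))) *
        ∑ m ∈ Finset.range r, (X - C X₀) ^ m * C (μ j / (q j - X₀) ^ (m + 1)) := by
    intro j
    have hne : q j - X₀ ≠ 0 := sub_ne_zero.mpr (hq j)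
    have h2 := geom_sum_mul ((X - C X₀) * C ((q j - X₀)⁻¹)) r
    have h3 : (X - C X₀) * C ((q j - X₀)⁻¹) - 1 = (X - C (q j)) * C ((q j - X₀)⁻¹) := by
      have h4 : (1 : ℂ[X]) = C (q j - X₀) * C ((q j - X₀)⁻¹) := by
        rw [← C_mul, mul_inv_cancel₀ hne, C_1]
      rw [h4, C_sub]; ring
    have h5 : ∑ m ∈ Finset.range r, (X - C X₀) ^ m * C (μ j / (q j - X₀) ^ (m + 1)) =
        C (μ j) * C ((q j - X₀)⁻¹) *
          ∑ m ∈ Finset.range r, ((X - C X₀) * C ((q j - X₀)⁻¹)) ^ m := by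
      rw [Finset.mul_sum]
      refine Finset.sum_congr rfl fun m _ => ?_
      rw [div_eq_mul_inv, pow_succ, mul_inv, ← inv_pow, mul_pow, C_mul, C_mul, C_pow]
      ring
    rw [h3, mul_pow] at h2
    rw [h5, ← Finset.mul_prod_erase _ _ (Finset.mem_univ j), C_mul, C_pow]
    linear_combination (C (μ j) * ∏ i ∈ Finset.univ.erase j, (X - C (q i))) * h2
  have h6 : ∑ j, ∑ m ∈ Finset.range r, (X - C X₀) ^ m * C (μ j / (q j - X₀) ^ (m + 1)) =
      ∑ m ∈ Finset.range r,
        (X - C X₀) ^ m * C ((if m = 0 then X₀ * A + B else 0) + if m = 1 then A else 0) := by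
    rw [Finset.sum_comm]
    refine Finset.sum_congr rfl fun m hm => ?_
    rw [← Finset.mul_sum, ← map_sum, hν m (Finset.mem_range.mp hm)]
  simp only [h1]
  rw [Finset.sum_sub_distrib, ← Finset.mul_sum, ← Finset.mul_sum, h6]
  have h7 : (X - C X₀) ^ r ∣ C A * X + C B - ∑ m ∈ Finset.range r,
        (X - C X₀) ^ m * C ((if m = 0 then X₀ * A + B else 0) + if m = 1 then A else 0) := by
    rcases Nat.lt_or_ge r 2 with h | h
    · obtain rfl : r = 1 := by omega
      refine ⟨C A, ?_⟩
      simp only [Finset.sum_range_one, pow_zero, one_mul, if_true, pow_one, zero_ne_one, if_false,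
        C_add, C_mul, C_0]
      ring
    · obtain ⟨m, rfl⟩ : ∃ m, r = m + 2 := ⟨r - 2, by omega⟩
      rw [Finset.sum_range_succ', Finset.sum_range_succ', Finset.sum_eq_zero]
      · simp only [zero_add, pow_zero, one_mul, if_true, pow_one, one_ne_zero, zero_ne_one,
          if_false, add_zero, C_add, C_mul]
        refine ⟨0, ?_⟩
        ring
      · intro k _
        rw [if_neg (by omega), if_neg (by omega)]
        simp
  obtain ⟨T, hT⟩ := h7
  refine ⟨∑ j, C (μ j * (q j - X₀)⁻¹ ^ r) * ∏ i ∈ Finset.univ.erase j, (X - C (q i)) +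
    T * ∏ i, (X - C (q i)), ?_⟩
  linear_combination (∏ i, (X - C (q i))) * hT

open Polynomial in
theorem degree_sum_mul_prod_erase_lt [DecidableEq κ] (q μ : κ → ℂ) :
    (∑ j, C (μ j) * ∏ i ∈ Finset.univ.erase j, (X - C (q i))).degree <
      ((Fintype.card κ : ℕ) : WithBot ℕ) := by
  rw [← mem_degreeLT]
  refine Submodule.sum_mem _ fun j _ => ?_
  rw [mem_degreeLT]
  rw [← smul_eq_C_mul]
  refine lt_of_le_of_lt (degree_smul_le _ _) ?_
  rw [degree_prod]
  simp only [degree_X_sub_C, Finset.sum_const, Finset.card_erase_of_mem (Finset.mem_univ j),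
    Finset.card_univ, nsmul_eq_mul, mul_one]
  have : 0 < Fintype.card κ := Fintype.card_pos_iff.mpr ⟨j⟩
  exact_mod_cast (by omega : Fintype.card κ - 1 < Fintype.card κ)

-- If the first `N` moments of `μ` vanish, `∑ μ_j/(z - q_j)` decays like `z^{-N-1}`, so multiplying
-- it by `z^N` gives again a sum of simple fractions. This lowers the degree of the numerator by
-- `N`.
open Polynomial in
theorem X_pow_mul_sum_mul_prod_erase [DecidableEq κ] {q μ : κ → ℂ} {N : ℕ}
    (h : ∀ k < N, ∑ j, μ j * q j ^ k = 0) :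
    X ^ N * ∑ j, C (μ j) * ∏ i ∈ Finset.univ.erase j, (X - C (q i)) =
      ∑ j, C (μ j * q j ^ N) * ∏ i ∈ Finset.univ.erase j, (X - C (q i)) := by
  have h1 : ∀ j, X ^ N * (C (μ j) * ∏ i ∈ Finset.univ.erase j, (X - C (q i))) =
      C (μ j * q j ^ N) * ∏ i ∈ Finset.univ.erase j, (X - C (q i)) +
      (∏ i, (X - C (q i))) * ∑ m ∈ Finset.range N, X ^ m * C (μ j * q j ^ (N - 1 - m)) := by
    intro j
    have h2 := geom_sum₂_mul (X : ℂ[X]) (C (q j)) N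
    have h3 : ∑ m ∈ Finset.range N, (X : ℂ[X]) ^ m * C (μ j * q j ^ (N - 1 - m)) =
        C (μ j) * ∑ m ∈ Finset.range N, X ^ m * C (q j) ^ (N - 1 - m) := by
      rw [Finset.mul_sum]
      exact Finset.sum_congr rfl fun m _ => by rw [C_mul, C_pow]; ring
    rw [h3, ← Finset.mul_prod_erase _ _ (Finset.mem_univ j), C_mul, C_pow]
    linear_combination -(C (μ j) * ∏ i ∈ Finset.univ.erase j, (X - C (q i))) * h2
  rw [Finset.mul_sum]
  simp only [h1]
  rw [Finset.sum_add_distrib, ← Finset.mul_sum, Finset.sum_comm]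
  rw [Finset.sum_eq_zero (s := Finset.range N), mul_zero, add_zero]
  intro m hm
  rw [Finset.mem_range] at hm
  rw [← Finset.mul_sum, ← map_sum, h _ (by omega)]
  simp

-- The numerator is divisible by `∏ (X - X_s)^{r_s}` but has smaller degree, hence is zero;
-- evaluating it at each `q_j` isolates `μ_j`. The alternatives in `hdeg` serve `r_∞ ≥ 3`, `r_∞ = 2`
-- and `r_∞ = 1`, where each missing vanishing moment or extra affine unknown changes the degree
-- count.
open Polynomial in
theorem affineFraction_eq_zero {X₀ : ι → ℂ} (hX : Function.Injective X₀) {r : ι → ℕ}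
    (hr : ∀ s, 1 ≤ r s) {q μ : κ → ℂ} (hqi : Function.Injective q) (hq : ∀ j s, q j ≠ X₀ s)
    {A B : ℂ} {N : ℕ} (hN : ∀ k < N, ∑ j, μ j * q j ^ k = 0)
    (hν : ∀ s, ∀ i < r s, ∑ j, μ j / (q j - X₀ s) ^ (i + 1) =
      (if i = 0 then X₀ s * A + B else 0) + if i = 1 then A else 0)
    (hdeg : (A = 0 ∧ B = 0 ∧ Fintype.card κ ≤ N + ∑ s, r s) ∨
      (A = 0 ∧ Fintype.card κ + 1 ≤ ∑ s, r s) ∨ Fintype.card κ + 2 ≤ ∑ s, r s) :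
    μ = 0 ∧ A = 0 ∧ B = 0 := by
  classical
  set P : ℂ[X] := (C A * X + C B) * ∏ j, (X - C (q j)) +
      ∑ j, C (μ j) * ∏ i ∈ Finset.univ.erase j, (X - C (q i)) with hP
  have hdvd : ∏ s, (X - C (X₀ s)) ^ r s ∣ P := by
    refine Finset.prod_dvd_of_coprime ?_ fun s _ =>
      pow_dvd_affine_numerator (hr s) (fun j => hq j s) (hν s)
    intro s _ s' _ hss
    exact (pairwise_coprime_X_sub_C hX hss).pow
  have hdegS := degree_sum_mul_prod_erase_lt q μ
  have hQ : (∏ j, (X - C (q j))).degree = ((Fintype.card κ : ℕ) : WithBot ℕ) := by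
    rw [degree_prod]; simp
  have hPdeg : P.degree < ((∑ s, r s : ℕ) : WithBot ℕ) := by
    rcases hdeg with ⟨hA, hB, h⟩ | ⟨hA, h⟩ | h
    · have h1 : P = ∑ j, C (μ j) * ∏ i ∈ Finset.univ.erase j, (X - C (q i)) := by
        rw [hP, hA, hB]; simp
      have h2 := degree_sum_mul_prod_erase_lt q fun j => μ j * q j ^ N
      rw [← X_pow_mul_sum_mul_prod_erase hN, ← h1, degree_mul, degree_X_pow] at h2
      by_cases h0 : P = 0
      · rw [h0, degree_zero]; exact WithBot.bot_lt_coe _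
      · rw [degree_eq_natDegree h0] at h2 ⊢
        have h3 : N + P.natDegree < Fintype.card κ := by exact_mod_cast h2
        exact_mod_cast (by omega : P.natDegree < ∑ s, r s)
    · refine lt_of_le_of_lt (degree_add_le _ _) (max_lt ?_ ?_)
      · rw [degree_mul, hQ, hA]
        refine lt_of_le_of_lt (add_le_add (b := 0) ?_ le_rfl) ?_
        · rw [C_0, zero_mul, zero_add]; exact degree_C_le
        · rw [zero_add]; exact_mod_cast h
      · exact hdegS.trans (by exact_mod_cast h)
    · refine lt_of_le_of_lt (degree_add_le _ _) (max_lt ?_ ?_)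
      · rw [degree_mul, hQ]
        refine lt_of_le_of_lt (add_le_add (b := 1) degree_linear_le le_rfl) ?_
        exact_mod_cast (by omega : 1 + Fintype.card κ < ∑ s, r s)
      · exact hdegS.trans (by exact_mod_cast (by omega : Fintype.card κ < ∑ s, r s))
  have hP0 : P = 0 := by
    refine eq_zero_of_dvd_of_degree_lt hdvd ?_
    rw [degree_prod]
    simpa using hPdeg
  have hμ : μ = 0 := by
    ext j
    have h1 := congrArg (eval (q j)) hP0
    rw [hP, eval_add, eval_mul, eval_prod,
      Finset.prod_eq_zero (Finset.mem_univ j) (by simp), mul_zero, zero_add, eval_finsetSum,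
      Finset.sum_eq_single j] at h1
    · rw [eval_mul, eval_C, eval_prod, eval_zero, mul_eq_zero] at h1
      refine h1.resolve_right (Finset.prod_ne_zero_iff.mpr fun i hi => ?_)
      simpa [sub_eq_zero] using fun h => (Finset.ne_of_mem_erase hi) (hqi h).symm
    · intro i _ hij
      rw [eval_mul, eval_prod, Finset.prod_eq_zero (i := j), mul_zero]
      · exact Finset.mem_erase.mpr ⟨hij.symm, Finset.mem_univ j⟩
      · simp
    · simp
  refine ⟨hμ, ?_⟩
  have h2 : C A * X + C B = 0 := by
    rw [hP, hμ] at hP0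
    simp only [Pi.zero_apply, C_0, zero_mul, Finset.sum_const_zero, add_zero, mul_eq_zero] at hP0
    refine hP0.resolve_right fun h => ?_
    rw [h, degree_zero] at hQ
    exact WithBot.bot_ne_coe hQ
  have h3 := congrArg (fun p => coeff p 0) h2
  have h4 := congrArg (fun p => coeff p 1) h2
  exact ⟨by simpa [coeff_C] using h4, by simpa [coeff_C] using h3⟩

end Generic

variable {D : PoleType}

/-- Labels of the unknowns `μ_j`, `ν_{∞,0}` (if `r_∞ ≤ 2`), `ν_{∞,-1}` (if `r_∞ = 1`). -/
abbrev AuxIndex (D : PoleType) : Type := Fin D.g ⊕ Fin (3 - D.rInf)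

/-- Labels of the equations for the unknowns. -/
abbrev AuxEquation (D : PoleType) : Type := Fin (D.rInf - 3) ⊕ (Σ s : Fin D.n, Fin (D.r s))

/-- The coefficient `ν_{∞,-i}` as a linear form on the unknowns. -/
noncomputable def auxTail (D : PoleType) (i : ℕ) : (AuxIndex D → ℂ) →ₗ[ℂ] ℂ :=
  if h : i < 3 - D.rInf then LinearMap.proj (Sum.inr ⟨i, h⟩) else 0

/-- The coefficients with given unknowns. -/
noncomputable def auxOfVec (w : AuxIndex D → ℂ) : AuxCoeff D :=
  ⟨fun j => w (Sum.inl j), auxTail D 1 w, auxTail D 0 w⟩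

theorem auxOfVec_a (w : AuxIndex D → ℂ) : (auxOfVec w).a = auxTail D 1 w := by
  unfold AuxCoeff.a
  split_ifs with h
  · rfl
  · have := D.one_le_rInf
    simp [auxTail, show ¬ 1 < 3 - D.rInf by omega]

theorem auxOfVec_b (w : AuxIndex D → ℂ) : (auxOfVec w).b = auxTail D 0 w := by
  unfold AuxCoeff.b
  split_ifs with h
  · rfl
  · simp [auxTail, show ¬ 0 < 3 - D.rInf by omega]

/-- The linear map of the system which determines the unknowns. -/
noncomputable def auxMap (q : Fin D.g → ℂ) (X : Fin D.n → ℂ) :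
    (AuxIndex D → ℂ) →ₗ[ℂ] (AuxEquation D → ℂ) :=
  LinearMap.pi fun e => match e with
    | Sum.inl k => ∑ j, (q j ^ (k : ℕ)) • LinearMap.proj (Sum.inl j)
    | Sum.inr ⟨s, m⟩ => ∑ j, (1 / (q j - X s) ^ ((m : ℕ) + 1)) • LinearMap.proj (Sum.inl j) -
        (if (m : ℕ) = 0 then X s • auxTail D 1 + auxTail D 0 else 0) -
        (if (m : ℕ) = 1 then auxTail D 1 else 0)

theorem auxMap_inl (q : Fin D.g → ℂ) (X : Fin D.n → ℂ) (w : AuxIndex D → ℂ)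
    (k : Fin (D.rInf - 3)) :
    auxMap q X w (Sum.inl k) = ∑ j, (auxOfVec w).μ j * q j ^ (k : ℕ) := by
  simp [auxMap, auxOfVec, mul_comm]

theorem auxMap_inr (q : Fin D.g → ℂ) (X : Fin D.n → ℂ) (w : AuxIndex D → ℂ) (s : Fin D.n)
    (m : Fin (D.r s)) :
    auxMap q X w (Sum.inr ⟨s, m⟩) = ∑ j, (auxOfVec w).μ j / (q j - X s) ^ ((m : ℕ) + 1) -
      (if (m : ℕ) = 0 then X s * (auxOfVec w).a + (auxOfVec w).b else 0) -
      (if (m : ℕ) = 1 then (auxOfVec w).a else 0) := by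
  rw [auxOfVec_a, auxOfVec_b]
  simp only [auxMap, LinearMap.pi_apply, LinearMap.sub_apply, LinearMap.sum_apply,
    LinearMap.smul_apply, LinearMap.proj_apply, smul_eq_mul]
  congr 1
  · congr 1
    · exact Finset.sum_congr rfl fun j _ => by simp only [auxOfVec]; ring
    · split_ifs <;> simp
  · split_ifs <;> simp

theorem auxMap_injective {q : Fin D.g → ℂ} {X : Fin D.n → ℂ} (hX : Function.Injective X)
    (hqi : Function.Injective q) (hq : ∀ j s, q j ≠ X s) : Function.Injective (auxMap q X) := by
  rw [injective_iff_map_eq_zero]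
  intro w hw
  have h3 := D.three_le
  have h1 := D.one_le_rInf
  have hg : D.g = D.rInf + ∑ s, D.r s - 3 := rfl
  have hmain := affineFraction_eq_zero hX D.one_le_r hqi hq (μ := (auxOfVec w).μ)
    (A := (auxOfVec w).a) (B := (auxOfVec w).b) (N := D.rInf - 3)
    (fun k hk => by rw [← auxMap_inl q X w ⟨k, hk⟩, hw]; rfl)
    (fun s i hi => by
      have h := auxMap_inr q X w s ⟨i, hi⟩
      rw [hw] at h
      simp only [Pi.zero_apply] at h
      linear_combination -h)
    (by
      rw [Fintype.card_fin]
      rcases Nat.lt_or_ge D.rInf 3 with h | h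
      · rcases (by omega : D.rInf = 1 ∨ D.rInf = 2) with h2 | h2
        · right; right; omega
        · right; left
          exact ⟨if_neg (by omega), by omega⟩
      · left
        exact ⟨if_neg (by omega), if_neg (by omega), by omega⟩)
  obtain ⟨hμ, hA, hB⟩ := hmain
  rw [auxOfVec_a] at hA
  rw [auxOfVec_b] at hB
  ext e
  rcases e with j | ⟨i, hi⟩
  · exact congrFun hμ j
  · rcases (by omega : i = 0 ∨ i = 1) with rfl | rfl
    · simpa [auxTail, hi] using hB
    · simpa [auxTail, hi] using hA

/-- The system is square, as `g + (3 - r_∞)` and `(r_∞ - 3) + ∑ r_s` agree for truncated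
subtraction; injectivity therefore gives surjectivity. -/
theorem LaxFamily.Generic.exists_solves {F : LaxFamily D} {U : Set (Times D)} (hF : F.Generic U)
    {τ : Times D} (hτ : τ ∈ U) (α : Times D) : ∃ c : AuxCoeff D, c.Solves F τ α := by
  have h3 := D.three_le
  have h1 := D.one_le_rInf
  have hg : D.g = D.rInf + ∑ s, D.r s - 3 := rfl
  have hsurj : Function.Surjective (auxMap (fun j => F.q j τ) (pos τ)) := by
    rw [← LinearMap.injective_iff_surjective_of_finrank_eq_finrank]
    · exact auxMap_injective (hF.pos_inj τ hτ) (hF.q_inj τ hτ) (hF.q_ne_pos τ hτ)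
    · rw [Module.finrank_fintype_fun_eq_card, Module.finrank_fintype_fun_eq_card,
        Fintype.card_sum, Fintype.card_sum, Fintype.card_sigma]
      simp only [Fintype.card_fin]
      omega
  obtain ⟨w, hw⟩ := hsurj fun e => match e with
    | Sum.inl k => nuInf F.θ τ α (k + 1)
    | Sum.inr ⟨s, m⟩ => -nuPole τ α s m
  refine ⟨auxOfVec w, fun k hk => ?_, fun s m hm => ?_⟩
  · have := auxMap_inl (fun j => F.q j τ) (pos τ) w ⟨k, hk⟩
    rw [hw] at this
    exact this.symm
  · rw [Finset.mem_Icc] at hm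
    obtain ⟨i, rfl⟩ : ∃ i, m = i + 1 := ⟨m - 1, by omega⟩
    have := auxMap_inr (fun j => F.q j τ) (pos τ) w s ⟨i, by omega⟩
    rw [hw] at this
    simp only at this
    simp only [Nat.add_sub_cancel, Nat.add_eq_right, Nat.reduceEqDiff]
    linear_combination -this

/-- The coefficientwise equivalence holds for every solution of the auxiliary system, so only
existence of a solution is needed for the converse. -/
theorem isospectral11_iff {F : LaxFamily D} {U : Set (Times D)} (hU : IsOpen U)
    (hF : F.Generic U) {R : Fin D.n → ℕ → Times D → ℂ} {RInf : ℕ → Times D → ℂ}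
    (hR : F.IsCoordR U R RInf)
    (hRd : ∀ s, ∀ k ∈ Finset.Icc 1 (D.r s), DifferentiableOn ℂ (R s k) U)
    (hRInfd : ∀ k < D.rInf - 3, DifferentiableOn ℂ (RInf k) U) :
    Isospectral11 F U ↔ (∀ s, PoleSystem U s (R s)) ∧ InfSystem F.θ U RInf := by
  rw [infSystem_iff, forall_congr' fun s => poleSystem_iff fun τ hτ => hF.lead_ne τ hτ s]
  constructor
  · intro h
    have h1 : ∀ τ ∈ U, ∀ α, (∀ s, delta α (R s 1) τ = 0 ∧ PoleEq s (R s) τ α) ∧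
        InfEq F.θ RInf τ α := by
      intro τ hτ α
      obtain ⟨c, hc, hz⟩ := h τ hτ α
      exact (isospectral_direction_iff hU hF hR hRd hRInfd hτ hc).1 hz
    exact ⟨fun s τ hτ => ⟨fun α => ((h1 τ hτ α).1 s).1, fun α => ((h1 τ hτ α).1 s).2⟩,
      fun τ hτ α => (h1 τ hτ α).2⟩
  · rintro ⟨h1, h2⟩ τ hτ α
    obtain ⟨c, hc⟩ := hF.exists_solves hτ α
    exact ⟨c, hc, (isospectral_direction_iff hU hF hR hRd hRInfd hτ hc).2
      ⟨fun s => ⟨(h1 s τ hτ).1 α, (h1 s τ hτ).2 α⟩, h2 τ hτ α⟩⟩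

end IsoLax

/-! ### Expansion at infinity and the additional relations. -/

namespace IsoLax

open Filter Topology Bornology

section Generic

variable {ι κ : Type*} [Fintype ι] [Fintype κ]

/-- `∑_s ∑_k R_{s,k} (z - X_s)^{-k-1}`. -/
noncomputable def polarSum (X : ι → ℂ) (r : ι → ℕ) (R : ι → ℕ → ℂ) (z : ℂ) : ℂ :=
  ∑ s, ∑ k ∈ Finset.range (r s), R s k / (z - X s) ^ (k + 1)

/-- Coefficients of the polar part of `z ∑_k R_{s,k} (z - X_s)^{-k-1}`. -/
def polarShift (X : ι → ℂ) (R : ι → ℕ → ℂ) (s : ι) (k : ℕ) : ℂ := R s (k + 1) + X s * R s k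

/-- From `z = (z - X) + X`. Iterating, the coefficients of the expansion at infinity are the sums of
the simple-pole coefficients of successive shifts. -/
theorem mul_polarSum {X : ι → ℂ} {r : ι → ℕ} {R : ι → ℕ → ℂ}
    (hR : ∀ s k, r s ≤ k → R s k = 0) {z : ℂ} (hz : ∀ s, z ≠ X s) :
    z * polarSum X r R z = ∑ s, R s 0 + polarSum X r (polarShift X R) z := by
  unfold polarSum
  rw [Finset.mul_sum, ← Finset.sum_add_distrib]
  refine Finset.sum_congr rfl fun s _ => ?_
  have hne : z - X s ≠ 0 := sub_ne_zero.mpr (hz s)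
  have h1 : ∑ k ∈ Finset.range (r s), R s k / (z - X s) ^ k =
      R s 0 + ∑ k ∈ Finset.range (r s), R s (k + 1) / (z - X s) ^ (k + 1) := by
    have h2 := Finset.sum_range_succ (fun k => R s k / (z - X s) ^ k) (r s)
    rw [Finset.sum_range_succ', hR s (r s) le_rfl] at h2
    simp only [pow_zero, div_one, zero_div, add_zero] at h2
    rw [← h2, add_comm]
  simp only [polarShift, add_div, Finset.sum_add_distrib]
  rw [← add_assoc, ← h1, ← Finset.sum_add_distrib, Finset.mul_sum]
  refine Finset.sum_congr rfl fun k _ => ?_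
  rw [pow_succ]
  field_simp
  ring

theorem polarShift_eq_zero {T : Type*} {X : T → ℂ} {r : T → ℕ} {R : T → ℕ → ℂ}
    (hR : ∀ s k, r s ≤ k → R s k = 0) (s : T) (k : ℕ) (hk : r s ≤ k) : polarShift X R s k = 0 := by
  rw [polarShift, hR s k hk, hR s (k + 1) (by omega)]; ring

theorem eventually_cobounded_ne (X : ι → ℂ) : ∀ᶠ z in cobounded ℂ, ∀ s, z ≠ X s := by
  have h := le_cofinite ℂ (Set.finite_range X).compl_mem_cofinite
  filter_upwards [h] with z hz s hs using hz ⟨s, hs.symm⟩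

theorem tendsto_inv_sub_cobounded (a : ℂ) : Tendsto (fun z : ℂ => (z - a)⁻¹) (cobounded ℂ) (𝓝 0) :=
  tendsto_inv₀_cobounded.comp (tendsto_sub_const_cobounded a)

theorem tendsto_polarSum (X : ι → ℂ) (r : ι → ℕ) (R : ι → ℕ → ℂ) :
    Tendsto (polarSum X r R) (cobounded ℂ) (𝓝 0) := by
  unfold polarSum
  have h : Tendsto (fun z => ∑ s, ∑ k ∈ Finset.range (r s), R s k / (z - X s) ^ (k + 1))
      (cobounded ℂ) (𝓝 (∑ s, ∑ k ∈ Finset.range (r s), R s k * 0 ^ (k + 1))) := by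
    refine tendsto_finsetSum _ fun s _ => tendsto_finsetSum _ fun k _ => ?_
    simp only [div_eq_mul_inv, ← inv_pow]
    exact ((tendsto_inv_sub_cobounded (X s)).pow (k + 1)).const_mul _
  simpa using h

theorem tendsto_mul_polarSum {X : ι → ℂ} {r : ι → ℕ} {R : ι → ℕ → ℂ}
    (hR : ∀ s k, r s ≤ k → R s k = 0) :
    Tendsto (fun z => z * polarSum X r R z) (cobounded ℂ) (𝓝 (∑ s, R s 0)) := by
  have h := (tendsto_polarSum X r (polarShift X R)).const_add (∑ s, R s 0)
  rw [add_zero] at h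
  refine h.congr' ?_
  filter_upwards [eventually_cobounded_ne X] with z hz using (mul_polarSum hR hz).symm

/-- `∏ (1 - x q_j) / ∏ (1 - x X_s)^{r_s}`. -/
noncomputable def ratioAtInf (q : κ → ℂ) (X : ι → ℂ) (r : ι → ℕ) (x : ℂ) : ℂ :=
  (∏ j, (1 - x * q j)) / ∏ s, (1 - x * X s) ^ r s

theorem hasDerivAt_ratioAtInf (q : κ → ℂ) (X : ι → ℂ) (r : ι → ℕ) :
    HasDerivAt (ratioAtInf q X r) (-(∑ j, q j - ∑ s, (r s : ℂ) * X s)) 0 := by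
  classical
  have hlin : ∀ a : ℂ, HasDerivAt (fun x : ℂ => 1 - x * a) (-a) 0 := fun a => by
    simpa using ((hasDerivAt_id (0 : ℂ)).mul_const a).const_sub 1
  have hnum : HasDerivAt (fun x => ∏ j, (1 - x * q j)) (-∑ j, q j) 0 := by
    have := HasDerivAt.fun_finsetProd (u := Finset.univ) fun j _ => hlin (q j)
    simpa using this
  have hden : HasDerivAt (fun x => ∏ s, (1 - x * X s) ^ r s) (-∑ s, (r s : ℂ) * X s) 0 := by
    have := HasDerivAt.fun_finsetProd (u := Finset.univ) fun s _ => (hlin (X s)).fun_pow (r s)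
    simpa using this
  have := hnum.fun_div hden (by simp)
  refine this.congr_deriv ?_
  simp
  ring

theorem ratioAtInf_zero (q : κ → ℂ) (X : ι → ℂ) (r : ι → ℕ) : ratioAtInf q X r 0 = 1 := by
  simp [ratioAtInf]

theorem ratioAtInf_inv {q : κ → ℂ} {X : ι → ℂ} {r : ι → ℕ} {a : ℕ}
    (ha : ∑ s, r s = Fintype.card κ + a) {z : ℂ} (hz : z ≠ 0) :
    ratioAtInf q X r z⁻¹ = z ^ a * ((∏ j, (z - q j)) / ∏ s, (z - X s) ^ r s) := by
  have h1 : ∏ j, (z - q j) = z ^ Fintype.card κ * ∏ j, (1 - z⁻¹ * q j) := by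
    rw [← Finset.card_univ, ← Finset.prod_const, ← Finset.prod_mul_distrib]
    exact Finset.prod_congr rfl fun j _ => by field_simp
  have h2 : ∏ s, (z - X s) ^ r s = z ^ (Fintype.card κ + a) * ∏ s, (1 - z⁻¹ * X s) ^ r s := by
    rw [← ha, ← Finset.prod_pow_eq_pow_sum, ← Finset.prod_mul_distrib]
    refine Finset.prod_congr rfl fun s _ => ?_
    rw [← mul_pow]
    congr 1
    field_simp
  rw [h1, h2, ratioAtInf, pow_add]
  have h3 : z ^ Fintype.card κ ≠ 0 := pow_ne_zero _ hz
  have h4 : z ^ a ≠ 0 := pow_ne_zero _ hz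
  rw [← mul_div_assoc, mul_left_comm, mul_assoc (z ^ Fintype.card κ), mul_div_mul_left _ _ h3,
    mul_div_mul_left _ _ h4]

end Generic

variable {D : PoleType}

theorem LaxFamily.tendsto_ratioAtInf (F : LaxFamily D) (τ : Times D) :
    Tendsto (fun z : ℂ => ratioAtInf (fun j => F.q j τ) (pos τ) D.r z⁻¹) (cobounded ℂ) (𝓝 1) := by
  have h := (hasDerivAt_ratioAtInf (fun j => F.q j τ) (pos τ) D.r).continuousAt.tendsto
  rw [ratioAtInf_zero] at h
  exact h.comp tendsto_inv₀_cobounded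

theorem LaxFamily.pow_mul_L12 (F : LaxFamily D) (τ : Times D) {a : ℕ} (ha : ∑ s, D.r s = D.g + a)
    {z : ℂ} (hz : z ≠ 0) :
    z ^ a * F.L12 τ z = F.ω τ * ratioAtInf (fun j => F.q j τ) (pos τ) D.r z⁻¹ := by
  rw [ratioAtInf_inv (by rwa [Fintype.card_fin]) hz, LaxFamily.L12, poleProd]
  ring

theorem LaxFamily.tendsto_pow_mul_L12 (F : LaxFamily D) (τ : Times D) {a : ℕ}
    (ha : ∑ s, D.r s = D.g + a) :
    Tendsto (fun z : ℂ => z ^ a * F.L12 τ z) (cobounded ℂ) (𝓝 (F.ω τ)) := by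
  have h := (F.tendsto_ratioAtInf τ).const_mul (F.ω τ)
  rw [mul_one] at h
  refine h.congr' ?_
  filter_upwards [eventually_ne_cobounded (0 : ℂ)] with z hz using (F.pow_mul_L12 τ ha hz).symm

/-- Each interpolation term is a constant times `∏ (z - q_j)/(z - q_i)`, one order smaller at
infinity than the numerator of `L12`. -/
theorem LaxFamily.tendsto_pow_mul_interp (F : LaxFamily D) (τ : Times D) {a : ℕ}
    (ha : ∑ s, D.r s = D.g + a) :
    Tendsto (fun z : ℂ => z ^ a * (F.interp τ z / poleProd τ z)) (cobounded ℂ) (𝓝 0) := by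
  have h : Tendsto (fun z : ℂ => -∑ i, F.p i τ * poleProd τ (F.q i τ) *
      (∏ j ∈ Finset.univ.erase i, (F.q i τ - F.q j τ)⁻¹) *
      (ratioAtInf (fun j => F.q j τ) (pos τ) D.r z⁻¹ * (z - F.q i τ)⁻¹)) (cobounded ℂ)
      (𝓝 (-∑ i, F.p i τ * poleProd τ (F.q i τ) *
      (∏ j ∈ Finset.univ.erase i, (F.q i τ - F.q j τ)⁻¹) * (1 * 0))) :=
    (tendsto_finsetSum _ fun i _ => ((F.tendsto_ratioAtInf τ).mul
      (tendsto_inv_sub_cobounded (F.q i τ))).const_mul _).neg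
  simp only [mul_zero, Finset.sum_const_zero, neg_zero] at h
  refine h.congr' ?_
  filter_upwards [eventually_ne_cobounded (0 : ℂ),
    eventually_cobounded_ne fun j => F.q j τ] with z hz hq
  rw [LaxFamily.interp, neg_div, mul_neg, Finset.sum_div, Finset.mul_sum]
  congr 1
  refine Finset.sum_congr rfl fun i _ => ?_
  have hne : z - F.q i τ ≠ 0 := sub_ne_zero.mpr (hq i)
  rw [ratioAtInf_inv (by rwa [Fintype.card_fin]) hz,
    ← Finset.mul_prod_erase _ _ (Finset.mem_univ i)]
  simp only [poleProd, div_eq_mul_inv, Finset.prod_mul_distrib]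
  field_simp

theorem LaxFamily.L11_add_L12 (F : LaxFamily D) {τ : Times D} (hω : F.ω τ ≠ 0) (z : ℂ) :
    F.L11 τ z + (tInf F.θ τ (D.rInf - 1) * z + F.g0 τ) / F.ω τ * F.L12 τ z =
      -(F.interp τ z / poleProd τ z) := by
  rw [LaxFamily.L11, LaxFamily.L12]
  field_simp
  ring

/-- The coefficients of the polar part, extended by zero. -/
def polarCoeff (W : Fin D.n → ℕ → Times D → ℂ) (τ : Times D) (s : Fin D.n) (k : ℕ) : ℂ :=
  if k < D.r s then W s (k + 1) τ else 0

theorem polarCoeff_eq_zero (W : Fin D.n → ℕ → Times D → ℂ) (τ : Times D) (s : Fin D.n) (k : ℕ)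
    (hk : D.r s ≤ k) : polarCoeff W τ s k = 0 := if_neg (by omega)

theorem polarSum_polarCoeff (W : Fin D.n → ℕ → Times D → ℂ) (τ : Times D) (z : ℂ) :
    ∑ s, ∑ k ∈ Finset.Icc 1 (D.r s), W s k τ / (z - pos τ s) ^ k =
      polarSum (pos τ) D.r (polarCoeff W τ) z := by
  unfold polarSum
  refine Finset.sum_congr rfl fun s _ => ?_
  rw [sum_Icc_one]
  refine Finset.sum_congr rfl fun k hk => ?_
  rw [polarCoeff, if_pos (Finset.mem_range.mp hk)]

theorem sum_polarCoeff_zero (W : Fin D.n → ℕ → Times D → ℂ) (τ : Times D) :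
    ∑ s, polarCoeff W τ s 0 = ∑ s, W s 1 τ :=
  Finset.sum_congr rfl fun s _ => if_pos (D.one_le_r s)

section Relations

variable {F : LaxFamily D} {U : Set (Times D)} {Q R : Fin D.n → ℕ → Times D → ℂ}
  {QInf RInf : ℕ → Times D → ℂ}

theorem LaxFamily.IsCoordQ.L12_eq (hQ : F.IsCoordQ U Q QInf) (h : D.rInf ≤ 2) {τ : Times D}
    (hτ : τ ∈ U) {z : ℂ} (hz : ∀ s, z ≠ pos τ s) :
    F.L12 τ z = polarSum (pos τ) D.r (polarCoeff Q τ) z := by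
  rw [hQ τ hτ z hz, polarSum_polarCoeff, if_neg (by omega), show D.rInf - 3 = 0 by omega]
  simp

/-- Multiply `L11 + (z + g_0)/ω L12` by `z` and let `z` tend to infinity. The expansion of `L12` is
`ω/z - ω σ/z^2 + …` with `σ` the shift, the slope of `ratioAtInf` at `0` giving the second term;
since `g_0 = θ + σ`, the shift drops out. -/
theorem residue_sum_of_rInf_eq_two (hF : F.Generic U) (hQ : F.IsCoordQ U Q QInf)
    (hR : F.IsCoordR U R RInf) (h : D.rInf = 2) {τ : Times D} (hτ : τ ∈ U) :
    ∑ s, R s 1 τ = -F.θ := by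
  have hω := hF.omega_ne τ hτ
  have h3 := D.three_le
  have ha : ∑ s, D.r s = D.g + 1 := by unfold PoleType.g; omega
  set q0 := polarCoeff Q τ with hq0
  set r0 := polarCoeff R τ with hr0
  have zq : ∀ s k, D.r s ≤ k → q0 s k = 0 := polarCoeff_eq_zero Q τ
  have zr : ∀ s k, D.r s ≤ k → r0 s k = 0 := polarCoeff_eq_zero R τ
  have hX := eventually_cobounded_ne (pos τ)
  have hm0 : ∑ s, q0 s 0 = F.ω τ := by
    refine tendsto_nhds_unique ((tendsto_mul_polarSum (X := pos τ) zq).congr' ?_) (F.tendsto_pow_mul_L12 τ ha)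
    filter_upwards [hX] with z hz
    rw [pow_one, hQ.L12_eq (by omega) hτ hz]
  have hslope := (hasDerivAt_iff_tendsto_slope.mp
    (hasDerivAt_ratioAtInf (fun j => F.q j τ) (pos τ) D.r)).comp tendsto_inv₀_cobounded'
  have hm1 : ∑ s, polarShift (pos τ) q0 s 0 = F.ω τ * -F.shift τ := by
    refine tendsto_nhds_unique ((tendsto_mul_polarSum (X := pos τ) (polarShift_eq_zero (X := pos τ) zq)))
      ((hslope.const_mul (F.ω τ)).congr' ?_)
    filter_upwards [hX, eventually_ne_cobounded (0 : ℂ)] with z hz hz0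
    have h4 := F.pow_mul_L12 τ ha hz0
    rw [pow_one, hQ.L12_eq (by omega) hτ hz, mul_polarSum zq hz, hm0] at h4
    simp only [Function.comp_apply, slope_def_field, ratioAtInf_zero, sub_zero]
    rw [div_inv_eq_mul]
    linear_combination (-z) * h4
  have htI : tInf F.θ τ (D.rInf - 1) = 1 := tInf_lead F.θ τ (by omega)
  have hL11 : ∀ z, (∀ s, z ≠ pos τ s) → F.L11 τ z = polarSum (pos τ) D.r r0 z - 1 := by
    intro z hz
    rw [hR τ hτ z hz, polarSum_polarCoeff, if_pos (by omega), if_neg (by omega), htI,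
      show D.rInf - 3 = 0 by omega, show D.rInf - 2 = 0 by omega]
    simp [hr0]
  have hlim := (((tendsto_mul_polarSum zr (X := pos τ)).add
    ((tendsto_mul_polarSum (X := pos τ) (polarShift_eq_zero (X := pos τ) zq)).const_mul (F.ω τ)⁻¹)).add
    ((F.tendsto_pow_mul_L12 τ ha).const_mul (F.g0 τ / F.ω τ)))
  have h0 := (F.tendsto_pow_mul_interp τ ha).neg
  have heq := tendsto_nhds_unique (hlim.congr' (by
    filter_upwards [hX] with z hz
    have h5 := F.L11_add_L12 hω z
    rw [htI, hL11 z hz] at h5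
    have h6 := mul_polarSum (X := pos τ) zq hz
    rw [← hQ.L12_eq (by omega) hτ hz, hm0] at h6
    have h7 : polarSum (pos τ) D.r (polarShift (pos τ) q0) z = z * F.L12 τ z - F.ω τ := by
      rw [h6]; ring
    rw [pow_one, ← mul_neg, ← h5, h7]
    field_simp
    ring)) h0
  have hg0 : F.g0 τ = F.θ + F.shift τ := by
    unfold LaxFamily.g0
    rw [if_pos (by omega), htI, show D.rInf - 2 = 0 by omega]
    simp [tInf]
  rw [hm1, hr0, sum_polarCoeff_zero, hg0] at heq
  field_simp at heq
  linear_combination heq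

/-- Here `L12` decays like `ω/z^2`. Multiplying `L11 + (θ z + g_0)/ω L12` by `z^2` leaves an affine
function of `z` plus a term tending to zero. The limit is `0`, so both coefficients vanish, which
gives the two relations. -/
theorem moments_of_rInf_eq_one (hF : F.Generic U) (hQ : F.IsCoordQ U Q QInf)
    (hR : F.IsCoordR U R RInf) (h : D.rInf = 1) {τ : Times D} (hτ : τ ∈ U) :
    ∑ s, R s 1 τ = -F.θ ∧
      ∑ s, pos τ s * R s 1 τ + ∑ s, (if 2 ≤ D.r s then R s 2 τ else 0) =
        -F.g0 τ - F.θ / F.ω τ * thirdMoment Q τ := by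
  have hω := hF.omega_ne τ hτ
  have h3 := D.three_le
  have ha : ∑ s, D.r s = D.g + 2 := by unfold PoleType.g; omega
  set q0 := polarCoeff Q τ with hq0
  set r0 := polarCoeff R τ with hr0
  have zq : ∀ s k, D.r s ≤ k → q0 s k = 0 := polarCoeff_eq_zero Q τ
  have zr : ∀ s k, D.r s ≤ k → r0 s k = 0 := polarCoeff_eq_zero R τ
  have hX := eventually_cobounded_ne (pos τ)
  have hn0 := eventually_ne_cobounded (0 : ℂ)
  have hL12 := F.tendsto_pow_mul_L12 τ ha
  have hm0 : ∑ s, q0 s 0 = 0 := by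
    have h1 := tendsto_inv₀_cobounded.mul hL12
    rw [zero_mul] at h1
    refine tendsto_nhds_unique ((tendsto_mul_polarSum (X := pos τ) zq).congr' ?_) h1
    filter_upwards [hX, hn0] with z hz hz0
    rw [hQ.L12_eq (by omega) hτ hz, ← hq0]
    field_simp
  have hs1 : ∀ z, (∀ s, z ≠ pos τ s) →
      z * F.L12 τ z = polarSum (pos τ) D.r (polarShift (pos τ) q0) z := by
    intro z hz
    rw [hQ.L12_eq (by omega) hτ hz, mul_polarSum zq hz, hm0, zero_add]
  have hm1 : ∑ s, polarShift (pos τ) q0 s 0 = F.ω τ := by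
    refine tendsto_nhds_unique ((tendsto_mul_polarSum (X := pos τ) (polarShift_eq_zero (X := pos τ) zq)).congr' ?_) hL12
    filter_upwards [hX] with z hz
    rw [← hs1 z hz]; ring
  have htI : tInf F.θ τ (D.rInf - 1) = F.θ := by
    rw [show D.rInf - 1 = 0 by omega]; simp [tInf]
  have hL11 : ∀ z, (∀ s, z ≠ pos τ s) → F.L11 τ z = polarSum (pos τ) D.r r0 z := by
    intro z hz
    rw [hR τ hτ z hz, polarSum_polarCoeff, if_neg (by omega), if_neg (by omega),
      show D.rInf - 3 = 0 by omega]
    simp [hr0]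
  set c : ℂ := ∑ s, polarShift (pos τ) r0 s 0 +
    F.θ / F.ω τ * ∑ s, polarShift (pos τ) (polarShift (pos τ) q0) s 0 +
    F.g0 τ / F.ω τ * F.ω τ with hc
  have hlim : Tendsto (fun z => z * polarSum (pos τ) D.r (polarShift (pos τ) r0) z +
      F.θ / F.ω τ * (z * polarSum (pos τ) D.r (polarShift (pos τ) (polarShift (pos τ) q0)) z) +
      F.g0 τ / F.ω τ * (z ^ 2 * F.L12 τ z)) (cobounded ℂ) (𝓝 c) :=
    ((tendsto_mul_polarSum (X := pos τ) (polarShift_eq_zero (X := pos τ) zr)).add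
    ((tendsto_mul_polarSum (X := pos τ) (polarShift_eq_zero (X := pos τ) (polarShift_eq_zero zq))).const_mul _)).add
    (hL12.const_mul _)
  have h0 := ((F.tendsto_pow_mul_interp τ ha).neg.sub hlim).congr' (f₂ := fun z =>
      z * (∑ s, r0 s 0 + F.θ)) (by
    filter_upwards [hX] with z hz
    have h5 := F.L11_add_L12 hω z
    rw [htI, hL11 z hz] at h5
    have h6 := mul_polarSum (X := pos τ) zr hz
    have h7 := mul_polarSum (X := pos τ) (polarShift_eq_zero (X := pos τ) zq) hz
    rw [← hs1 z hz, hm1] at h7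
    have h8 : polarSum (pos τ) D.r (polarShift (pos τ) (polarShift (pos τ) q0)) z =
        z * (z * F.L12 τ z) - F.ω τ := by rw [h7]; ring
    have h9 : polarSum (pos τ) D.r (polarShift (pos τ) r0) z =
        z * polarSum (pos τ) D.r r0 z - ∑ s, r0 s 0 := by rw [h6]; ring
    rw [← mul_neg, ← h5, h8, h9]
    field_simp
    ring)
  -- A linear function of `z` with a finite limit at infinity has slope zero; dividing by `z`
  -- extracts the slope.
  have hres : ∑ s, r0 s 0 + F.θ = 0 := by
    have h1 := tendsto_inv₀_cobounded.mul h0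
    rw [zero_mul] at h1
    refine tendsto_nhds_unique (tendsto_const_nhds.congr' ?_) h1
    filter_upwards [hn0] with z hz0
    field_simp
  rw [hres] at h0
  simp only [mul_zero] at h0
  have hc0 : c = 0 := by
    have := tendsto_nhds_unique h0 tendsto_const_nhds
    linear_combination -this
  rw [hr0, sum_polarCoeff_zero] at hres
  refine ⟨by linear_combination hres, ?_⟩
  have e1 : ∑ s, polarShift (pos τ) r0 s 0 =
      ∑ s, pos τ s * R s 1 τ + ∑ s, (if 2 ≤ D.r s then R s 2 τ else 0) := by
    rw [← Finset.sum_add_distrib]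
    refine Finset.sum_congr rfl fun s _ => ?_
    have h1 : polarCoeff R τ s 0 = R s 1 τ := if_pos (D.one_le_r s)
    have h2 : polarCoeff R τ s 1 = if 2 ≤ D.r s then R s 2 τ else 0 := rfl
    rw [polarShift, hr0, h1, h2, add_comm]
  have e2 : ∑ s, polarShift (pos τ) (polarShift (pos τ) q0) s 0 = thirdMoment Q τ := by
    unfold thirdMoment
    refine Finset.sum_congr rfl fun s _ => ?_
    have h1 : polarCoeff Q τ s 0 = Q s 1 τ := if_pos (D.one_le_r s)
    have h2 : polarCoeff Q τ s 1 = if 2 ≤ D.r s then Q s 2 τ else 0 := rfl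
    have h4 : polarCoeff Q τ s 2 = if 3 ≤ D.r s then Q s 3 τ else 0 := rfl
    simp only [polarShift, hq0, zero_add, Nat.reduceAdd, h1, h2, h4]
    by_cases h5 : 2 ≤ D.r s
    · simp only [if_pos h5]; ring
    · simp only [if_neg h5]; ring
  rw [hc, e1, e2, div_mul_cancel₀ _ hω] at hc0
  linear_combination hc0

end Relations

/-- The last row of the triangular relation is the one for `W_2`; it is absent for a simple pole. -/
theorem PoleForm.sum_eq {U : Set (Times D)} {s : Fin D.n}
    {f : ℕ → ℕ → ℕ → ℂ → (ℕ → ℂ) → ℂ} {l : Times D → ℂ} {W : ℕ → Times D → ℂ} {v : ℕ → ℂ}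
    (h : PoleForm f U s l W v) {τ : Times D} (hτ : τ ∈ U) :
    ∑ j ∈ Finset.Icc 1 (D.r s - 1), f (D.r s) (D.r s - 1) j (l τ) (tPole τ s) *
      v (D.r s + 1 - j) = if 2 ≤ D.r s then W 2 τ else 0 := by
  split_ifs with h2
  · have := (h τ hτ).2 (D.r s - 1) (by rw [Finset.mem_Icc]; omega)
    rw [← this, show D.r s + 1 - (D.r s - 1) = 2 by omega]
  · rw [show D.r s - 1 = 0 by omega]
    simp

end IsoLax

/-! ### Assembly of the main theorem. -/

open IsoLax in
theorem theorem5p4 :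
    ∃ (f : ℕ → ℕ → ℕ → ℂ → (ℕ → ℂ) → ℂ) (g : ℕ → ℕ → ℕ → (ℕ → ℂ) → ℂ),
      PoleTable f ∧ InfTable g ∧
      ∀ (D : PoleType) (U : Set (Times D)) (F : LaxFamily D)
        (Q R : Fin D.n → ℕ → Times D → ℂ) (QInf RInf : ℕ → Times D → ℂ),
        IsOpen U → F.Generic U → F.IsCoordQ U Q QInf → F.IsCoordR U R RInf →
        (∀ s, ∀ k ∈ Finset.Icc 1 (D.r s), DifferentiableOn ℂ (R s k) U) →
        (∀ k < D.rInf - 3, DifferentiableOn ℂ (RInf k) U) →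
        -- the isospectral condition is equivalent to the differential systems
        (Isospectral11 F U ↔ (∀ s, PoleSystem U s (R s)) ∧ InfSystem F.θ U RInf) ∧
        (IsConnected U → ∀ ℓ : Fin D.n → Times D → ℂ, IsLogBranch U ℓ →
          -- general solution of the system at each finite pole
          (∀ (s : Fin D.n) (W : ℕ → Times D → ℂ),
            (∀ k ∈ Finset.Icc 1 (D.r s), DifferentiableOn ℂ (W k) U) →
            (PoleSystem U s W ↔ ∃ v : ℕ → ℂ, PoleForm f U s (ℓ s) W v)) ∧
          -- general solution of the system at infinity
          (∀ W : ℕ → Times D → ℂ, (∀ k < D.rInf - 3, DifferentiableOn ℂ (W k) U) →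
            (InfSystem F.θ U W ↔ ∃ v : ℕ → ℂ, InfForm g F.θ U W v)) ∧
          -- the coordinates `R` under the isospectral condition
          (Isospectral11 F U ↔ ∃ (v : Fin D.n → ℕ → ℂ) (vInf : ℕ → ℂ),
            (∀ s, PoleForm f U s (ℓ s) (R s) (v s)) ∧ InfForm g F.θ U RInf vInf) ∧
          -- the additional relations
          ∀ v : Fin D.n → ℕ → ℂ, (∀ s, PoleForm f U s (ℓ s) (R s) (v s)) →
            (D.rInf ≤ 2 → ∑ s, v s 1 = -F.θ) ∧
            (D.rInf = 1 → ∀ τ ∈ U,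
              ∑ s, pos τ s * v s 1 + ∑ s, ∑ j ∈ Finset.Icc 1 (D.r s - 1),
                  f (D.r s) (D.r s - 1) j (ℓ s τ) (tPole τ s) * v s (D.r s + 1 - j) =
                -F.g0 τ - F.θ / F.ω τ * thirdMoment Q τ)) := by
  refine ⟨poleTable, infTable, poleTable_spec, infTable_spec, ?_⟩
  intro D U F Q R QInf RInf hU hF hQ hR hRd hRInfd
  have hiso := isospectral11_iff hU hF hR hRd hRInfd
  refine ⟨hiso, fun hconn ℓ hℓ => ?_⟩
  have hpole := fun (s : Fin D.n) (W : ℕ → Times D → ℂ)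
      (hW : ∀ k ∈ Finset.Icc 1 (D.r s), DifferentiableOn ℂ (W k) U) =>
    poleSystem_iff_exists_poleForm hU hconn (hℓ s) hW
  have hinf := fun (W : ℕ → Times D → ℂ)
      (hW : ∀ k < D.rInf - 3, DifferentiableOn ℂ (W k) U) =>
    infSystem_iff_exists_infForm (θ := F.θ) hU hconn hW
  refine ⟨hpole, hinf, ?_, fun v hv => ⟨fun h => ?_, fun h τ hτ => ?_⟩⟩
  · rw [hiso, hinf RInf hRInfd]
    constructor
    · rintro ⟨h1, vInf, h2⟩
      choose v hv using fun s => (hpole s (R s) (hRd s)).1 (h1 s)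
      exact ⟨v, vInf, hv, h2⟩
    · rintro ⟨v, vInf, h1, h2⟩
      exact ⟨fun s => (hpole s (R s) (hRd s)).2 ⟨v s, h1 s⟩, vInf, h2⟩
  · obtain ⟨τ, hτ⟩ := hconn.nonempty
    have h1 := D.one_le_rInf
    simp only [← (hv _ τ hτ).1]
    rcases (by omega : D.rInf = 1 ∨ D.rInf = 2) with h2 | h2
    · exact (moments_of_rInf_eq_one hF hQ hR h2 hτ).1
    · exact residue_sum_of_rInf_eq_two hF hQ hR h2 hτ
  · simp only [(hv _).sum_eq hτ, ← (hv _ τ hτ).1]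
    exact (moments_of_rInf_eq_one hF hQ hR h hτ).2
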